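/- **Theorem 4.1.** Let $n=2^k$. A *tournament* on $n$ players is a complete oriented graph, where an edge $(u,w)$ means that $u$ beats $w$. A *seeding* is a bijection from the $n$ leaves of the balanced $k$-round single-elimination bracket to the players. It is a *winning seeding* for $v$ if $v$ wins the resulting single-elimination tournament, and $v$ is an *SE winner* if it has a winning seeding. In the *Condorcet Random Model* with ordering $\sigma$ of the players and noise $p<1/2$, independently for each pair of players $u,w$ such that $u$ occurs before $w$ in the ordering, $u$ beats $w$ with probability $1-p$, and $w$ beats $u$ otherwise. (1) There is an algorithm which takes as input a tournament $T$ on $n=2^k$ players and a player $v$ (but neither $\sigma$ nor $p$), whose number of steps on a random-access machine with unit-cost addition and subtraction is at most a polynomial in $n$ on every such input, and which has the following property. There is an absolute constant $c>0$ such that for every $C\ge 64$ there is an $n_C$ such that for every power of two $n=2^k>n_C$, every ordering $\sigma$ of the $n$ players and every $p$ with $C\ln n/n\le p<1/2$, with probability at least $1-\frac{1}{c\,n^2}$ over the tournament $T$ drawn from the Condorcet Random Model with ordering $\sigma$ and noise $p$, the algorithm outputs, for every player $v$, a winning seeding for $v$ over $T$. (2) The noise level in (1) is optimal up to constants: there is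 an absolute constant $\varepsilon>0$ such that, for all orderings $\sigma_k$ of $2^k$ players and all noise levels $p_k\in[0,1]$ with $p_k\le \varepsilon\ln(2^k)/2^k$ for all sufficiently large $k$ (in particular whenever $p_k=o(\ln(2^k)/2^k)$), the probability that the weakest player (the last one in $\sigma_k$) of the Condorcet Random Model tournament on $2^k$ players with ordering $\sigma_k$ and noise $p_k$ is not an SE winner, that is, has no winning seeding at all, tends to $1$ as $k\to\infty$. -/

import Mathlib

open Filter Topology MeasureTheory ProbabilityTheory

namespace SETournament

/-! ### Tournaments and single-elimination brackets -/

/-- A tournament (complete oriented graph) on the player set `V`: `T.beats u w` is `true` exactly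
when `(u, w)` is an edge, i.e. `u` wins the match between `u` and `w`. -/
structure Tournament (V : Type*) where
  beats : V → V → Bool
  beats_self : ∀ u, beats u u = false
  beats_swap : ∀ u w, u ≠ w → beats w u = !beats u w

/-- The winner of the match between `u` and `w`. -/
def Tournament.matchWinner {V : Type*} (T : Tournament V) (u w : V) : V :=
  if T.beats u w then u else w

/-- The winner of the balanced single-elimination tournament with `k` rounds in which the player
`s i` starts at the leaf `i` of the bracket: the winners of the two half-brackets (leaves
`0, …, 2 ^ k - 1` and leaves `2 ^ k, …, 2 ^ (k + 1) - 1`) meet in the final. -/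
def Tournament.champion {V : Type*} (T : Tournament V) : (k : ℕ) → (Fin (2 ^ k) → V) → V
  | 0, s => s ⟨0, by norm_num⟩
  | k + 1, s =>
      T.matchWinner
        (T.champion k fun i => s ⟨i, by have := i.isLt; rw [pow_succ]; omega⟩)
        (T.champion k fun i => s ⟨2 ^ k + i, by have := i.isLt; rw [pow_succ]; omega⟩)

/-- The seeding `s` (a bijection from the leaves of the bracket to the `2 ^ k` players) is a
winning seeding for `v`. -/
def IsWinningSeeding {k : ℕ} (T : Tournament (Fin (2 ^ k))) (v : Fin (2 ^ k))
    (s : Equiv.Perm (Fin (2 ^ k))) : Prop :=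
  T.champion k s = v

/-- `v` is an SE winner: some seeding makes `v` win. -/
def IsSEWinner {k : ℕ} (T : Tournament (Fin (2 ^ k))) (v : Fin (2 ^ k)) : Prop :=
  ∃ s : Equiv.Perm (Fin (2 ^ k)), IsWinningSeeding T v s

/-! ### The Condorcet Random Model -/

/-- Outcomes of the random experiment for `n` players: for every pair of ranks `i < j`, whether
the match between the players of these ranks is an upset. -/
abbrev Upsets (n : ℕ) : Type := {e : Fin n × Fin n // e.1 < e.2} → Bool

/-- Every match is an upset with probability `p`, independently of all others. -/
noncomputable def upsetMeasure (n : ℕ) (p : unitInterval) : Measure (Upsets n) :=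
  Measure.pi fun _ => bernoulliMeasure true false p

/-- The tournament drawn from the Condorcet Random Model. The underlying ordering is `σ`: the
player `u` has rank `σ u`, and rank `0` is the strongest. If `u` occurs before `w` in
the ordering, then `u` beats `w` unless their match is an upset. -/
def crTournament {n : ℕ} (σ : Equiv.Perm (Fin n)) (ω : Upsets n) : Tournament (Fin n) where
  beats u w :=
    if h : σ u < σ w then !ω ⟨(σ u, σ w), h⟩
    else if h : σ w < σ u then ω ⟨(σ w, σ u), h⟩
    else false
  beats_self u := by simp
  beats_swap u w huw := by
    have hne : σ u ≠ σ w := fun h => huw (σ.injective h)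
    rcases lt_or_gt_of_ne hne with h | h
    · simp [h, h.not_gt]
    · simp [h, h.not_gt]

/-- The weakest player: the last one in the ordering `σ`. -/
def weakest {k : ℕ} (σ : Equiv.Perm (Fin (2 ^ k))) : Fin (2 ^ k) :=
  σ.symm ⟨2 ^ k - 1, Nat.sub_lt (Nat.two_pow_pos k) one_pos⟩

/-! ### Random-access machine programs with a step count

Programs work on scalar variables and on arrays of natural numbers and have random access to the
read-only input matrix. The arithmetic operations are addition and truncated subtraction only, at
unit cost; a step therefore makes the numbers longer by at most one bit, and polynomial time for
these programs is polynomial time on Turing machines. -/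

/-- The work memory: scalar variables and one-dimensional arrays, both named by numbers. -/
structure Memory where
  var : ℕ → ℕ
  arr : ℕ → ℕ → ℕ

/-- Expressions: constants, variables, array entries, entries of the input matrix, sums, and
truncated differences. -/
inductive Expr where
  | const (c : ℕ)
  | var (x : ℕ)
  | arr (a : ℕ) (i : Expr)
  | input (i j : Expr)
  | add (d e : Expr)
  | sub (d e : Expr)

/-- The value of an expression, for the input matrix `M`. -/
def Expr.eval (M : ℕ → ℕ → ℕ) (m : Memory) : Expr → ℕ
  | const c => c
  | var x => m.var x
  | arr a i => m.arr a (i.eval M m)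
  | input i j => M (i.eval M m) (j.eval M m)
  | add d e => d.eval M m + e.eval M m
  | sub d e => d.eval M m - e.eval M m

/-- The number of steps needed to evaluate an expression: one for each of its nodes. -/
def Expr.cost : Expr → ℕ
  | const _ => 1
  | var _ => 1
  | arr _ i => i.cost + 1
  | input i j => i.cost + j.cost + 1
  | add d e => d.cost + e.cost + 1
  | sub d e => d.cost + e.cost + 1

/-- Programs. The conditions of `branch` and `loop` are true when their value is nonzero. -/
inductive Program where
  /-- do nothing -/
  | skip
  /-- assign the value of `e` to the variable `x` -/
  | assign (x : ℕ) (e : Expr)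
  /-- write the value of `e` into entry `i` of the array `a` -/
  | store (a : ℕ) (i e : Expr)
  /-- run `P`, then `Q` -/
  | seq (P Q : Program)
  /-- if `e` then `P` else `Q` -/
  | branch (e : Expr) (P Q : Program)
  /-- while `e` do `P` -/
  | loop (e : Expr) (P : Program)

/-- `Exec M P m t m'`: on the input matrix `M`, the program `P` started with the memory `m` halts
after exactly `t` steps with the memory `m'`. -/
inductive Exec (M : ℕ → ℕ → ℕ) : Program → Memory → ℕ → Memory → Prop
  | skip (m : Memory) : Exec M .skip m 1 m
  | assign (x : ℕ) (e : Expr) (m : Memory) :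
      Exec M (.assign x e) m (e.cost + 1)
        { m with var := Function.update m.var x (e.eval M m) }
  | store (a : ℕ) (i e : Expr) (m : Memory) :
      Exec M (.store a i e) m (i.cost + e.cost + 1)
        { m with
          arr := Function.update m.arr a
            (Function.update (m.arr a) (i.eval M m) (e.eval M m)) }
  | seq {P Q : Program} {m m' m'' : Memory} {t t' : ℕ} :
      Exec M P m t m' → Exec M Q m' t' m'' → Exec M (.seq P Q) m (t + t') m''
  | branch_true {e : Expr} {P Q : Program} {m m' : Memory} {t : ℕ} :
      e.eval M m ≠ 0 → Exec M P m t m' → Exec M (.branch e P Q) m (e.cost + 1 + t) m'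
  | branch_false {e : Expr} {P Q : Program} {m m' : Memory} {t : ℕ} :
      e.eval M m = 0 → Exec M Q m t m' → Exec M (.branch e P Q) m (e.cost + 1 + t) m'
  | loop_done {e : Expr} {P : Program} {m : Memory} :
      e.eval M m = 0 → Exec M (.loop e P) m (e.cost + 1) m
  | loop_step {e : Expr} {P : Program} {m m' m'' : Memory} {t t' : ℕ} :
      e.eval M m ≠ 0 → Exec M P m t m' → Exec M (.loop e P) m' t' m'' →
      Exec M (.loop e P) m (e.cost + 1 + t + t') m''

/-- The input matrix of a tournament: its adjacency matrix, with `0` outside the range. -/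
def inputMatrix {n : ℕ} (T : Tournament (Fin n)) (i j : ℕ) : ℕ :=
  if h : i < n ∧ j < n then (T.beats ⟨i, h.1⟩ ⟨j, h.2⟩).toNat else 0

/-- The initial memory: the number of players in variable `0`, the player of interest in
variable `1`, and `0` everywhere else. -/
def initialMemory {n : ℕ} (v : Fin n) : Memory where
  var x := if x = 0 then n else if x = 1 then v else 0
  arr _ _ := 0

/-- On the tournament `T` and the player `v`, the program halts after exactly `t` steps. -/
def Program.HaltsIn (P : Program) {n : ℕ} (T : Tournament (Fin n)) (v : Fin n) (t : ℕ) : Prop :=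
  ∃ m, Exec (inputMatrix T) P (initialMemory v) t m

/-- On the tournament `T` and the player `v`, the program halts and has written the seeding `s`
into the array `0`: entry `i` is the player at leaf `i`. -/
def Program.Outputs (P : Program) {n : ℕ} (T : Tournament (Fin n)) (v : Fin n)
    (s : Equiv.Perm (Fin n)) : Prop :=
  ∃ t m, Exec (inputMatrix T) P (initialMemory v) t m ∧ ∀ i : Fin n, m.arr 0 i = s i

/-- The program runs in polynomial time on tournaments whose number of players is a power of two:
some polynomial in the number `2 ^ k` of players bounds its number of steps on every tournament
and for every player of interest. -/
def Program.IsPolyTime (P : Program) : Prop :=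
  ∃ q : Polynomial ℕ, ∀ (k : ℕ) (T : Tournament (Fin (2 ^ k))) (v : Fin (2 ^ k)),
    ∃ t ≤ q.eval (2 ^ k), P.HaltsIn T v t

end SETournament

open SETournament

/-!
The winning seedings come from two structural properties, domination and expansion, which hold for
all players with high probability. They do not refer to the noise, and the algorithm that exploits
them need not know the ordering.

Let `A` be the set of players that `v` beats. If every player who beats `v` loses to at least `k`
players of `A` (`IsSuperking`), then `v` wins a tournament of `k` rounds: in each round `v` plays a
member of `A`, as many further members of `A` as possible beat players who beat `v`, and everyone
else is paired greedily. If a player `x` who beats `v` survives, then `x` did not lose to any of the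
members of `A` that beat it, because they all won their matches, and they survive; only the opponent
of `v` is lost, so that `k - 1` of them are left for the `k - 1` rounds that follow.

Weak players are not superkings at first, but one round can turn them into superkings. Some set `Q`
of strong players contains all players who beat `v` and lose to fewer than `k` members of `A`
(`IsDominated`); these have to lose in the first round. If `A` has at least `n / 4` members, match
them with members of `A` that beat them. If `A` is smaller, match them with other players who
beat them and also beat `v`, and at the same time match all of `A` with players that they beat and
who beat `v`, so that no member of `A` is lost, except
the opponent of `v`. In both cases a bipartite matching of one side (the
bidders) into the other (the objects) is needed, where `x` and `y` are adjacent if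
`v` beats `x` if and only if `x` beats `y`. Expansion gives Hall's condition, that no set of bidders
has fewer neighbours than members (`IsExpanding.hallCondition`). The matching is found by an auction (`Auction`), in which every bidder
without an object bids for a cheapest object that it wants. The owner of an object of price `q` has
no neighbour of price less than `q - 1`; if a bidder cannot bid below `n`, there is an
empty level of prices, and the bidders who own the objects above that level, together with the
unsuccessful one, violate Hall's condition. As every bid raises a price by one, `n ^ 2` sweeps
suffice. The round as a whole is `Algo.round_spec`, and `Algo.main_outputs` puts the rounds
together.
The algorithm is written in a language of counting loops (`Cmd`), for which termination and a
polynomial time bound are read off from the syntax (`Cmd.exec`).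

Let `Q` consist of the strongest `5 / 32` of the players. Domination by `k` players holds for all
pairs by a Chernoff bound (`prob_few_common`), since a member of `Q` beats a given player outside
`Q` with probability `1 - p`, and loses to `v` with probability at least `p`. For the expansion of the
bidders, fix `A` first. Then the matches between possible bidders and objects are still independent,
there are more objects than bidders by `3 * n / 32`, and for each match adjacency fails with
probability at most `1 - p`; a union bound over all sets of bidders and all sets that might contain
their neighbours gives `prob_not_isExpanding_le`.

The optimality of the noise level is a union bound too. A champion beats `k` players, and the weakest
player beats `k` given players with probability `p ^ k`. Hence it can be champion with probability at
most `(2 ^ k).choose k * p ^ k`, which tends to `0` if `p ≤ log (2 ^ k) / (4 * 2 ^ k)`.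
-/

namespace SETournament

/-! ### Programs built from counting loops -/

/-- Programs whose only loops are counting loops that run through `0, …, n - 1`, where `n` is the
value of variable `0`. Such programs always halt, so they have a total semantics `Cmd.run`, and
their running time is bounded by a polynomial in `n` that is read off from the syntax. -/
inductive Cmd where
  | skip
  | assign (x : ℕ) (e : Expr)
  | store (a : ℕ) (i e : Expr)
  | seq (c d : Cmd)
  | ite (e : Expr) (c d : Cmd)
  | rep (x : ℕ) (c : Cmd)

/-- Overwrite a variable. -/
def Memory.setVar (m : Memory) (x a : ℕ) : Memory :=
  { m with var := Function.update m.var x a }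

/-- Overwrite an array entry. -/
def Memory.setArr (m : Memory) (a i e : ℕ) : Memory :=
  { m with arr := Function.update m.arr a (Function.update (m.arr a) i e) }

@[simp] lemma Memory.setVar_var (m : Memory) (x a y : ℕ) :
    (m.setVar x a).var y = if y = x then a else m.var y := by
  simp [Memory.setVar, Function.update_apply]

@[simp] lemma Memory.setVar_arr (m : Memory) (x a : ℕ) : (m.setVar x a).arr = m.arr := rfl

@[simp] lemma Memory.setArr_var (m : Memory) (a i e : ℕ) : (m.setArr a i e).var = m.var := rfl

lemma Memory.setArr_arr_ne (m : Memory) {a b : ℕ} (i e : ℕ) (h : b ≠ a) :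
    (m.setArr a i e).arr b = m.arr b := by
  simp [Memory.setArr, h]

@[simp] lemma Memory.setArr_arr (m : Memory) (a i e b j : ℕ) :
    (m.setArr a i e).arr b j = if b = a then if j = i then e else m.arr b j else m.arr b j := by
  by_cases h : b = a
  · subst h; simp [Memory.setArr, Function.update_apply]
  · simp [Memory.setArr, h]

namespace Cmd

/-- The translation into the language of the machine. -/
def toProgram : Cmd → Program
  | skip => .skip
  | assign x e => .assign x e
  | store a i e => .store a i e
  | seq c d => .seq c.toProgram d.toProgram
  | ite e c d => .branch e c.toProgram d.toProgram
  | rep x c =>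
      .seq (.assign x (.const 0))
        (.loop (.sub (.var 0) (.var x))
          (.seq c.toProgram (.assign x (.add (.var x) (.const 1)))))

/-- The variables that a command may change. -/
def assigned : Cmd → List ℕ
  | skip => []
  | assign x _ => [x]
  | store _ _ _ => []
  | seq c d => c.assigned ++ d.assigned
  | ite _ c d => c.assigned ++ d.assigned
  | rep x c => x :: c.assigned

/-- The arrays that a command may change. -/
def stored : Cmd → List ℕ
  | skip => []
  | assign _ _ => []
  | store a _ _ => [a]
  | seq c d => c.stored ++ d.stored
  | ite _ c d => c.stored ++ d.stored
  | rep _ c => c.stored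

/-- A command is well-formed if it never changes variable `0`, and if no loop body changes the
counter of its loop. -/
def Wf : Cmd → Prop
  | skip => True
  | assign x _ => x ≠ 0
  | store _ _ _ => True
  | seq c d => c.Wf ∧ d.Wf
  | ite _ c d => c.Wf ∧ d.Wf
  | rep x c => x ≠ 0 ∧ x ∉ c.assigned ∧ c.Wf

/-- The memory after `i` passes of a counting loop with counter `x` whose body acts by `f`. -/
def iter (f : Memory → Memory) (x : ℕ) (m : Memory) : ℕ → Memory
  | 0 => m.setVar x 0
  | i + 1 => (f (iter f x m i)).setVar x (i + 1)

/-- The memory in which a command halts. -/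
def run (M : ℕ → ℕ → ℕ) : Cmd → Memory → Memory
  | skip, m => m
  | assign x e, m => m.setVar x (e.eval M m)
  | store a i e, m => m.setArr a (i.eval M m) (e.eval M m)
  | seq c d, m => d.run M (c.run M m)
  | ite e c d, m => if e.eval M m ≠ 0 then c.run M m else d.run M m
  | rep x c, m => iter (c.run M) x m (m.var 0)

/-- A polynomial bound for the running time, in terms of the value of variable `0`. -/
noncomputable def time : Cmd → Polynomial ℕ
  | skip => 1
  | assign _ e => Polynomial.C (e.cost + 1)
  | store _ i e => Polynomial.C (i.cost + e.cost + 1)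
  | seq c d => c.time + d.time
  | ite e c d => Polynomial.C (e.cost + 1) + (c.time + d.time)
  | rep _ c => 6 + Polynomial.X * (c.time + 8)

variable {M : ℕ → ℕ → ℕ}

lemma run_var_of_notMem {c : Cmd} {y : ℕ} (h : y ∉ c.assigned) (m : Memory) :
    (c.run M m).var y = m.var y := by
  induction c generalizing m with
  | skip => rfl
  | assign x e => simp [assigned] at h; simp [run, h]
  | store a i e => simp [run]
  | seq c d hc hd => simp [assigned] at h; simp [run, hc h.1, hd h.2]
  | ite e c d hc hd =>
    simp [assigned] at h
    simp only [run]; split_ifs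
    · exact hc h.1 m
    · exact hd h.2 m
  | rep x c hc =>
    simp [assigned] at h
    simp only [run]
    induction m.var 0 with
    | zero => simp [iter, h.1]
    | succ i ih => simp [iter, h.1, hc h.2, ih]

lemma run_arr_of_notMem {c : Cmd} {a : ℕ} (h : a ∉ c.stored) (m : Memory) :
    (c.run M m).arr a = m.arr a := by
  induction c generalizing m with
  | skip => rfl
  | assign x e => rfl
  | store b i e => simp [stored] at h; simp [run, Memory.setArr_arr_ne, h]
  | seq c d hc hd => simp [stored] at h; simp [run, hc h.1, hd h.2]
  | ite e c d hc hd =>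
    simp [stored] at h
    simp only [run]; split_ifs
    · exact hc h.1 m
    · exact hd h.2 m
  | rep x c hc =>
    simp only [stored] at h
    simp only [run]
    induction m.var 0 with
    | zero => simp [iter]
    | succ i ih => simp [iter, hc h, ih]

lemma Wf.zero_notMem {c : Cmd} (h : c.Wf) : 0 ∉ c.assigned := by
  induction c with
  | skip => simp [assigned]
  | assign x e => simpa [assigned, Wf, eq_comm] using h
  | store a i e => simp [assigned]
  | seq c d hc hd => simp [assigned, hc h.1, hd h.2]
  | ite e c d hc hd => simp [assigned, hc h.1, hd h.2]
  | rep x c hc => simp [assigned, hc h.2.2, h.1.symm]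

/-- A well-formed command halts, in the memory given by `run`, within the time given by `time`. -/
theorem exec {c : Cmd} (h : c.Wf) (m : Memory) :
    ∃ t ≤ c.time.eval (m.var 0), Exec M c.toProgram m t (c.run M m) := by
  induction c generalizing m with
  | skip => exact ⟨1, by simp [time], .skip m⟩
  | assign x e => exact ⟨e.cost + 1, by simp [time], .assign x e m⟩
  | store a i e => exact ⟨i.cost + e.cost + 1, by simp [time], .store a i e m⟩
  | seq c d hc hd =>
    obtain ⟨t, ht, e⟩ := hc h.1 m
    obtain ⟨t', ht', e'⟩ := hd h.2 (c.run M m)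
    rw [run_var_of_notMem h.1.zero_notMem] at ht'
    exact ⟨t + t', by simp [time]; omega, .seq e e'⟩
  | ite e c d hc hd =>
    by_cases he : e.eval M m ≠ 0
    · obtain ⟨t, ht, e'⟩ := hc h.1 m
      refine ⟨e.cost + 1 + t, by simp [time]; omega, ?_⟩
      simpa [run, he, toProgram] using Exec.branch_true (Q := d.toProgram) he e'
    · obtain ⟨t, ht, e'⟩ := hd h.2 m
      refine ⟨e.cost + 1 + t, by simp [time]; omega, ?_⟩
      rw [not_not] at he
      simpa [run, he, toProgram] using Exec.branch_false (P := c.toProgram) he e'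
  | rep x c hc =>
    obtain ⟨hx, hxc, hw⟩ := h
    have hx' : (0 : ℕ) ≠ x := fun h => hx h.symm
    have hvx : ∀ i, (iter (c.run M) x m i).var x = i := by
      intro i; cases i <;> simp [iter]
    have hv0 : ∀ i, (iter (c.run M) x m i).var 0 = m.var 0 := by
      intro i
      induction i with
      | zero => simp [iter, hx']
      | succ i ih => simp [iter, hx', run_var_of_notMem hw.zero_notMem, ih]
    -- the remaining `d` passes of the loop
    have key : ∀ d i, i + d = m.var 0 → ∃ t ≤ 4 + d * (c.time.eval (m.var 0) + 8),
        Exec M (.loop (.sub (.var 0) (.var x))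
          (.seq c.toProgram (.assign x (.add (.var x) (.const 1)))))
          (iter (c.run M) x m i) t (iter (c.run M) x m (m.var 0)) := by
      intro d
      induction d with
      | zero =>
        intro i hi
        have hi' : i = m.var 0 := by omega
        rw [hi']
        refine ⟨_, ?_, .loop_done ?_⟩
        · simp [Expr.cost]
        · simp [Expr.eval, hv0, hvx]
      | succ d ih =>
        intro i hi
        obtain ⟨t, ht, e⟩ := hc hw (iter (c.run M) x m i)
        rw [hv0] at ht
        obtain ⟨t', ht', e'⟩ := ih (i + 1) (by omega)
        have e2 := Exec.assign (M := M) x (.add (.var x) (.const 1))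
          (c.run M (iter (c.run M) x m i))
        have hm : ({ c.run M (iter (c.run M) x m i) with
            var := Function.update (c.run M (iter (c.run M) x m i)).var x
              ((Expr.add (.var x) (.const 1)).eval M (c.run M (iter (c.run M) x m i))) } : Memory)
            = iter (c.run M) x m (i + 1) := by
          simp [Expr.eval, run_var_of_notMem hxc, hvx, iter, Memory.setVar]
        rw [hm] at e2
        refine ⟨_, ?_, .loop_step ?_ (.seq e e2) e'⟩
        · simp only [Expr.cost, add_mul, one_mul]; omega
        · simp only [Expr.eval, hv0, hvx]; omega
    obtain ⟨t, ht, e⟩ := key (m.var 0) 0 (by simp)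
    exact ⟨_, by simp [time, Expr.cost]; omega, .seq (.assign x (.const 0) m) e⟩

/-- Induction along a counting loop. In the induction step, everything that the loop does not
change has the value it had before the loop. -/
theorem rep_induction {x : ℕ} {c : Cmd} {m : Memory} (I : ℕ → Memory → Prop)
    (zero : I 0 (m.setVar x 0))
    (step : ∀ i < m.var 0, ∀ m' : Memory, m'.var x = i →
      (∀ y, y ∉ c.assigned → y ≠ x → m'.var y = m.var y) →
      (∀ a, a ∉ c.stored → m'.arr a = m.arr a) → I i m' →
      I (i + 1) ((c.run M m').setVar x (i + 1))) :
    I (m.var 0) ((rep x c).run M m) := by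
  have hv : ∀ i, (iter (c.run M) x m i).var x = i := by
    intro i; cases i <;> simp [iter]
  have hf : ∀ i y, y ∉ c.assigned → y ≠ x → (iter (c.run M) x m i).var y = m.var y := by
    intro i y hy hyx
    induction i with
    | zero => simp [iter, hyx]
    | succ i ih => simp [iter, hyx, run_var_of_notMem hy, ih]
  have ha : ∀ i a, a ∉ c.stored → (iter (c.run M) x m i).arr a = m.arr a := by
    intro i a h
    induction i with
    | zero => simp [iter]
    | succ i ih => simp [iter, run_arr_of_notMem h, ih]
  have key : ∀ i ≤ m.var 0, I i (iter (c.run M) x m i) := by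
    intro i
    induction i with
    | zero => exact fun _ => zero
    | succ i ih => exact fun h => step i (by omega) _ (hv i) (hf i) (ha i) (ih (by omega))
  exact key _ le_rfl

/-- Run `c` if the value of `e` is zero. -/
def whenZero (e : Expr) (c : Cmd) : Cmd := ite e skip c

lemma run_whenZero (e : Expr) (c : Cmd) (m : Memory) :
    (whenZero e c).run M m = if e.eval M m = 0 then c.run M m else m := by
  by_cases h : e.eval M m = 0 <;> simp [whenZero, run, h]

end Cmd

/-- An expression whose value is zero exactly when `d` and `e` have the same value. -/
def Expr.ne (d e : Expr) : Expr := .add (.sub d e) (.sub e d)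

/-- An expression whose value is zero exactly when the value of `d` is smaller than that of `e`. -/
def Expr.ge (d e : Expr) : Expr := .sub (.add d (.const 1)) e

/-- An expression whose value is zero exactly when the value of `e` is not. -/
def Expr.isZero (e : Expr) : Expr := .sub (.const 1) e

@[simp] lemma Expr.ne_eval_eq_zero {M : ℕ → ℕ → ℕ} {m : Memory} {d e : Expr} :
    (d.ne e).eval M m = 0 ↔ d.eval M m = e.eval M m := by
  simp only [Expr.ne, Expr.eval]; omega

@[simp] lemma Expr.ge_eval_eq_zero {M : ℕ → ℕ → ℕ} {m : Memory} {d e : Expr} :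
    (d.ge e).eval M m = 0 ↔ d.eval M m < e.eval M m := by
  simp only [Expr.ge, Expr.eval]; omega

@[simp] lemma Expr.isZero_eval_eq_zero {M : ℕ → ℕ → ℕ} {m : Memory} {e : Expr} :
    e.isZero.eval M m = 0 ↔ e.eval M m ≠ 0 := by
  simp only [Expr.isZero, Expr.eval]; omega

@[simp] lemma Expr.add_eval_eq_zero {M : ℕ → ℕ → ℕ} {m : Memory} {d e : Expr} :
    (d.add e).eval M m = 0 ↔ d.eval M m = 0 ∧ e.eval M m = 0 := by
  simp only [Expr.eval]; omega

/-! ### Bipartite matching by auction -/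

/-- The state of an auction in which the bidders in `X` compete for the objects in `Y`, all named
by numbers below `n`; the bidder `x` is interested in the object `y` if `adj x y`. The entry
`L x` is nonzero while the bidder `x` has no object, `own y` is the owner of `y`, or `n` if there is
none, and `price y` is the number of bids on `y` so far. By `price_near`, every owner has an object
that was cheapest, up to its own bid. The entry `price n = n` is a sentinel. -/
structure Auction (n : ℕ) (X Y : Finset ℕ) (adj : ℕ → ℕ → Prop) (L own price : ℕ → ℕ) :
    Prop where
  own_eq : ∀ y < n, y ∉ Y → own y = n
  own_mem : ∀ y < n, own y ≠ n → own y ∈ X ∧ adj (own y) y ∧ L (own y) = 0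
  own_inj : ∀ y < n, ∀ y' < n, own y ≠ n → own y = own y' → y = y'
  matched : ∀ x ∈ X, L x = 0 → ∃ y ∈ Y, own y = x
  L_eq : ∀ x < n, x ∉ X → L x = 0
  price_eq : ∀ y ∈ Y, own y = n → price y = 0
  price_le : ∀ y ∈ Y, price y ≤ n
  price_near : ∀ y < n, own y ≠ n → ∀ y' ∈ Y, adj (own y) y' → price y ≤ price y' + 1
  price_self : price n = n

/-- No bidder without an object can bid less than `n`. -/
def AuctionOver (n : ℕ) (X Y : Finset ℕ) (adj : ℕ → ℕ → Prop) (L price : ℕ → ℕ) : Prop :=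
  ∀ x ∈ X, L x ≠ 0 → ∀ y ∈ Y, adj x y → n ≤ price y

section Auction

variable {n : ℕ} {X Y : Finset ℕ} {adj : ℕ → ℕ → Prop} {L own price : ℕ → ℕ}

/-- A bid on a cheapest object. -/
lemma Auction.bid (hX : ∀ x ∈ X, x < n) (hY : ∀ y ∈ Y, y < n)
    (h : Auction n X Y adj L own price) {x b : ℕ} (hx : x ∈ X) (hL : L x ≠ 0) (hb : b ∈ Y)
    (hxb : adj x b) (hbn : price b < n) (hmin : ∀ y ∈ Y, adj x y → price b ≤ price y) :
    Auction n X Y adj (Function.update (Function.update L (own b) 1) x 0)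
      (Function.update own b x) (Function.update price b (price b + 1)) := by
  have hxn : x ≠ n := (hX x hx).ne
  have hbn' : b ≠ n := (hY b hb).ne
  have hxo : ∀ y < n, own y ≠ x := by
    intro y hy e
    have := (h.own_mem y hy (e ▸ hxn)).2.2
    rw [e] at this
    exact hL this
  have hle : ∀ y, price y ≤ Function.update price b (price b + 1) y := by
    intro y
    by_cases e : y = b
    · subst e; simp
    · simp [e]
  constructor
  · intro y hy hyY
    have : y ≠ b := fun e => hyY (e ▸ hb)
    simpa [this] using h.own_eq y hy hyY
  · intro y hy hyn
    by_cases e : y = b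
    · subst e; simpa using ⟨hx, hxb⟩
    · simp only [Function.update_of_ne e] at hyn ⊢
      obtain ⟨h1, h2, h3⟩ := h.own_mem y hy hyn
      refine ⟨h1, h2, ?_⟩
      have e2 : own y ≠ own b := fun e' => e (h.own_inj y hy b (hY b hb) hyn e')
      simp [hxo y hy, e2, h3]
  · intro y hy y' hy' hyn e
    by_cases e1 : y = b <;> by_cases e2 : y' = b
    · rw [e1, e2]
    · subst e1
      simp only [Function.update_self, Function.update_of_ne e2] at e
      exact absurd e.symm (hxo y' hy')
    · subst e2
      simp only [Function.update_self, Function.update_of_ne e1] at e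
      exact absurd e (hxo y hy)
    · simp only [Function.update_of_ne e1, Function.update_of_ne e2] at e hyn
      exact h.own_inj y hy y' hy' hyn e
  · intro x' hx' hL'
    by_cases e : x' = x
    · subst e; exact ⟨b, hb, by simp⟩
    · rw [Function.update_of_ne e] at hL'
      by_cases e' : x' = own b
      · subst e'; simp at hL'
      · rw [Function.update_of_ne e'] at hL'
        obtain ⟨y, hy, hyx⟩ := h.matched x' hx' hL'
        refine ⟨y, hy, ?_⟩
        have : y ≠ b := fun e => e' (by rw [← hyx, e])
        simpa [this] using hyx
  · intro x' hx' hxX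
    have e : x' ≠ x := fun e => hxX (e ▸ hx)
    rw [Function.update_of_ne e]
    by_cases e' : x' = own b
    · exact absurd (e' ▸ (h.own_mem b (hY b hb) (e' ▸ hx'.ne)).1) hxX
    · rw [Function.update_of_ne e']; exact h.L_eq x' hx' hxX
  · intro y hy e
    by_cases e1 : y = b
    · subst e1; simp at e; exact absurd e hxn
    · simp only [Function.update_of_ne e1] at e ⊢
      exact h.price_eq y hy e
  · intro y hy
    by_cases e1 : y = b
    · subst e1; simpa using hbn
    · simpa only [Function.update_of_ne e1] using h.price_le y hy
  · intro y hy hyn y' hy' hadj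
    by_cases e1 : y = b
    · subst e1
      simp only [Function.update_self] at hadj ⊢
      have := hmin y' hy' hadj
      have := hle y'
      omega
    · simp only [Function.update_of_ne e1] at hyn hadj ⊢
      have := h.price_near y hy hyn y' hy' hadj
      have := hle y'
      omega
  · rw [Function.update_of_ne hbn'.symm]; exact h.price_self

open Classical in
/-- If Hall's condition holds, then a finished auction gives an object to every bidder: as there are
fewer than `n` objects, some price `t < n` does not occur. A bidder without an object, together with
the owners of the objects of price more than `t`, is interested only in these objects. -/
lemma Auction.saturated (hY : ∀ y ∈ Y, y < n) (hYn : Y.card < n)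
    (h : Auction n X Y adj L own price) (ho : AuctionOver n X Y adj L price)
    (hall : ∀ X' ⊆ X, X'.card ≤ {y ∈ Y | ∃ x ∈ X', adj x y}.card) :
    ∀ x ∈ X, L x = 0 := by
  intro x hx
  by_contra hL
  obtain ⟨t, htn, ht⟩ : ∃ t < n, ∀ y ∈ Y, price y ≠ t := by
    by_contra! hcon
    have : Finset.range n ⊆ Y.image price := by
      intro t ht
      obtain ⟨y, hy, e⟩ := hcon t (Finset.mem_range.1 ht)
      exact Finset.mem_image.2 ⟨y, hy, e⟩
    have := (Finset.card_le_card this).trans Finset.card_image_le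
    simp at this
    omega
  have hown : ∀ y ∈ Y, t < price y → own y ≠ n := by
    intro y hy hty e
    have := h.price_eq y hy e
    omega
  set Y' := {y ∈ Y | t < price y} with hY'
  have hmem : ∀ y ∈ Y', y ∈ Y ∧ t < price y := fun y hy => by simpa [hY'] using hy
  have hxi : x ∉ Y'.image own := by
    intro hxi
    obtain ⟨y, hy, e⟩ := Finset.mem_image.1 hxi
    obtain ⟨hyY, hty⟩ := hmem y hy
    exact hL (e ▸ (h.own_mem y (hY y hyY) (hown y hyY hty)).2.2)
  have hcard : (insert x (Y'.image own)).card = Y'.card + 1 := by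
    rw [Finset.card_insert_of_notMem hxi, Finset.card_image_of_injOn]
    intro y hy y' hy' e
    obtain ⟨hyY, hty⟩ := hmem y hy
    obtain ⟨hyY', hty'⟩ := hmem y' hy'
    exact h.own_inj y (hY y hyY) y' (hY y' hyY') (hown y hyY hty) e
  have hsub : insert x (Y'.image own) ⊆ X := by
    intro z hz
    rcases Finset.mem_insert.1 hz with rfl | hz
    · exact hx
    · obtain ⟨y, hy, rfl⟩ := Finset.mem_image.1 hz
      obtain ⟨hyY, hty⟩ := hmem y hy
      exact (h.own_mem y (hY y hyY) (hown y hyY hty)).1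
  have h1 := hall _ hsub
  have h2 : {y ∈ Y | ∃ z ∈ insert x (Y'.image own), adj z y} ⊆ Y' := by
    intro y hy
    obtain ⟨hyY, z, hz, hzy⟩ := Finset.mem_filter.1 hy
    refine Finset.mem_filter.2 ⟨hyY, ?_⟩
    rcases Finset.mem_insert.1 hz with rfl | hz
    · have := ho z hx hL y hyY hzy
      omega
    · obtain ⟨w, hw, rfl⟩ := Finset.mem_image.1 hz
      obtain ⟨hwY, htw⟩ := hmem w hw
      have := h.price_near w (hY w hwY) (hown w hwY htw) y hyY hzy
      have := ht y hyY
      omega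
  have := Finset.card_le_card h2
  omega

end Auction

/-! ### The matches of one round -/

/-- A set of matches between players of `W`, with their outcomes: `f x = n` if `x` does not play,
`f x = x` if `x` wins, and otherwise `f x` is the player who beats `x`. -/
structure Matching (M : ℕ → ℕ → ℕ) (n : ℕ) (W : Finset ℕ) (f : ℕ → ℕ) : Prop where
  mem : ∀ x ∈ W, f x = n ∨ f x ∈ W ∧ f (f x) = f x
  beats : ∀ x ∈ W, f x ≠ n → f x ≠ x → M (f x) x ≠ 0
  inj : ∀ x ∈ W, ∀ y ∈ W, f x ≠ n → f x ≠ x → f y ≠ y → f x = f y → x = y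
  loser : ∀ x ∈ W, f x = x → ∃ y ∈ W, y ≠ x ∧ f y = x

section Matching

variable {M : ℕ → ℕ → ℕ} {n : ℕ} {W : Finset ℕ} {f : ℕ → ℕ}

/-- Add a match that `x` wins against `y`. -/
lemma Matching.add (hW : ∀ x ∈ W, x < n) (h : Matching M n W f) {x y : ℕ} (hx : x ∈ W)
    (hy : y ∈ W) (hxy : x ≠ y) (hfx : f x = n) (hfy : f y = n) (hb : M x y ≠ 0) :
    Matching M n W (Function.update (Function.update f y x) x x) := by
  have hxn := (hW x hx).ne
  have hval : ∀ z, z ≠ x → z ≠ y →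
      Function.update (Function.update f y x) x x z = f z := by
    intro z h1 h2; simp [h1, h2]
  have hvx : Function.update (Function.update f y x) x x x = x := by simp
  have hvy : Function.update (Function.update f y x) x x y = x := by simp [hxy.symm]
  generalize Function.update (Function.update f y x) x x = g at *
  have hfne : ∀ z ∈ W, f z ≠ x ∧ f z ≠ y := by
    intro z hz
    rcases h.mem z hz with e | ⟨h1, h2⟩
    · have := (hW y hy).ne
      omega
    · constructor <;> intro e <;> rw [e] at h1 h2
      · exact hxn (h2.symm.trans hfx)
      · exact (hW y hy).ne (h2.symm.trans hfy)
  constructor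
  · intro z hz
    by_cases e1 : z = x
    · subst e1; right; rw [hvx]; exact ⟨hz, hvx⟩
    by_cases e2 : z = y
    · subst e2; right; rw [hvy]; exact ⟨hx, hvx⟩
    rw [hval z e1 e2, hval _ (hfne z hz).1 (hfne z hz).2]
    exact h.mem z hz
  · intro z hz h1 h2
    by_cases e1 : z = x
    · subst e1; exact absurd hvx h2
    by_cases e2 : z = y
    · subst e2; rwa [hvy]
    rw [hval z e1 e2] at h1 h2 ⊢
    exact h.beats z hz h1 h2
  · intro z hz w hw h1 h2 h3 h4
    by_cases e1 : z = x
    · subst e1; exact absurd hvx h2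
    by_cases e1' : w = x
    · subst e1'; exact absurd hvx h3
    by_cases e2 : z = y <;> by_cases e2' : w = y
    · rw [e2, e2']
    · subst e2; rw [hvy, hval w e1' e2'] at h4; exact absurd h4.symm (hfne w hw).1
    · subst e2'; rw [hvy, hval z e1 e2] at h4; exact absurd h4 (hfne z hz).1
    · rw [hval z e1 e2] at h1 h2 h4
      rw [hval w e1' e2'] at h3 h4
      exact h.inj z hz w hw h1 h2 h3 h4
  · intro z hz h1
    by_cases e1 : z = x
    · subst e1; exact ⟨y, hy, hxy.symm, hvy⟩
    by_cases e2 : z = y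
    · subst e2; exact absurd (hvy.symm.trans h1) hxy
    rw [hval z e1 e2] at h1
    obtain ⟨w, hw, hwz, e⟩ := h.loser z hz h1
    have hzn := (hW z hz).ne
    refine ⟨w, hw, hwz, ?_⟩
    rw [hval w ?_ ?_, e]
    · rintro rfl; omega
    · rintro rfl; omega

/-- In a matching, exactly half of the players involved win. -/
lemma Matching.card (hW : ∀ x ∈ W, x < n) (h : Matching M n W f) :
    W.card = {x ∈ W | f x = n}.card + 2 * {x ∈ W | f x = x}.card := by
  classical
  have h1 : {x ∈ W | f x = x}.card = {x ∈ W | f x ≠ n ∧ f x ≠ x}.card := by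
    symm
    refine Finset.card_bij (fun x _ => f x) ?_ ?_ ?_
    · intro x hx
      obtain ⟨hx, h1, h2⟩ := Finset.mem_filter.1 hx
      have := (h.mem x hx).resolve_left h1
      simpa using this
    · intro x hx y hy e
      obtain ⟨hx, h1, h2⟩ := Finset.mem_filter.1 hx
      obtain ⟨hy, h3, h4⟩ := Finset.mem_filter.1 hy
      exact h.inj x hx y hy h1 h2 h4 e
    · intro x hx
      obtain ⟨hx, h1⟩ := Finset.mem_filter.1 hx
      obtain ⟨y, hy, hyx, e⟩ := h.loser x hx h1
      refine ⟨y, Finset.mem_filter.2 ⟨hy, ?_, ?_⟩, e⟩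
      · rw [e]; exact (hW x hx).ne
      · rw [e]; exact hyx.symm
  have h2 : W = {x ∈ W | f x = n} ∪ ({x ∈ W | f x = x} ∪ {x ∈ W | f x ≠ n ∧ f x ≠ x}) := by
    ext x
    simp only [Finset.mem_union, Finset.mem_filter]
    tauto
  have h3 : Disjoint {x ∈ W | f x = x} {x ∈ W | f x ≠ n ∧ f x ≠ x} := by
    rw [Finset.disjoint_filter]; tauto
  have h4 : Disjoint {x ∈ W | f x = n}
      ({x ∈ W | f x = x} ∪ {x ∈ W | f x ≠ n ∧ f x ≠ x}) := by
    rw [Finset.disjoint_union_right, Finset.disjoint_filter, Finset.disjoint_filter]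
    refine ⟨fun x hx e1 e2 => (hW x hx).ne (e2.symm.trans e1), fun x hx e => by tauto⟩
  have := congrArg Finset.card h2
  rw [Finset.card_union_of_disjoint h4, Finset.card_union_of_disjoint h3] at this
  omega

end Matching

/-! ### The algorithm

Variables: `0` the number of players `n`, `1` the player `v`, `2` the number of remaining rounds, `3`
the number of leaves in the block of a remaining player, `4` the opponent of `v`, `5` the number of
remaining players that `v` beats, `6`, `7` and `8` counters of passes, `9` and `10` counters
that run through the players, `11` a cheapest object, `12` a number of common neighbours.

Arrays: `0` the seeding, `1` the champion of the block of a player, `2` the position of a player in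
its block, `3` the winner of the match of a player in the current round (`n` if there is no match
yet), `4` nonzero for bidders without an object, `5` zero for objects, `6` the prices and `7` the
owners of the objects. -/

namespace Algo

open Cmd

/-- At first every player is the champion of a block of its own. -/
def initPlayers : Cmd := rep 9 (.store 1 (.var 9) (.var 9))

/-- Set variable `2` to `k` and variable `3` to `1`. -/
def countRounds : Cmd :=
  .seq (.assign 3 (.const 1))
    (.seq
      (.rep 9 (whenZero (.ge (.var 3) (.var 0))
        (.seq (.assign 3 (.add (.var 3) (.var 3))) (.assign 2 (.add (.var 2) (.const 1))))))
      (.assign 3 (.const 1)))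

/-- Clear the arrays that a round uses. -/
def clear : Cmd :=
  .seq
    (.rep 9
      (.seq (.store 3 (.var 9) (.const 0))
        (.seq (whenZero (.ne (.arr 1 (.var 9)) (.var 9)) (.store 3 (.var 9) (.var 0)))
          (.seq (.store 4 (.var 9) (.const 0))
            (.seq (.store 5 (.var 9) (.const 1))
              (.seq (.store 6 (.var 9) (.const 0)) (.store 7 (.var 9) (.var 0))))))))
    (.store 6 (.var 0) (.var 0))

/-- Find an opponent that `v` beats, and count all of them. -/
def findOpponent : Cmd :=
  .seq (.assign 4 (.var 1))
    (.seq (.assign 5 (.const 0))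
      (.rep 9 (whenZero (.add (.ne (.arr 1 (.var 9)) (.var 9)) (.isZero (.input (.var 1) (.var 9))))
        (.seq (.assign 4 (.var 9)) (.assign 5 (.add (.var 5) (.const 1)))))))

/-- Let `v` play its opponent. -/
def playOpponent : Cmd :=
  .seq (.store 3 (.var 4) (.var 1)) (.store 3 (.var 1) (.var 1))

/-- This expression is zero if `v` beats less than a quarter of the players. -/
def manyWins : Expr := .ge (.add (.add (.var 5) (.var 5)) (.add (.var 5) (.var 5))) (.var 0)

/-- Count the remaining players that are beaten by `v` and beat `x`. -/
def countCommon : Cmd :=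
  .seq (.assign 12 (.const 0))
    (.rep 10 (whenZero (.add (.ne (.arr 1 (.var 10)) (.var 10))
        (.add (.isZero (.input (.var 1) (.var 10))) (.isZero (.input (.var 10) (.var 9)))))
      (.assign 12 (.add (.var 12) (.const 1)))))

/-- Set up the bidders and the objects of the auction. -/
def chooseSides : Cmd :=
  .rep 9 (whenZero (.ne (.arr 3 (.var 9)) (.var 0))
    (.ite (.input (.var 1) (.var 9))
      (.ite manyWins (.store 5 (.var 9) (.const 0)) (.store 4 (.var 9) (.const 1)))
      (.seq countCommon
        (.ite (.ge (.var 12) (.var 2))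
          (whenZero manyWins (.store 5 (.var 9) (.const 0)))
          (.store 4 (.var 9) (.const 1))))))

/-- Find a cheapest object for the bidder `x`. -/
def findCheapest : Cmd :=
  .seq (.assign 11 (.var 0))
    (.rep 10 (whenZero (.add (.arr 5 (.var 10))
        (.add (.ne (.input (.var 1) (.var 9)) (.input (.var 9) (.var 10)))
          (.ge (.arr 6 (.var 10)) (.arr 6 (.var 11)))))
      (.assign 11 (.var 10))))

/-- A bid of the bidder `x`. -/
def bid : Cmd :=
  .seq findCheapest
    (whenZero (.ge (.arr 6 (.var 11)) (.var 0))
      (.seq (.store 4 (.arr 7 (.var 11)) (.const 1))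
        (.seq (.store 7 (.var 11) (.var 9))
          (.seq (.store 4 (.var 9) (.const 0))
            (.store 6 (.var 11) (.add (.arr 6 (.var 11)) (.const 1)))))))

/-- Every bidder that has no object bids once. -/
def sweep : Cmd := .rep 9 (.ite (.arr 4 (.var 9)) bid .skip)

/-- Run the auction. -/
def auction : Cmd := .rep 7 (.rep 8 sweep)

/-- Let the bidders and their objects play. -/
def playAuction : Cmd :=
  .rep 10 (whenZero (.ge (.arr 7 (.var 10)) (.var 0))
    (.ite (.input (.arr 7 (.var 10)) (.var 10))
      (.seq (.store 3 (.var 10) (.arr 7 (.var 10)))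
        (.store 3 (.arr 7 (.var 10)) (.arr 7 (.var 10))))
      (.seq (.store 3 (.arr 7 (.var 10)) (.var 10)) (.store 3 (.var 10) (.var 10)))))

/-- Let players play that do not play yet, as long as there are `x` and `y` such that `x` beats `y`
and the expression `e` is zero. -/
def playGreedy (e : Expr) : Cmd :=
  .rep 9 (.rep 10 (whenZero
    (.add (.ne (.arr 3 (.var 9)) (.var 0)) (.add (.ne (.arr 3 (.var 10)) (.var 0))
      (.add (.isZero (.input (.var 9) (.var 10))) e)))
    (.seq (.store 3 (.var 10) (.var 9)) (.store 3 (.var 9) (.var 9)))))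

/-- This expression is zero if `v` beats `x` and does not beat `y`. -/
def winAgainstLoss : Expr :=
  .add (.isZero (.input (.var 1) (.var 9))) (.input (.var 1) (.var 10))

/-- Append the block of every loser to the block of its opponent. -/
def merge : Cmd :=
  .rep 9 (.ite (.ne (.arr 3 (.arr 1 (.var 9))) (.arr 1 (.var 9)))
    (.seq (.store 2 (.var 9) (.add (.arr 2 (.var 9)) (.var 3)))
      (.store 1 (.var 9) (.arr 3 (.arr 1 (.var 9))))) .skip)

/-- One round. -/
def round : Cmd :=
  .seq clear (.seq findOpponent (.seq playOpponent (.seq chooseSides (.seq auction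
    (.seq playAuction (.seq (playGreedy winAgainstLoss) (.seq (playGreedy (.const 0))
      (.seq merge (.seq (.assign 2 (.sub (.var 2) (.const 1)))
        (.assign 3 (.add (.var 3) (.var 3))))))))))))

/-- Write the seeding. -/
def output : Cmd := .rep 9 (.store 0 (.arr 2 (.var 9)) (.var 9))

/-- The whole algorithm. -/
def main : Cmd :=
  .seq initPlayers (.seq countRounds (.seq (.rep 6 (.ite (.var 2) round .skip)) output))

lemma main_wf : main.Wf := by
  simp [main, initPlayers, countRounds, round, clear, findOpponent, playOpponent, chooseSides,
    countCommon, auction, sweep, bid, findCheapest, playAuction, playGreedy, merge, output,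
    whenZero, Wf, assigned]

/-! ### The parts of a round -/

variable {M : ℕ → ℕ → ℕ}

lemma clear_spec (m : Memory) :
    (∀ x < m.var 0, (clear.run M m).arr 3 x = if m.arr 1 x = x then m.var 0 else 0) ∧
    (∀ x < m.var 0, (clear.run M m).arr 4 x = 0 ∧ (clear.run M m).arr 5 x = 1 ∧
      (clear.run M m).arr 6 x = 0 ∧ (clear.run M m).arr 7 x = m.var 0) ∧
    (clear.run M m).arr 6 (m.var 0) = m.var 0 := by
  rw [clear]
  simp only [Cmd.run.eq_4, Cmd.run.eq_3, Expr.eval]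
  generalize hc : Cmd.rep _ _ = c
  have h0 : (c.run M m).var 0 = m.var 0 := by
    subst hc; exact run_var_of_notMem (by simp [assigned, whenZero]) m
  have key : ∀ x < m.var 0, (c.run M m).arr 3 x = (if m.arr 1 x = x then m.var 0 else 0) ∧
      (c.run M m).arr 4 x = 0 ∧ (c.run M m).arr 5 x = 1 ∧
      (c.run M m).arr 6 x = 0 ∧ (c.run M m).arr 7 x = m.var 0 := by
    subst hc
    refine rep_induction (M := M) (m := m) (fun i m' => ∀ x < i,
      m'.arr 3 x = (if m.arr 1 x = x then m.var 0 else 0) ∧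
      m'.arr 4 x = 0 ∧ m'.arr 5 x = 1 ∧ m'.arr 6 x = 0 ∧ m'.arr 7 x = m.var 0) (by simp) ?_
    intro i hi m' hx hv ha ih x hxi
    have h0 : m'.var 0 = m.var 0 := hv 0 (by simp [assigned, whenZero]) (by simp)
    have h1 : m'.arr 1 = m.arr 1 := ha 1 (by simp [stored, whenZero])
    rcases Nat.lt_succ_iff_lt_or_eq.1 hxi with h | h
    · by_cases e : m.arr 1 i = i <;>
        simpa [run, run_whenZero, Expr.eval, hx, h0, h1, h.ne, e] using ih x h
    · subst h
      by_cases e : m.arr 1 x = x <;> simp [run, run_whenZero, Expr.eval, hx, h0, h1, e]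
  refine ⟨fun x hx => ?_, fun x hx => ?_, ?_⟩
  · simpa using (key x hx).1
  · have := key x hx
    simp only [Memory.setArr_arr, h0]
    simpa [hx.ne] using this.2
  · simp [h0]

lemma findOpponent_spec (m : Memory) :
    (findOpponent.run M m).var 5 = {x ∈ Finset.range (m.var 0) |
      m.arr 1 x = x ∧ M (m.var 1) x ≠ 0}.card ∧
    ((∃ x < m.var 0, m.arr 1 x = x ∧ M (m.var 1) x ≠ 0) →
      (findOpponent.run M m).var 4 < m.var 0 ∧
      m.arr 1 ((findOpponent.run M m).var 4) = (findOpponent.run M m).var 4 ∧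
      M (m.var 1) ((findOpponent.run M m).var 4) ≠ 0) := by
  rw [findOpponent]
  simp only [Cmd.run.eq_4, Cmd.run.eq_2, Expr.eval]
  generalize hm1 : (m.setVar 4 (m.var 1)).setVar 5 0 = m1
  have e0 : m1.var 0 = m.var 0 := by subst hm1; simp
  have e1 : m1.var 1 = m.var 1 := by subst hm1; simp
  have e5 : m1.var 5 = 0 := by subst hm1; simp
  have ea : m1.arr = m.arr := by subst hm1; simp
  rw [← e0, ← e1, ← ea]
  clear hm1 e0 e1 ea
  refine rep_induction (M := M) (m := m1) (fun i m' =>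
    m'.var 5 = {x ∈ Finset.range i | m1.arr 1 x = x ∧ M (m1.var 1) x ≠ 0}.card ∧
    ((∃ x < i, m1.arr 1 x = x ∧ M (m1.var 1) x ≠ 0) →
      m'.var 4 < m1.var 0 ∧ m1.arr 1 (m'.var 4) = m'.var 4 ∧ M (m1.var 1) (m'.var 4) ≠ 0))
    (by simp [e5]) ?_
  intro i hi m' hx hv ha ih
  have h1 : m'.var 1 = m1.var 1 := hv 1 (by simp [assigned, whenZero]) (by simp)
  have ha1 : m'.arr 1 = m1.arr 1 := ha 1 (by simp [stored, whenZero])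
  rw [Finset.range_add_one, Finset.filter_insert]
  by_cases e : m1.arr 1 i = i ∧ M (m1.var 1) i ≠ 0
  · rw [if_pos e, Finset.card_insert_of_notMem (by simp)]
    simp [run, run_whenZero, Expr.eval, hx, h1, ha1, e, hi, ih.1]
  · rw [if_neg e]
    have e' : (∃ x < i + 1, m1.arr 1 x = x ∧ M (m1.var 1) x ≠ 0) ↔
        ∃ x < i, m1.arr 1 x = x ∧ M (m1.var 1) x ≠ 0 := by
      constructor
      · rintro ⟨x, hx, h⟩
        refine ⟨x, ?_, h⟩
        rcases Nat.lt_succ_iff_lt_or_eq.1 hx with h' | rfl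
        · exact h'
        · exact absurd h e
      · rintro ⟨x, hx, h⟩
        exact ⟨x, by omega, h⟩
    rw [e']
    have e2 : ¬ (m1.arr 1 i = i ∧ ¬ M (m1.var 1) i = 0) := e
    simpa [run, run_whenZero, Expr.eval, hx, h1, ha1, e2] using ih

lemma countCommon_spec (m : Memory) :
    (countCommon.run M m).var 12 = {y ∈ Finset.range (m.var 0) |
      m.arr 1 y = y ∧ M (m.var 1) y ≠ 0 ∧ M y (m.var 9) ≠ 0}.card := by
  rw [countCommon]
  simp only [Cmd.run.eq_4, Cmd.run.eq_2, Expr.eval]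
  generalize hm1 : m.setVar 12 0 = m1
  have e0 : m1.var 0 = m.var 0 := by subst hm1; simp
  have e1 : m1.var 1 = m.var 1 := by subst hm1; simp
  have e9 : m1.var 9 = m.var 9 := by subst hm1; simp
  have e5 : m1.var 12 = 0 := by subst hm1; simp
  have ea : m1.arr = m.arr := by subst hm1; simp
  rw [← e0, ← e1, ← ea, ← e9]
  clear hm1 e0 e1 ea e9
  refine rep_induction (M := M) (m := m1) (fun i m' =>
    m'.var 12 = {y ∈ Finset.range i | m1.arr 1 y = y ∧ M (m1.var 1) y ≠ 0 ∧
      M y (m1.var 9) ≠ 0}.card) (by simp [e5]) ?_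
  intro i hi m' hx hv ha ih
  have h1 : m'.var 1 = m1.var 1 := hv 1 (by simp [assigned, whenZero]) (by simp)
  have h9 : m'.var 9 = m1.var 9 := hv 9 (by simp [assigned, whenZero]) (by simp)
  have ha1 : m'.arr 1 = m1.arr 1 := ha 1 (by simp [stored, whenZero])
  rw [Finset.range_add_one, Finset.filter_insert]
  by_cases e : m1.arr 1 i = i ∧ M (m1.var 1) i ≠ 0 ∧ M i (m1.var 9) ≠ 0
  · rw [if_pos e, Finset.card_insert_of_notMem (by simp)]
    simp [run, run_whenZero, Expr.eval, hx, h1, ha1, h9, e, ih]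
  · rw [if_neg e]
    have e2 : ¬ (m1.arr 1 i = i ∧ ¬ M (m1.var 1) i = 0 ∧ ¬ M i (m1.var 9) = 0) := e
    simpa [run, run_whenZero, Expr.eval, hx, h1, ha1, h9, e2] using ih

end Algo

/-! ### The auction as a program -/

namespace Algo

open Cmd

variable {M : ℕ → ℕ → ℕ}

lemma manyWins_eval_eq_zero {m : Memory} :
    manyWins.eval M m = 0 ↔ 4 * m.var 5 < m.var 0 := by
  simp only [manyWins, Expr.ge_eval_eq_zero, Expr.eval]; omega

lemma chooseSides_spec (m : Memory) (deg : ℕ → ℕ)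
    (hdeg : ∀ x, deg x = {y ∈ Finset.range (m.var 0) |
      m.arr 1 y = y ∧ M (m.var 1) y ≠ 0 ∧ M y x ≠ 0}.card) :
    ∀ x < m.var 0,
      (chooseSides.run M m).arr 4 x = (if m.arr 3 x = m.var 0 ∧
        (M (m.var 1) x ≠ 0 ∧ 4 * m.var 5 < m.var 0 ∨ M (m.var 1) x = 0 ∧ deg x < m.var 2)
        then 1 else m.arr 4 x) ∧
      (chooseSides.run M m).arr 5 x = (if m.arr 3 x = m.var 0 ∧
        (M (m.var 1) x ≠ 0 ∧ ¬ 4 * m.var 5 < m.var 0 ∨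
          M (m.var 1) x = 0 ∧ ¬ deg x < m.var 2 ∧ 4 * m.var 5 < m.var 0)
        then 0 else m.arr 5 x) := by
  rw [chooseSides]
  refine (rep_induction (M := M) (m := m) (fun i m' => ∀ x,
    (i ≤ x → m'.arr 4 x = m.arr 4 x ∧ m'.arr 5 x = m.arr 5 x) ∧ (x < i →
      m'.arr 4 x = (if m.arr 3 x = m.var 0 ∧
        (M (m.var 1) x ≠ 0 ∧ 4 * m.var 5 < m.var 0 ∨ M (m.var 1) x = 0 ∧ deg x < m.var 2)
        then 1 else m.arr 4 x) ∧
      m'.arr 5 x = (if m.arr 3 x = m.var 0 ∧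
        (M (m.var 1) x ≠ 0 ∧ ¬ 4 * m.var 5 < m.var 0 ∨
          M (m.var 1) x = 0 ∧ ¬ deg x < m.var 2 ∧ 4 * m.var 5 < m.var 0)
        then 0 else m.arr 5 x))) (by simp) ?_ · |>.2)
  intro i hi m' hx hv ha ih
  have hA : ∀ y, y ∉ [12, 10] → y ≠ 9 → m'.var y = m.var y := fun y hy h9 =>
    hv y (by simp at hy; simp [assigned, whenZero, countCommon, hy]) h9
  have h0 : m'.var 0 = m.var 0 := hA 0 (by simp) (by simp)
  have h1 : m'.var 1 = m.var 1 := hA 1 (by simp) (by simp)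
  have h2 : m'.var 2 = m.var 2 := hA 2 (by simp) (by simp)
  have h5 : m'.var 5 = m.var 5 := hA 5 (by simp) (by simp)
  have ha1 : m'.arr 1 = m.arr 1 := ha 1 (by simp [stored, whenZero, countCommon])
  have ha3 : m'.arr 3 = m.arr 3 := ha 3 (by simp [stored, whenZero, countCommon])
  -- the counting loop inside the body
  have hcc := countCommon_spec (M := M) m'
  have hcv : ∀ y, y ∉ [12, 10] → (countCommon.run M m').var y = m'.var y := fun y hy =>
    run_var_of_notMem (by simp at hy; simp [assigned, whenZero, countCommon, hy]) m'
  have hca : ∀ a, (countCommon.run M m').arr a = m'.arr a := fun a =>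
    run_arr_of_notMem (by simp [stored, whenZero, countCommon]) m'
  generalize hcm : countCommon.run M m' = mc at hcc hcv hca
  have c0 : mc.var 0 = m.var 0 := (hcv 0 (by simp)).trans h0
  have c2 : mc.var 2 = m.var 2 := (hcv 2 (by simp)).trans h2
  have c5 : mc.var 5 = m.var 5 := (hcv 5 (by simp)).trans h5
  have c9 : mc.var 9 = i := (hcv 9 (by simp)).trans hx
  rw [h0, h1, ha1, hx, ← hdeg] at hcc
  -- the effect of the body
  have hbody : ∀ x,
      ((Cmd.ite (.input (.var 1) (.var 9))
        (.ite manyWins (.store 5 (.var 9) (.const 0)) (.store 4 (.var 9) (.const 1)))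
        (.seq countCommon
          (.ite (.ge (.var 12) (.var 2))
            (whenZero manyWins (.store 5 (.var 9) (.const 0)))
            (.store 4 (.var 9) (.const 1))))).run M m').arr 4 x =
        (if x = i ∧ (M (m.var 1) x ≠ 0 ∧ 4 * m.var 5 < m.var 0 ∨
          M (m.var 1) x = 0 ∧ deg x < m.var 2) then 1 else m'.arr 4 x) ∧
      ((Cmd.ite (.input (.var 1) (.var 9))
        (.ite manyWins (.store 5 (.var 9) (.const 0)) (.store 4 (.var 9) (.const 1)))
        (.seq countCommon
          (.ite (.ge (.var 12) (.var 2))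
            (whenZero manyWins (.store 5 (.var 9) (.const 0)))
            (.store 4 (.var 9) (.const 1))))).run M m').arr 5 x =
        (if x = i ∧ (M (m.var 1) x ≠ 0 ∧ ¬ 4 * m.var 5 < m.var 0 ∨
          M (m.var 1) x = 0 ∧ ¬ deg x < m.var 2 ∧ 4 * m.var 5 < m.var 0)
          then 0 else m'.arr 5 x) := by
    intro x
    simp only [run, run_whenZero, hcm, Expr.eval, ne_eq, Expr.ge_eval_eq_zero,
      manyWins_eval_eq_zero, h0, h1, h5, hx, c0, c2, c5, hcc]
    by_cases e : x = i
    · subst e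
      by_cases e1 : M (m.var 1) x = 0 <;> by_cases e2 : 4 * m.var 5 < m.var 0 <;>
        by_cases e3 : deg x < m.var 2 <;>
        simp [e1, e2, e3, hca, c9]
    · by_cases e1 : M (m.var 1) i = 0 <;> by_cases e2 : 4 * m.var 5 < m.var 0 <;>
        by_cases e3 : deg i < m.var 2 <;>
        simp [e1, e2, e3, hca, c9, e]
  intro x
  simp only [run_whenZero, Expr.ne_eval_eq_zero, Expr.eval, hx, h0, ha3, Memory.setVar_arr]
  by_cases e3 : m.arr 3 i = m.var 0
  · rw [if_pos e3, (hbody x).1, (hbody x).2]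
    constructor
    · intro hix
      have : x ≠ i := by omega
      simpa [this] using (ih x).1 (by omega)
    · intro hxi
      rcases Nat.lt_succ_iff_lt_or_eq.1 hxi with h | rfl
      · simpa [h.ne] using (ih x).2 h
      · simp [e3, ((ih x).1 le_rfl).1, ((ih x).1 le_rfl).2]
  · rw [if_neg e3]
    constructor
    · intro hix
      exact (ih x).1 (by omega)
    · intro hxi
      rcases Nat.lt_succ_iff_lt_or_eq.1 hxi with h | rfl
      · exact (ih x).2 h
      · simp [e3, ((ih x).1 le_rfl).1, ((ih x).1 le_rfl).2]

lemma findCheapest_spec (m : Memory) :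
    ((findCheapest.run M m).var 11 = m.var 0 ∨ (findCheapest.run M m).var 11 < m.var 0 ∧
      m.arr 5 ((findCheapest.run M m).var 11) = 0 ∧
      M (m.var 1) (m.var 9) = M (m.var 9) ((findCheapest.run M m).var 11)) ∧
    ∀ y < m.var 0, m.arr 5 y = 0 → M (m.var 1) (m.var 9) = M (m.var 9) y →
      m.arr 6 ((findCheapest.run M m).var 11) ≤ m.arr 6 y := by
  rw [findCheapest]
  simp only [Cmd.run.eq_4, Cmd.run.eq_2, Expr.eval]
  generalize hm1 : m.setVar 11 (m.var 0) = m1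
  have e0 : m1.var 0 = m.var 0 := by subst hm1; simp
  have e1 : m1.var 1 = m.var 1 := by subst hm1; simp
  have e9 : m1.var 9 = m.var 9 := by subst hm1; simp
  have e11 : m1.var 11 = m1.var 0 := by subst hm1; simp
  have ea : m1.arr = m.arr := by subst hm1; simp
  rw [← e0, ← e1, ← ea, ← e9]
  clear hm1 e0 e1 ea e9
  refine rep_induction (M := M) (m := m1) (fun i m' =>
    (m'.var 11 = m1.var 0 ∨ m'.var 11 < m1.var 0 ∧ m1.arr 5 (m'.var 11) = 0 ∧
      M (m1.var 1) (m1.var 9) = M (m1.var 9) (m'.var 11)) ∧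
    ∀ y < i, m1.arr 5 y = 0 → M (m1.var 1) (m1.var 9) = M (m1.var 9) y →
      m1.arr 6 (m'.var 11) ≤ m1.arr 6 y) (by simp [e11]) ?_
  intro i hi m' hx hv ha ih
  have h1 : m'.var 1 = m1.var 1 := hv 1 (by simp [assigned, whenZero]) (by simp)
  have h9 : m'.var 9 = m1.var 9 := hv 9 (by simp [assigned, whenZero]) (by simp)
  have haa : m'.arr = m1.arr := funext fun a => ha a (by simp [stored, whenZero])
  obtain ⟨ih1, ih2⟩ := ih
  simp only [run, run_whenZero, Expr.add_eval_eq_zero, Expr.ne_eval_eq_zero,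
    Expr.ge_eval_eq_zero]
  simp only [Expr.eval, hx, h1, h9, haa]
  split_ifs with h
  · obtain ⟨h2, h3, h4⟩ := h
    simp only [Memory.setVar_var]
    refine ⟨Or.inr (by simpa [hi, h2] using h3), fun y hy h5 h6 => ?_⟩
    rcases Nat.lt_succ_iff_lt_or_eq.1 hy with h | rfl
    · have := ih2 y h h5 h6
      simp; omega
    · simp
  · simp only [Memory.setVar_var]
    refine ⟨by simpa using ih1, fun y hy h5 h6 => ?_⟩
    rcases Nat.lt_succ_iff_lt_or_eq.1 hy with h' | rfl
    · simpa using ih2 y h' h5 h6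
    · simp only [h5, h6, true_and, not_lt] at h
      simpa using h

lemma bid_assigned {y : ℕ} (h : y ∉ [11, 10]) : y ∉ bid.assigned := by
  simp at h
  simp [bid, findCheapest, assigned, whenZero, h]

lemma bid_stored {a : ℕ} (h : a ∉ [4, 7, 6]) : a ∉ bid.stored := by
  simp at h
  simp [bid, findCheapest, stored, whenZero, h]

/-- The bidder `m.var 9` either cannot bid less than `n`, and nothing happens, or the auction goes
on and the sum of the prices increases. -/
lemma bid_spec (m : Memory) {X Y : Finset ℕ} (hX : ∀ x ∈ X, x < m.var 0)
    (hY : ∀ y ∈ Y, y < m.var 0) (hR : ∀ y < m.var 0, m.arr 5 y = 0 ↔ y ∈ Y)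
    (h : Auction (m.var 0) X Y (fun x y => M (m.var 1) x = M x y) (m.arr 4) (m.arr 7) (m.arr 6))
    (hx : m.var 9 ∈ X) (hL : m.arr 4 (m.var 9) ≠ 0) :
    ((bid.run M m).arr = m.arr ∧
      ∀ y ∈ Y, M (m.var 1) (m.var 9) = M (m.var 9) y → m.var 0 ≤ m.arr 6 y) ∨
    (Auction (m.var 0) X Y (fun x y => M (m.var 1) x = M x y) ((bid.run M m).arr 4)
        ((bid.run M m).arr 7) ((bid.run M m).arr 6) ∧
      ∑ y ∈ Y, (bid.run M m).arr 6 y = ∑ y ∈ Y, m.arr 6 y + 1 ∧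
      ∃ y ∈ Y, M (m.var 1) (m.var 9) = M (m.var 9) y ∧ m.arr 6 y < m.var 0) := by
  have hf := findCheapest_spec (M := M) m
  have ha : (findCheapest.run M m).arr = m.arr := funext fun a =>
    run_arr_of_notMem (by simp [stored, whenZero, findCheapest]) m
  have hv : ∀ y, y ∉ [11, 10] → (findCheapest.run M m).var y = m.var y := fun y hy =>
    run_var_of_notMem (by simp at hy; simp [assigned, whenZero, findCheapest, hy]) m
  rw [bid]
  simp only [Cmd.run.eq_4]
  generalize findCheapest.run M m = mc at hf ha hv
  have c0 := hv 0 (by simp)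
  have c9 := hv 9 (by simp)
  simp only [run_whenZero, Expr.ge_eval_eq_zero, Expr.eval, ha, c0]
  obtain ⟨hf1, hf2⟩ := hf
  split_ifs with hlt
  · right
    have hbn : mc.var 11 ≠ m.var 0 := by
      intro e; rw [e, h.price_self] at hlt; omega
    obtain ⟨hb1, hb2, hb3⟩ := hf1.resolve_left hbn
    have hbY := (hR _ hb1).1 hb2
    have hb := h.bid hX hY hx hL hbY hb3 hlt fun y hy hxy =>
      hf2 y (hY y hy) ((hR y (hY y hy)).2 hy) hxy
    have e4 : ∀ mm : Memory, mm = Cmd.run M (.seq (.store 4 (.arr 7 (.var 11)) (.const 1))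
        (.seq (.store 7 (.var 11) (.var 9)) (.seq (.store 4 (.var 9) (.const 0))
        (.store 6 (.var 11) (.add (.arr 6 (.var 11)) (.const 1)))))) mc →
        mm.arr 4 = Function.update (Function.update (m.arr 4) (m.arr 7 (mc.var 11)) 1)
          (m.var 9) 0 ∧ mm.arr 7 = Function.update (m.arr 7) (mc.var 11) (m.var 9) ∧
        mm.arr 6 = Function.update (m.arr 6) (mc.var 11) (m.arr 6 (mc.var 11) + 1) := by
      rintro mm rfl
      refine ⟨funext fun z => ?_, funext fun z => ?_, funext fun z => ?_⟩ <;>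
        simp [run, Expr.eval, ha, c9, Function.update_apply]
    obtain ⟨e4, e7, e6⟩ := e4 _ rfl
    rw [e4, e7, e6]
    refine ⟨hb, ?_, mc.var 11, hbY, hb3, hlt⟩
    rw [Finset.sum_update_of_mem hbY, ← Finset.add_sum_erase _ _ hbY,
      Finset.sdiff_singleton_eq_erase]
    omega
  · left
    exact ⟨ha, fun y hy hxy => (not_lt.1 hlt).trans (hf2 y (hY y hy) ((hR y (hY y hy)).2 hy) hxy)⟩

/-- A sweep either raises the sum of the prices, or the auction is over and nothing happens. -/
lemma sweep_spec (m : Memory) {X Y : Finset ℕ} (hX : ∀ x ∈ X, x < m.var 0)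
    (hY : ∀ y ∈ Y, y < m.var 0) (hR : ∀ y < m.var 0, m.arr 5 y = 0 ↔ y ∈ Y)
    (h : Auction (m.var 0) X Y (fun x y => M (m.var 1) x = M x y) (m.arr 4) (m.arr 7)
      (m.arr 6)) :
    Auction (m.var 0) X Y (fun x y => M (m.var 1) x = M x y) ((sweep.run M m).arr 4)
        ((sweep.run M m).arr 7) ((sweep.run M m).arr 6) ∧
    ((∑ y ∈ Y, m.arr 6 y + 1 ≤ ∑ y ∈ Y, (sweep.run M m).arr 6 y ∧
      ¬ AuctionOver (m.var 0) X Y (fun x y => M (m.var 1) x = M x y) (m.arr 4) (m.arr 6)) ∨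
    ((sweep.run M m).arr = m.arr ∧
      AuctionOver (m.var 0) X Y (fun x y => M (m.var 1) x = M x y) (m.arr 4) (m.arr 6))) := by
  rw [sweep]
  have key := rep_induction (M := M) (x := 9) (c := .ite (.arr 4 (.var 9)) bid .skip) (m := m)
    (fun i m' =>
      Auction (m.var 0) X Y (fun x y => M (m.var 1) x = M x y) (m'.arr 4) (m'.arr 7) (m'.arr 6) ∧
      ((∑ y ∈ Y, m.arr 6 y + 1 ≤ ∑ y ∈ Y, m'.arr 6 y ∧
        ¬ AuctionOver (m.var 0) X Y (fun x y => M (m.var 1) x = M x y) (m.arr 4) (m.arr 6)) ∨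
      (m'.arr = m.arr ∧ ∀ x ∈ X, x < i → m.arr 4 x ≠ 0 → ∀ y ∈ Y, M (m.var 1) x = M x y →
        m.var 0 ≤ m.arr 6 y))) ?_ ?_
  · refine ⟨key.1, key.2.imp id fun h => ⟨h.1, fun x hx hLx y hy hxy =>
      h.2 x hx (hX x hx) hLx y hy hxy⟩⟩
  · exact ⟨by simpa using h, Or.inr ⟨by simp, fun x _ hx => absurd hx (by omega)⟩⟩
  · intro i hi m' hx hv ha ih
    have h0 : m'.var 0 = m.var 0 := hv 0 (by simp [assigned, bid_assigned]) (by simp)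
    have h1 : m'.var 1 = m.var 1 := hv 1 (by simp [assigned, bid_assigned]) (by simp)
    have ha5 : m'.arr 5 = m.arr 5 := ha 5 (by simp [stored, bid_stored])
    obtain ⟨ih1, ih2⟩ := ih
    simp only [Memory.setVar_arr, run, Expr.eval, hx]
    by_cases hL : m'.arr 4 i ≠ 0
    · rw [if_pos hL]
      have hiX : i ∈ X := by
        by_contra hiX
        exact hL (ih1.L_eq i hi hiX)
      have hb := bid_spec (M := M) (X := X) (Y := Y) m' (by rwa [h0]) (by rwa [h0])
        (by rwa [h0, ha5]) (by rwa [h0, h1]) (by rwa [hx]) (by rwa [hx])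
      rw [h0, h1, hx] at hb
      rcases hb with ⟨hb1, hb2⟩ | ⟨hb1, hb2, y, hy, hxy, hyn⟩
      · rw [hb1]
        refine ⟨ih1, ih2.imp id fun ⟨hm, hle⟩ => ⟨hm, fun x hx' hxi hLx y hy hxy => ?_⟩⟩
        rcases Nat.lt_succ_iff_lt_or_eq.1 hxi with h' | rfl
        · exact hle x hx' h' hLx y hy hxy
        · rw [← hm]; exact hb2 y hy hxy
      · refine ⟨hb1, Or.inl ?_⟩
        rcases ih2 with ⟨h2, h3⟩ | ⟨hm, -⟩
        · exact ⟨by omega, h3⟩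
        · rw [hm] at hb2 hyn hL
          exact ⟨by omega, fun ho => absurd (ho i hiX hL y hy hxy) (by omega)⟩
    · rw [if_neg hL]
      refine ⟨ih1, ih2.imp id fun ⟨hm, hle⟩ => ⟨hm, fun x hx' hxi hLx y hy hxy => ?_⟩⟩
      rcases Nat.lt_succ_iff_lt_or_eq.1 hxi with h' | rfl
      · exact hle x hx' h' hLx y hy hxy
      · rw [hm] at hL; exact absurd hLx hL

lemma sweep_assigned {y : ℕ} (h : y ∉ [9, 11, 10]) : y ∉ sweep.assigned := by
  simp at h
  simp [sweep, assigned, bid_assigned, h]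

lemma sweep_stored {a : ℕ} (h : a ∉ [4, 7, 6]) : a ∉ sweep.stored := by
  simp [sweep, stored, bid_stored h]

/-- The `n ^ 2` sweeps finish the auction, as the sum of the prices stays below `n ^ 2`. -/
lemma auction_spec (m : Memory) {X Y : Finset ℕ} (hX : ∀ x ∈ X, x < m.var 0)
    (hY : ∀ y ∈ Y, y < m.var 0) (hYn : Y.card < m.var 0)
    (hR : ∀ y < m.var 0, m.arr 5 y = 0 ↔ y ∈ Y)
    (h : Auction (m.var 0) X Y (fun x y => M (m.var 1) x = M x y) (m.arr 4) (m.arr 7)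
      (m.arr 6)) :
    Auction (m.var 0) X Y (fun x y => M (m.var 1) x = M x y) ((auction.run M m).arr 4)
        ((auction.run M m).arr 7) ((auction.run M m).arr 6) ∧
      AuctionOver (m.var 0) X Y (fun x y => M (m.var 1) x = M x y) ((auction.run M m).arr 4)
        ((auction.run M m).arr 6) := by
  let P : ℕ → Memory → Prop := fun r m' =>
    Auction (m.var 0) X Y (fun x y => M (m.var 1) x = M x y) (m'.arr 4) (m'.arr 7) (m'.arr 6) ∧
    (r ≤ ∑ y ∈ Y, m'.arr 6 y ∨
      AuctionOver (m.var 0) X Y (fun x y => M (m.var 1) x = M x y) (m'.arr 4) (m'.arr 6))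
  have key : P (m.var 0 * m.var 0) (auction.run M m) := by
    rw [auction]
    refine rep_induction (M := M) (x := 7) (m := m) (fun i m' => P (i * m.var 0) m')
      ⟨by simpa using h, Or.inl (by simp)⟩ ?_
    intro i hi m' hx hv ha ih
    have h0 : m'.var 0 = m.var 0 := hv 0 (by simp [assigned, sweep_assigned]) (by simp)
    have h1 : m'.var 1 = m.var 1 := hv 1 (by simp [assigned, sweep_assigned]) (by simp)
    have ha5 : m'.arr 5 = m.arr 5 := ha 5 (by simp [stored, sweep_stored])
    suffices hP : P (i * m.var 0 + m'.var 0) ((rep 8 sweep).run M m') by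
      rw [h0, ← Nat.succ_mul] at hP
      exact hP
    refine rep_induction (M := M) (x := 8) (m := m') (fun s m'' => P (i * m.var 0 + s) m'')
      ih ?_
    intro s hs m'' hx' hv' ha' ih'
    have h0' : m''.var 0 = m.var 0 := (hv' 0 (by simp [sweep_assigned]) (by simp)).trans h0
    have h1' : m''.var 1 = m.var 1 := (hv' 1 (by simp [sweep_assigned]) (by simp)).trans h1
    have ha5' : m''.arr 5 = m.arr 5 := (ha' 5 (by simp [sweep_stored])).trans ha5
    have hsw := sweep_spec (M := M) (X := X) (Y := Y) m'' (by rwa [h0']) (by rwa [h0'])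
        (by rwa [h0', ha5']) (by rw [h0', h1']; exact ih'.1)
    rw [h0', h1'] at hsw
    refine ⟨hsw.1, ?_⟩
    rcases hsw.2 with ⟨h2, h3⟩ | ⟨h2, h3⟩
    · left
      have := ih'.2.resolve_right h3
      simp only [Memory.setVar_arr]
      omega
    · right
      simp only [Memory.setVar_arr, h2]
      exact h3
  refine ⟨key.1, key.2.resolve_left fun hle => ?_⟩
  have h2 : ∑ y ∈ Y, (auction.run M m).arr 6 y ≤ Y.card * m.var 0 := by
    rw [← smul_eq_mul]
    exact Finset.sum_le_card_nsmul _ _ _ key.1.price_le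
  have h3 : Y.card * m.var 0 < m.var 0 * m.var 0 :=
    Nat.mul_lt_mul_of_pos_right hYn (by omega)
  omega

end Algo

/-! ### Playing the matches and merging the blocks -/

/-- The matrix `M` describes a tournament on the players `0, …, n - 1`. -/
structure IsTournamentMatrix (M : ℕ → ℕ → ℕ) (n : ℕ) : Prop where
  self : ∀ x, M x x = 0
  swap : ∀ x < n, ∀ y < n, x ≠ y → (M y x = 0 ↔ M x y ≠ 0)

namespace Algo

open Cmd

variable {M : ℕ → ℕ → ℕ}

lemma playAuction_spec (m : Memory) {W X Y : Finset ℕ} (hM : IsTournamentMatrix M (m.var 0))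
    (hW : ∀ x ∈ W, x < m.var 0) (hX : ∀ x ∈ X, x ∈ W ∧ m.arr 3 x = m.var 0)
    (hY : ∀ x ∈ Y, x ∈ W ∧ m.arr 3 x = m.var 0) (hXY : Disjoint X Y)
    {L price : ℕ → ℕ}
    (h : Auction (m.var 0) X Y (fun x y => M (m.var 1) x = M x y) L (m.arr 7) price)
    (hf : Matching M (m.var 0) W (m.arr 3)) :
    Matching M (m.var 0) W ((playAuction.run M m).arr 3) ∧
    (∀ z, z ∉ X → z ∉ Y → (playAuction.run M m).arr 3 z = m.arr 3 z) ∧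
    (∀ y ∈ Y, m.arr 7 y = m.var 0 → (playAuction.run M m).arr 3 y = m.var 0) ∧
    (∀ x ∈ X, (∀ y ∈ Y, m.arr 7 y ≠ x) → (playAuction.run M m).arr 3 x = m.var 0) ∧
    (∀ y ∈ Y, m.arr 7 y ≠ m.var 0 → M (m.var 1) (m.arr 7 y) ≠ 0 →
      (playAuction.run M m).arr 3 y = m.arr 7 y ∧
      (playAuction.run M m).arr 3 (m.arr 7 y) = m.arr 7 y) ∧
    (∀ y ∈ Y, m.arr 7 y ≠ m.var 0 → M (m.var 1) (m.arr 7 y) = 0 →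
      (playAuction.run M m).arr 3 y = y ∧
      (playAuction.run M m).arr 3 (m.arr 7 y) = y) := by
  have hYn : ∀ y ∈ Y, y < m.var 0 := fun y hy => hW y (hY y hy).1
  have hne : ∀ x ∈ X, ∀ y ∈ Y, x ≠ y := fun x hx y hy e =>
    Finset.disjoint_left.1 hXY hx (e ▸ hy)
  have key := rep_induction (M := M) (x := 10) (m := m) (c := whenZero
    (.ge (.arr 7 (.var 10)) (.var 0))
    (.ite (.input (.arr 7 (.var 10)) (.var 10))
      (.seq (.store 3 (.var 10) (.arr 7 (.var 10)))
        (.store 3 (.arr 7 (.var 10)) (.arr 7 (.var 10))))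
      (.seq (.store 3 (.arr 7 (.var 10)) (.var 10)) (.store 3 (.var 10) (.var 10)))))
    (fun i m' => Matching M (m.var 0) W (m'.arr 3) ∧
      (∀ z, z ∉ X → z ∉ Y → m'.arr 3 z = m.arr 3 z) ∧
      (∀ y ∈ Y, m.arr 7 y = m.var 0 ∨ i ≤ y → m'.arr 3 y = m.var 0) ∧
      (∀ x ∈ X, (∀ y ∈ Y, y < i → m.arr 7 y ≠ x) → m'.arr 3 x = m.var 0) ∧
      (∀ y ∈ Y, y < i → m.arr 7 y ≠ m.var 0 →
        (M (m.var 1) (m.arr 7 y) ≠ 0 →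
          m'.arr 3 y = m.arr 7 y ∧ m'.arr 3 (m.arr 7 y) = m.arr 7 y) ∧
        (M (m.var 1) (m.arr 7 y) = 0 → m'.arr 3 y = y ∧ m'.arr 3 (m.arr 7 y) = y))) ?_ ?_
  · obtain ⟨k1, k2, k3, k4, k5⟩ := key
    exact ⟨k1, k2, fun y hy e => k3 y hy (Or.inl e),
      fun x hx hxy => k4 x hx fun y hy _ => hxy y hy,
      fun y hy => fun e => (k5 y hy (hYn y hy) e).1,
      fun y hy => fun e => (k5 y hy (hYn y hy) e).2⟩
  · refine ⟨by simpa using hf, by simp, fun y hy _ => by simpa using (hY y hy).2,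
      fun x hx _ => by simpa using (hX x hx).2, fun y _ hy => absurd hy (by omega)⟩
  · intro i hi m' hx hv ha ih
    have h0 : m'.var 0 = m.var 0 := hv 0 (by simp [assigned, whenZero]) (by simp)
    have ha7 : m'.arr 7 = m.arr 7 := ha 7 (by simp [stored, whenZero])
    obtain ⟨i1, i2, i3, i4, i5⟩ := ih
    simp only [run_whenZero, Expr.ge_eval_eq_zero, Expr.eval, hx, h0, ha7, Memory.setVar_arr]
    by_cases hlt : m.arr 7 i < m.var 0
    · rw [if_pos hlt]
      have hiY : i ∈ Y := by
        by_contra hiY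
        exact hlt.ne (h.own_eq i hi hiY)
      obtain ⟨hox, hadj, -⟩ := h.own_mem i hi hlt.ne
      set x := m.arr 7 i with hxdef
      have hxi : x ≠ i := hne x hox i hiY
      have hfi : m'.arr 3 i = m.var 0 := i3 i hiY (Or.inr le_rfl)
      have hfx : m'.arr 3 x = m.var 0 := i4 x hox fun y hy hyi e =>
        hyi.ne' (h.own_inj i hi y (hYn y hy) hlt.ne e.symm)
      -- the opponent of a bidder is its object
      have hother : ∀ y ∈ Y, y < i → m.arr 7 y ≠ x := fun y hy hyi e =>
        hyi.ne' (h.own_inj i hi y (hYn y hy) hlt.ne e.symm)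
      obtain ⟨g, hg, hmatch, hgx, hgi, hgz⟩ : ∃ g : ℕ → ℕ,
          ((Cmd.ite (.input (.arr 7 (.var 10)) (.var 10))
            (.seq (.store 3 (.var 10) (.arr 7 (.var 10)))
              (.store 3 (.arr 7 (.var 10)) (.arr 7 (.var 10))))
            (.seq (.store 3 (.arr 7 (.var 10)) (.var 10))
              (.store 3 (.var 10) (.var 10)))).run M m').arr 3 = g ∧
          Matching M (m.var 0) W g ∧
          (M (m.var 1) x ≠ 0 → g i = x ∧ g x = x) ∧
          (M (m.var 1) x = 0 → g i = i ∧ g x = i) ∧ (∀ z, z ≠ x → z ≠ i → g z = m'.arr 3 z) := by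
        by_cases hb : M x i = 0
        · refine ⟨Function.update (Function.update (m'.arr 3) x i) i i, ?_, ?_, ?_, ?_, ?_⟩
          · funext z
            simp [run, Expr.eval, hx, ha7, ← hxdef, hb, Function.update_apply]
          · exact i1.add hW (hY i hiY).1 (hX x hox).1 hxi.symm hfi hfx
              ((hM.swap i hi x hlt hxi.symm).1 hb)
          · intro h'; rw [hadj] at h'; exact absurd hb h'
          · intro _; simp [hxi]
          · intro z h1 h2; simp [h1, h2]
        · refine ⟨Function.update (Function.update (m'.arr 3) i x) x x, ?_, ?_, ?_, ?_, ?_⟩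
          · funext z
            simp [run, Expr.eval, hx, ha7, ← hxdef, hb, Function.update_apply]
          · exact i1.add hW (hX x hox).1 (hY i hiY).1 hxi hfx hfi hb
          · intro _; simp [hxi.symm]
          · intro h'; rw [hadj] at h'; exact absurd h' hb
          · intro z h1 h2; simp [h1, h2]
      rw [hg]
      refine ⟨hmatch, ?_, ?_, ?_, ?_⟩
      · intro z hzX hzY
        rw [hgz z (fun e => hzX (e ▸ hox)) (fun e => hzY (e ▸ hiY))]
        exact i2 z hzX hzY
      · intro y hy hyi
        have e1 : y ≠ i := by
          rintro rfl
          rcases hyi with e | e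
          · exact hlt.ne e
          · omega
        rw [hgz y (fun e => hne x hox y hy e.symm) e1]
        exact i3 y hy (hyi.imp id (by omega))
      · intro z hz hyz
        have e1 : z ≠ x := fun e => hyz i hiY (by omega) (e ▸ hxdef.symm)
        rw [hgz z e1 (hne z hz i hiY)]
        exact i4 z hz fun y hy hyi => hyz y hy (by omega)
      · intro y hy hyi hyn
        rcases Nat.lt_succ_iff_lt_or_eq.1 hyi with h' | rfl
        · have hmx := h.own_mem y (hYn y hy) hyn
          rw [hgz y (fun e => hne x hox y hy e.symm) h'.ne,
            hgz _ (hother y hy h') (hne _ hmx.1 i hiY)]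
          exact i5 y hy h' hyn
        · exact ⟨hgx, hgi⟩
    · rw [if_neg hlt]
      have hin : m.arr 7 i = m.var 0 := by
        by_contra e
        exact hlt (hW _ (hX _ (h.own_mem i hi e).1).1)
      refine ⟨i1, i2, fun y hy hyi => ?_, fun x hx hyx => ?_, fun y hy hyi hyn => ?_⟩
      · refine i3 y hy (hyi.imp id (by omega))
      · exact i4 x hx fun y hy hyi => hyx y hy (by omega)
      · rcases Nat.lt_succ_iff_lt_or_eq.1 hyi with h' | rfl
        · exact i5 y hy h' hyn
        · exact absurd hin hyn

lemma playGreedy_spec (m : Memory) (e : Expr) {E : ℕ → ℕ → Prop}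
    (hE : ∀ m' : Memory, m'.var 1 = m.var 1 → (e.eval M m' = 0 ↔ E (m'.var 9) (m'.var 10)))
    {W : Finset ℕ} (hM : IsTournamentMatrix M (m.var 0)) (hW : ∀ x ∈ W, x < m.var 0)
    (hWf : ∀ x < m.var 0, x ∉ W → m.arr 3 x ≠ m.var 0)
    (hf : Matching M (m.var 0) W (m.arr 3)) :
    Matching M (m.var 0) W (((playGreedy e).run M m).arr 3) ∧
    (∀ z, m.arr 3 z ≠ m.var 0 → ((playGreedy e).run M m).arr 3 z = m.arr 3 z) ∧
    (∀ z, m.arr 3 z = m.var 0 → ((playGreedy e).run M m).arr 3 z ≠ m.var 0 →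
      ((playGreedy e).run M m).arr 3 z = z ∧ (∃ y, E z y) ∨
      ((playGreedy e).run M m).arr 3 z ≠ z ∧ ∃ y, E y z) ∧
    (∀ x ∈ W, ∀ y ∈ W, M x y ≠ 0 → E x y →
      ((playGreedy e).run M m).arr 3 x ≠ m.var 0 ∨
      ((playGreedy e).run M m).arr 3 y ≠ m.var 0) := by
  let P : ℕ → ℕ → Memory → Prop := fun i j m' =>
    Matching M (m.var 0) W (m'.arr 3) ∧
    (∀ z, m.arr 3 z ≠ m.var 0 → m'.arr 3 z = m.arr 3 z) ∧
    (∀ z, m.arr 3 z = m.var 0 → m'.arr 3 z ≠ m.var 0 →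
      m'.arr 3 z = z ∧ (∃ y, E z y) ∨ m'.arr 3 z ≠ z ∧ ∃ y, E y z) ∧
    (∀ x ∈ W, ∀ y ∈ W, (x < i ∨ x = i ∧ y < j) → M x y ≠ 0 → E x y →
      m'.arr 3 x ≠ m.var 0 ∨ m'.arr 3 y ≠ m.var 0)
  have key : P (m.var 0) 0 ((playGreedy e).run M m) := by
    rw [playGreedy]
    refine rep_induction (M := M) (x := 9) (m := m) (fun i m' => P i 0 m')
      ⟨by simpa using hf, by simp, fun z h1 h2 => absurd h1 h2,
        fun x _ y _ h => absurd h (by omega)⟩ ?_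
    intro i hi m1 hx1 hv1 ha1 ih1
    have h01 : m1.var 0 = m.var 0 := hv1 0 (by simp [assigned, whenZero]) (by simp)
    have h11 : m1.var 1 = m.var 1 := hv1 1 (by simp [assigned, whenZero]) (by simp)
    generalize hc : Cmd.rep 10 _ = c
    suffices h : P i (m1.var 0) (c.run M m1) by
      obtain ⟨k1, k2, k3, k4⟩ := h
      refine ⟨k1, k2, k3, fun x hx y hy hxy => k4 x hx y hy ?_⟩
      have := hW y hy
      omega
    rw [← hc]
    refine rep_induction (M := M) (x := 10) (m := m1) (fun j m' => P i j m') ih1 ?_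
    intro j hj m2 hx2 hv2 ha2 ih2
    have h02 : m2.var 0 = m.var 0 := (hv2 0 (by simp [assigned, whenZero]) (by simp)).trans h01
    have h12 : m2.var 1 = m.var 1 := (hv2 1 (by simp [assigned, whenZero]) (by simp)).trans h11
    have h92 : m2.var 9 = i := (hv2 9 (by simp [assigned, whenZero]) (by simp)).trans hx1
    rw [h01] at hj
    obtain ⟨i1, i2, i3, i4⟩ := ih2
    rw [run_whenZero]
    have hiff : (Expr.add (.ne (.arr 3 (.var 9)) (.var 0)) (.add (.ne (.arr 3 (.var 10)) (.var 0))
        (.add (.isZero (.input (.var 9) (.var 10))) e))).eval M m2 = 0 ↔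
        m2.arr 3 i = m.var 0 ∧ m2.arr 3 j = m.var 0 ∧ M i j ≠ 0 ∧ E i j := by
      rw [Expr.add_eval_eq_zero, Expr.add_eval_eq_zero, Expr.add_eval_eq_zero,
        Expr.ne_eval_eq_zero, Expr.ne_eval_eq_zero, Expr.isZero_eval_eq_zero, hE m2 h12, h92, hx2]
      simp only [Expr.eval, h02, h92, hx2]
    have hmem : ∀ x < m.var 0, m2.arr 3 x = m.var 0 → x ∈ W := by
      intro x hx hxn
      by_contra hxW
      have := i2 x (hWf x hx hxW)
      exact hWf x hx hxW (this ▸ hxn)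
    by_cases hcond : m2.arr 3 i = m.var 0 ∧ m2.arr 3 j = m.var 0 ∧ M i j ≠ 0 ∧ E i j
    · rw [if_pos (hiff.2 hcond)]
      obtain ⟨c1, c2, c3, c4⟩ := hcond
      have hij : i ≠ j := by rintro rfl; exact c3 (hM.self i)
      have hadd := i1.add hW (hmem i hi c1) (hmem j hj c2) hij c1 c2 c3
      have he : ((((Cmd.store 3 (.var 10) (.var 9)).seq (.store 3 (.var 9) (.var 9))).run M
          m2).setVar 10 (j + 1)).arr 3 =
          Function.update (Function.update (m2.arr 3) j i) i i := by
        funext z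
        simp [run, Expr.eval, hx2, h92, Function.update_apply]
      have hz : ∀ z, z ≠ i → z ≠ j →
          Function.update (Function.update (m2.arr 3) j i) i i z = m2.arr 3 z := by
        intro z h1 h2; simp [h1, h2]
      have hzi : Function.update (Function.update (m2.arr 3) j i) i i i = i := by simp
      have hzj : Function.update (Function.update (m2.arr 3) j i) i i j = i := by
        simp [hij.symm]
      refine ⟨by rw [he]; exact hadd, ?_, ?_, ?_⟩ <;> rw [he]
      · intro z hzn
        have e1 : z ≠ i := by
          rintro rfl; exact hzn (by rw [← i2 z hzn, c1])
        have e2 : z ≠ j := by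
          rintro rfl; exact hzn (by rw [← i2 z hzn, c2])
        rw [hz z e1 e2]
        exact i2 z hzn
      · intro z h1 h2
        by_cases e1 : z = i
        · subst e1; exact Or.inl ⟨hzi, j, c4⟩
        by_cases e2 : z = j
        · subst e2; exact Or.inr ⟨by rw [hzj]; exact hij, i, c4⟩
        rw [hz z e1 e2] at h2 ⊢
        exact i3 z h1 h2
      · intro x hx y hy hxy hb hExy
        by_cases ex : x = i
        · left; subst ex; rw [hzi]; exact hi.ne
        by_cases ey : y = i
        · right; subst ey; rw [hzi]; exact hi.ne
        by_cases ex' : x = j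
        · left; subst ex'; rw [hzj]; exact hi.ne
        by_cases ey' : y = j
        · right; subst ey'; rw [hzj]; exact hi.ne
        rw [hz x ex ex', hz y ey ey']
        exact i4 x hx y hy (by omega) hb hExy
    · rw [if_neg (mt hiff.1 hcond)]
      refine ⟨i1, i2, i3, fun x hx y hy hxy hb hExy => ?_⟩
      by_cases hxy' : x = i ∧ y = j
      · obtain ⟨rfl, rfl⟩ := hxy'
        simp only [Memory.setVar_arr]
        tauto
      · exact i4 x hx y hy (by omega) hb hExy
  obtain ⟨k1, k2, k3, k4⟩ := key
  exact ⟨k1, k2, k3, fun x hx y hy => k4 x hx y hy (Or.inl (hW x hx))⟩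

lemma merge_spec (m : Memory) :
    ∀ x < m.var 0, (merge.run M m).arr 1 x = m.arr 3 (m.arr 1 x) ∧
      (merge.run M m).arr 2 x =
        m.arr 2 x + if m.arr 3 (m.arr 1 x) = m.arr 1 x then 0 else m.var 3 := by
  have key := rep_induction (M := M) (x := 9) (m := m) (c := .ite
    (.ne (.arr 3 (.arr 1 (.var 9))) (.arr 1 (.var 9)))
    (.seq (.store 2 (.var 9) (.add (.arr 2 (.var 9)) (.var 3)))
      (.store 1 (.var 9) (.arr 3 (.arr 1 (.var 9))))) .skip)
    (fun i m' => ∀ x, (i ≤ x → m'.arr 1 x = m.arr 1 x ∧ m'.arr 2 x = m.arr 2 x) ∧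
      (x < i → m'.arr 1 x = m.arr 3 (m.arr 1 x) ∧
        m'.arr 2 x = m.arr 2 x + if m.arr 3 (m.arr 1 x) = m.arr 1 x then 0 else m.var 3))
    (by simp) ?_
  · exact fun x hx => (key x).2 hx
  · intro i hi m' hx hv ha ih x
    have h3 : m'.var 3 = m.var 3 := hv 3 (by simp [assigned]) (by simp)
    have ha3 : m'.arr 3 = m.arr 3 := ha 3 (by simp [stored])
    obtain ⟨e1, e2⟩ := (ih i).1 le_rfl
    simp only [run, ne_eq, Expr.ne_eval_eq_zero]
    simp only [Expr.eval, hx, ha3, h3, e1, e2, Memory.setVar_arr]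
    by_cases e : m.arr 3 (m.arr 1 i) = m.arr 1 i
    · rw [if_neg (by simpa using e)]
      refine ⟨fun h => (ih x).1 (by omega), fun h => ?_⟩
      rcases Nat.lt_succ_iff_lt_or_eq.1 h with h' | rfl
      · exact (ih x).2 h'
      · simp [e, e1, e2]
    · rw [if_pos (by simpa using e)]
      refine ⟨fun h => ?_, fun h => ?_⟩
      · have : x ≠ i := by omega
        simpa [this, hx] using (ih x).1 (by omega)
      · rcases Nat.lt_succ_iff_lt_or_eq.1 h with h' | rfl
        · simpa [h'.ne, hx] using (ih x).2 h'
        · simp [e, hx, e1, ha3]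

end Algo

/-! ### One round -/

/-- The players that are still in the tournament, where `champ x` is the champion of the block
of `x`. -/
def alive (n : ℕ) (champ : ℕ → ℕ) : Finset ℕ := {x ∈ Finset.range n | champ x = x}

/-- The remaining players that are beaten by `v`. -/
def wins (M : ℕ → ℕ → ℕ) (W : Finset ℕ) (v : ℕ) : Finset ℕ := {y ∈ W | M v y ≠ 0}

/-- The remaining players that are beaten by `v` and beat `x`. -/
def common (M : ℕ → ℕ → ℕ) (W : Finset ℕ) (v x : ℕ) : Finset ℕ :=
  {y ∈ W | M v y ≠ 0 ∧ M y x ≠ 0}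

/-- The bidders of the auction, when `v` plays `a` in the current round, and `j` rounds remain.
Players who beat `v` bid if fewer than `j` of the players that are beaten by `v` beat them, and
players that are beaten by `v` bid if there are fewer than `n / 4` of them. -/
def bidders (M : ℕ → ℕ → ℕ) (n : ℕ) (W : Finset ℕ) (v j a : ℕ) : Finset ℕ :=
  {x ∈ W | (x ≠ v ∧ x ≠ a) ∧ (M v x ≠ 0 ∧ 4 * (wins M W v).card < n ∨
    M v x = 0 ∧ (common M W v x).card < j)}

/-- The objects of the auction. -/
def objects (M : ℕ → ℕ → ℕ) (n : ℕ) (W : Finset ℕ) (v j a : ℕ) : Finset ℕ :=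
  {x ∈ W | (x ≠ v ∧ x ≠ a) ∧ (M v x ≠ 0 ∧ ¬ 4 * (wins M W v).card < n ∨
    M v x = 0 ∧ ¬ (common M W v x).card < j ∧ 4 * (wins M W v).card < n)}

/-- Hall's condition for the bidders and objects of the auction, for every possible opponent of
`v`. -/
def HallCondition (M : ℕ → ℕ → ℕ) (n : ℕ) (W : Finset ℕ) (v j : ℕ) : Prop :=
  ∀ a ∈ W, M v a ≠ 0 → ∀ X ⊆ bidders M n W v j a,
    X.card ≤ {y ∈ objects M n W v j a | ∃ x ∈ X, M v x = M x y}.card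

/-- Every remaining player who beats `v` loses to at least `j` of the remaining players that are
beaten by `v`. -/
def IsSuperking (M : ℕ → ℕ → ℕ) (W : Finset ℕ) (v j : ℕ) : Prop :=
  ∀ x ∈ W, x ≠ v → M v x = 0 → j ≤ (common M W v x).card

namespace Algo

open Cmd

variable {M : ℕ → ℕ → ℕ}

set_option maxHeartbeats 2000000 in
/-- One round: `f` describes its matches. If `v` is a superking, or if the auction can satisfy all
bidders, then afterwards `v` is a superking, up to the decreasing number of remaining rounds. -/
theorem round_spec (m : Memory) {W : Finset ℕ} (hWdef : W = alive (m.var 0) (m.arr 1))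
    (hM : IsTournamentMatrix M (m.var 0))
    (hv : m.var 1 ∈ W) (heven : Even W.card)
    (hne : (wins M W (m.var 1)).Nonempty)
    (hgood : IsSuperking M W (m.var 1) (m.var 2) ∨
      HallCondition M (m.var 0) W (m.var 1) (m.var 2)) :
    ∃ f : ℕ → ℕ, Matching M (m.var 0) W f ∧ (∀ x ∈ W, f x ≠ m.var 0) ∧ f (m.var 1) = m.var 1 ∧
      (∀ x < m.var 0, (round.run M m).arr 1 x = f (m.arr 1 x) ∧
        (round.run M m).arr 2 x =
          m.arr 2 x + if f (m.arr 1 x) = m.arr 1 x then 0 else m.var 3) ∧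
      (round.run M m).var 2 = m.var 2 - 1 ∧ (round.run M m).var 3 = m.var 3 + m.var 3 ∧
      IsSuperking M {x ∈ W | f x = x} (m.var 1) (m.var 2 - 1) := by
  obtain ⟨n, hn⟩ : ∃ n, n = m.var 0 := ⟨_, rfl⟩
  obtain ⟨v, hvdef⟩ : ∃ v, v = m.var 1 := ⟨_, rfl⟩
  obtain ⟨j, hj⟩ : ∃ j, j = m.var 2 := ⟨_, rfl⟩
  rw [← hn] at hM hgood
  rw [← hvdef] at hv hne hgood
  rw [← hj] at hgood
  rw [← hn, ← hvdef, ← hj]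
  have memW : ∀ x, x ∈ W ↔ x < n ∧ m.arr 1 x = x := by
    intro x; rw [hWdef, alive, ← hn]; simp
  have hW : ∀ x ∈ W, x < n := fun x hx => ((memW x).1 hx).1
  have hvn : v < n := hW v hv
  have hMv : M v v = 0 := hM.self v
  obtain ⟨mf, hmf⟩ : ∃ mf, mf = round.run M m := ⟨_, rfl⟩
  rw [← hmf]
  rw [round] at hmf
  simp only [Cmd.run.eq_4] at hmf
  -- the memory after `clear`
  have s1 := clear_spec (M := M) m
  have a1 : ∀ a, a ∉ [3, 4, 5, 6, 7] → (clear.run M m).arr a = m.arr a := fun a h =>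
    run_arr_of_notMem (by simp at h; simp [clear, stored, whenZero, h]) m
  have v1 : ∀ y, y ∉ [9] → (clear.run M m).var y = m.var y := fun y h =>
    run_var_of_notMem (by simp at h; simp [clear, assigned, whenZero, h]) m
  generalize clear.run M m = m1 at s1 a1 v1 hmf
  rw [← hn] at s1
  -- the memory after `findOpponent`
  have s2 := findOpponent_spec (M := M) m1
  have a2 : ∀ a, (findOpponent.run M m1).arr a = m1.arr a := fun a =>
    run_arr_of_notMem (by simp [findOpponent, stored, whenZero]) m1
  have v2 : ∀ y, y ∉ [4, 5, 9] → (findOpponent.run M m1).var y = m.var y := fun y h => by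
    rw [run_var_of_notMem (by simp at h; simp [findOpponent, assigned, whenZero, h]) m1]
    exact v1 y (by simp at h ⊢; tauto)
  generalize findOpponent.run M m1 = m2 at s2 a2 v2 hmf
  rw [v1 0 (by simp), v1 1 (by simp), a1 1 (by simp), ← hn, ← hvdef] at s2
  obtain ⟨s2c, s2a⟩ := s2
  have hcnt : m2.var 5 = (wins M W v).card := by
    rw [s2c, wins, hWdef, alive, Finset.filter_filter, ← hn]
  obtain ⟨a, ha⟩ : ∃ a, a = m2.var 4 := ⟨_, rfl⟩
  have hopp : a ∈ W ∧ M v a ≠ 0 := by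
    obtain ⟨y, hy⟩ := hne
    obtain ⟨hyW, hyv⟩ := Finset.mem_filter.1 hy
    have := s2a ⟨y, ((memW y).1 hyW).1, ((memW y).1 hyW).2, hyv⟩
    rw [← ha] at this
    exact ⟨(memW a).2 ⟨this.1, this.2.1⟩, this.2.2⟩
  obtain ⟨haW, hva⟩ := hopp
  have hav : v ≠ a := by rintro rfl; exact hva hMv
  -- the memory after `playOpponent`
  have f2 : ∀ x < n, m2.arr 3 x = if x ∈ W then n else 0 := by
    intro x hx
    rw [a2, s1.1 x hx]
    simp [memW, hx]
  have s3 : (playOpponent.run M m2).arr 3 =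
      Function.update (Function.update (m2.arr 3) a v) v v := by
    funext z
    simp [playOpponent, run, Expr.eval, v2, ← ha, ← hvdef, Function.update_apply]
  have a3 : ∀ b, b ≠ 3 → (playOpponent.run M m2).arr b = m1.arr b := fun b h => by
    rw [run_arr_of_notMem (by simp [playOpponent, stored, h]) m2, a2]
  have v3 : (playOpponent.run M m2).var = m2.var := rfl
  generalize playOpponent.run M m2 = m3 at s3 a3 v3 hmf
  have mat3 : Matching M n W (m3.arr 3) := by
    rw [s3]
    have h0 : Matching M n W (m2.arr 3) := by
      constructor
      · intro x hx; left; simp [f2 x (hW x hx), hx]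
      · intro x hx h; exact absurd (by simp [f2 x (hW x hx), hx]) h
      · intro x hx _ _ h; exact absurd (by simp [f2 x (hW x hx), hx]) h
      · intro x hx h
        rw [f2 x (hW x hx), if_pos hx] at h
        exact absurd h (hW x hx).ne'
    exact h0.add hW hv haW hav (by simp [f2 v hvn, hv]) (by simp [f2 a (hW a haW), haW]) hva
  have f3v : m3.arr 3 v = v := by simp [s3]
  have f3a : m3.arr 3 a = v := by simp [s3, hav.symm]
  have f3 : ∀ x < n, (m3.arr 3 x = n ↔ x ∈ W ∧ x ≠ v ∧ x ≠ a) := by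
    intro x hx
    by_cases e1 : x = v
    · subst e1; simp [f3v, hx.ne]
    by_cases e2 : x = a
    · subst e2; simp [f3a, hvn.ne]
    rw [s3]
    by_cases hxW : x ∈ W
    · simp [e1, e2, f2 x hx, hxW]
    · simp only [Function.update_of_ne e1, Function.update_of_ne e2, f2 x hx, hxW, if_false,
        false_and, iff_false]
      omega
  -- the memory after `chooseSides`
  have v3' : ∀ y, y ∉ [4, 5, 9] → m3.var y = m.var y := fun y h => by rw [v3]; exact v2 y h
  have hdeg : ∀ x, (common M W v x).card = {y ∈ Finset.range (m3.var 0) |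
      m3.arr 1 y = y ∧ M (m3.var 1) y ≠ 0 ∧ M y x ≠ 0}.card := by
    intro x
    rw [common, hWdef, alive, Finset.filter_filter, v3' 0 (by simp), v3' 1 (by simp), ← hvdef,
      a3 1 (by simp), a1 1 (by simp)]
  have s4 := chooseSides_spec (M := M) m3 (fun x => (common M W v x).card) hdeg
  have a4 : ∀ b, b ∉ [4, 5] → (chooseSides.run M m3).arr b = m3.arr b := fun b h =>
    run_arr_of_notMem (by simp at h; simp [chooseSides, stored, whenZero, countCommon, h]) m3
  have v4 : ∀ y, y ∉ [4, 5, 9, 10, 12] → (chooseSides.run M m3).var y = m.var y := fun y h => by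
    rw [run_var_of_notMem
      (by simp at h; simp [chooseSides, countCommon, assigned, whenZero, h]) m3]
    exact v3' y (by simp at h ⊢; tauto)
  generalize chooseSides.run M m3 = m4 at s4 a4 v4 hmf
  rw [v3' 0 (by simp), v3' 1 (by simp), v3' 2 (by simp), v3, hcnt, ← hn, ← hvdef, ← hj] at s4
  obtain ⟨X, hX⟩ : ∃ X, X = bidders M n W v j a := ⟨_, rfl⟩
  obtain ⟨Y, hY⟩ : ∃ Y, Y = objects M n W v j a := ⟨_, rfl⟩
  have memX : ∀ x, x ∈ X ↔ x ∈ W ∧ (x ≠ v ∧ x ≠ a) ∧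
      (M v x ≠ 0 ∧ 4 * (wins M W v).card < n ∨ M v x = 0 ∧ (common M W v x).card < j) := by
    intro x; rw [hX, bidders]; simp
  have memY : ∀ x, x ∈ Y ↔ x ∈ W ∧ (x ≠ v ∧ x ≠ a) ∧ (M v x ≠ 0 ∧ ¬ 4 * (wins M W v).card < n ∨
      M v x = 0 ∧ ¬ (common M W v x).card < j ∧ 4 * (wins M W v).card < n) := by
    intro x; rw [hY, objects]; simp
  have hL4 : ∀ x < n, m4.arr 4 x = if x ∈ X then 1 else 0 := by
    intro x hx
    rw [(s4 x hx).1, a3 4 (by simp), (s1.2.1 x hx).1]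
    refine if_congr ?_ rfl rfl
    rw [f3 x hx, memX]
    clear * -
    tauto
  have hR4 : ∀ x < n, (m4.arr 5 x = 0 ↔ x ∈ Y) := by
    intro x hx
    have hcond : (m3.arr 3 x = n ∧ (M v x ≠ 0 ∧ ¬ 4 * (wins M W v).card < n ∨
        M v x = 0 ∧ ¬ (common M W v x).card < j ∧ 4 * (wins M W v).card < n)) ↔ x ∈ Y := by
      rw [f3 x hx, memY]
      clear * -
      tauto
    rw [(s4 x hx).2, a3 5 (by simp), (s1.2.1 x hx).2.1, if_congr hcond rfl rfl]
    split_ifs with h <;> simp [h]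
  have hXn : ∀ x ∈ X, x < n := fun x hx => hW x ((memX x).1 hx).1
  have hYn : ∀ y ∈ Y, y < n := fun y hy => hW y ((memY y).1 hy).1
  have hXYd : Disjoint X Y := by
    rw [Finset.disjoint_left]
    intro x hx hy
    have h1 := ((memX x).1 hx).2.2
    have h2 := ((memY x).1 hy).2.2
    clear * - h1 h2
    tauto
  have hYc : Y.card < n := by
    have : Y ⊆ (Finset.range n).erase v := fun y hy =>
      Finset.mem_erase.2 ⟨((memY y).1 hy).2.1.1, Finset.mem_range.2 (hYn y hy)⟩
    have := Finset.card_le_card this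
    rw [Finset.card_erase_of_mem (Finset.mem_range.2 hvn), Finset.card_range] at this
    omega
  have own4 : ∀ y < n, m4.arr 7 y = n := by
    intro y hy; rw [a4 7 (by simp), a3 7 (by simp), (s1.2.1 y hy).2.2.2]
  have price4 : ∀ y < n, m4.arr 6 y = 0 := by
    intro y hy; rw [a4 6 (by simp), a3 6 (by simp), (s1.2.1 y hy).2.2.1]
  have auc4 : Auction n X Y (fun x y => M v x = M x y) (m4.arr 4) (m4.arr 7) (m4.arr 6) := by
    constructor
    · intro y hy _; exact own4 y hy
    · intro y hy h; exact absurd (own4 y hy) h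
    · intro y hy _ _ h; exact absurd (own4 y hy) h
    · intro x hx h
      rw [hL4 x (hXn x hx), if_pos hx] at h
      exact absurd h one_ne_zero
    · intro x hx h; rw [hL4 x hx, if_neg h]
    · intro y hy _; exact price4 y (hYn y hy)
    · intro y hy; rw [price4 y (hYn y hy)]; exact Nat.zero_le _
    · intro y hy h; exact absurd (own4 y hy) h
    · rw [a4 6 (by simp), a3 6 (by simp), s1.2.2]
  -- the memory after `auction`
  have e40 : m4.var 0 = n := (v4 0 (by simp)).trans hn.symm
  have e41 : m4.var 1 = v := (v4 1 (by simp)).trans hvdef.symm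
  have s5 := auction_spec (M := M) (X := X) (Y := Y) m4 (by rwa [e40]) (by rwa [e40])
    (by rwa [e40]) (by rwa [e40]) (by rwa [e40, e41])
  have a5 : ∀ b, b ∉ [4, 7, 6] → (auction.run M m4).arr b = m4.arr b := fun b h =>
    run_arr_of_notMem (by simp only [auction, stored]; exact sweep_stored h) m4
  have v5 : ∀ y, y ∉ [4, 5, 7, 8, 9, 10, 11, 12] → (auction.run M m4).var y = m.var y :=
    fun y h => by
      simp at h
      rw [run_var_of_notMem (by simp [auction, assigned, sweep_assigned, h]) m4]
      exact v4 y (by simp; tauto)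
  generalize auction.run M m4 = m5 at s5 a5 v5 hmf
  rw [e40, e41] at s5
  obtain ⟨auc5, over5⟩ := s5
  have f5 : m5.arr 3 = m3.arr 3 := by rw [a5 3 (by simp), a4 3 (by simp)]
  have sat : HallCondition M n W v j → ∀ x ∈ X, m5.arr 4 x = 0 := fun hall =>
    auc5.saturated hYn hYc over5 (by
      classical
      intro X' hX'
      have := hall a haW hva X' (by rwa [← hX])
      rw [← hY] at this
      convert this)
  -- the memory after `playAuction`
  have e50 : m5.var 0 = n := (v5 0 (by simp)).trans hn.symm
  have e51 : m5.var 1 = v := (v5 1 (by simp)).trans hvdef.symm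
  have s6 := playAuction_spec (M := M) (W := W) (X := X) (Y := Y) m5 (by rwa [e50])
    (by rwa [e50])
    (by
      intro x hx; rw [e50, f5, f3 x (hXn x hx)]
      have := (memX x).1 hx; exact ⟨this.1, this.1, this.2.1⟩)
    (by
      intro x hx; rw [e50, f5, f3 x (hYn x hx)]
      have := (memY x).1 hx; exact ⟨this.1, this.1, this.2.1⟩)
    hXYd (L := m5.arr 4) (price := m5.arr 6) (by rwa [e50, e51]) (by rwa [e50, f5])
  have a6 : ∀ b, b ≠ 3 → (playAuction.run M m5).arr b = m5.arr b := fun b h =>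
    run_arr_of_notMem (by simp [playAuction, stored, whenZero, h]) m5
  have v6 : ∀ y, y ∉ [4, 5, 7, 8, 9, 10, 11, 12] → (playAuction.run M m5).var y = m.var y :=
    fun y h => by
      have h' := h
      simp at h
      rw [run_var_of_notMem (by simp [playAuction, assigned, whenZero, h]) m5]
      exact v5 y h'
  generalize playAuction.run M m5 = m6 at s6 a6 v6 hmf
  rw [e50, e51, f5] at s6
  obtain ⟨mat6, s6a, s6b, s6c, s6d, s6e⟩ := s6
  have hnXY : ∀ x, x = v ∨ x = a ∨ x ∉ W → x ∉ X ∧ x ∉ Y := by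
    intro x hx
    rw [memX, memY]
    clear * - hx
    tauto
  have f6v : m6.arr 3 v = v := by
    rw [s6a v (hnXY v (Or.inl rfl)).1 (hnXY v (Or.inl rfl)).2, f3v]
  -- players that are beaten by `v`, other than its opponent, have won or do not play yet
  have alpha : ∀ x ∈ W, M v x ≠ 0 → x ≠ a → m6.arr 3 x = n ∨ m6.arr 3 x = x := by
    intro x hx hvx hxa
    have hxv : x ≠ v := by rintro rfl; exact hvx hMv
    by_cases hxX : x ∈ X
    · by_cases hex : ∃ y ∈ Y, m5.arr 7 y = x
      · obtain ⟨y, hy, rfl⟩ := hex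
        exact Or.inr (s6d y hy (hW _ hx).ne hvx).2
      · push Not at hex
        exact Or.inl (s6c x hxX hex)
    by_cases hxY : x ∈ Y
    · by_cases hox : m5.arr 7 x = n
      · exact Or.inl (s6b x hxY hox)
      · right
        have hmem := auc5.own_mem x (hW x hx) hox
        refine (s6e x hxY hox ?_).1
        -- the objects are beaten by `v`, so the bidders are not
        have h1 := ((memX _).1 hmem.1).2.2
        have h2 := ((memY x).1 hxY).2.2
        clear * - h1 h2 hvx
        tauto
    · left
      rw [s6a x hxX hxY, f3 x (hW x hx)]
      exact ⟨hx, hxv, hxa⟩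
  -- players who beat `v` and won in the auction
  have beta : ∀ x ∈ W, x ≠ v → M v x = 0 → m6.arr 3 x = x →
      (∀ y ∈ W, M v y ≠ 0 → y ≠ a → m6.arr 3 y = y) := by
    intro x hx hxv hvx hfx y hy hvy hya
    have hyv : y ≠ v := by rintro rfl; exact hvy hMv
    have hxa : x ≠ a := by rintro rfl; exact hva hvx
    by_cases hxY : x ∈ Y
    · by_cases hox : m5.arr 7 x = n
      · rw [s6b x hxY hox] at hfx
        exact absurd hfx (hW x hx).ne'
      have hmem := auc5.own_mem x (hW x hx) hox
      have hvo : M v (m5.arr 7 x) = 0 := by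
        by_contra hvo
        have := (s6d x hxY hox hvo).1
        rw [hfx] at this
        rw [← this] at hvo
        exact hvo hvx
      have hc : 4 * (wins M W v).card < n := by
        have := ((memY x).1 hxY).2.2
        clear * - this hvx
        tauto
      have hb := ((memX _).1 hmem.1)
      have hlt : (common M W v (m5.arr 7 x)).card < j := by
        have := hb.2.2
        clear * - this hvo
        tauto
      have hall : HallCondition M n W v j := by
        refine hgood.resolve_left fun hs => ?_
        have := hs _ hb.1 hb.2.1.1 hvo
        omega
      have hyX : y ∈ X := (memX y).2 ⟨hy, ⟨hyv, hya⟩, Or.inl ⟨hvy, hc⟩⟩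
      obtain ⟨z, hz, hzy⟩ := auc5.matched y hyX (sat hall y hyX)
      have := (s6d z hz (by rw [hzy]; exact (hW y hy).ne) (by rwa [hzy])).2
      rwa [hzy] at this
    · by_cases hxX : x ∈ X
      · by_cases hex : ∃ y ∈ Y, m5.arr 7 y = x
        · obtain ⟨z, hz, hzx⟩ := hex
          have := (s6e z hz (by rw [hzx]; exact (hW x hx).ne) (by rwa [hzx])).2
          rw [hzx, hfx] at this
          exact absurd (this ▸ hz) hxY
        · push Not at hex
          rw [s6c x hxX hex] at hfx
          exact absurd hfx (hW x hx).ne'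
      · rw [s6a x hxX hxY, (f3 x (hW x hx)).2 ⟨hx, hxv, hxa⟩] at hfx
        exact absurd hfx (hW x hx).ne'
  -- players who beat `v` and are not beaten by enough players have lost
  have gamma : ∀ x ∈ W, x ≠ v → M v x = 0 → (common M W v x).card < j →
      m6.arr 3 x ≠ n ∧ m6.arr 3 x ≠ x := by
    intro x hx hxv hvx hlt
    have hxa : x ≠ a := by rintro rfl; exact hva hvx
    have hall : HallCondition M n W v j := by
      refine hgood.resolve_left fun hs => ?_
      have := hs _ hx hxv hvx
      omega
    have hxX : x ∈ X := (memX x).2 ⟨hx, ⟨hxv, hxa⟩, Or.inr ⟨hvx, hlt⟩⟩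
    obtain ⟨z, hz, rfl⟩ := auc5.matched x hxX (sat hall x hxX)
    have := (s6e z hz (hW _ hx).ne hvx).2
    rw [this]
    exact ⟨(hYn z hz).ne, fun e => Finset.disjoint_left.1 hXYd hxX (e ▸ hz)⟩
  -- greedy matches between players that `v` beats and players who beat `v`
  have e60 : m6.var 0 = n := (v6 0 (by simp)).trans hn.symm
  have e61 : m6.var 1 = v := (v6 1 (by simp)).trans hvdef.symm
  have s7 := playGreedy_spec (M := M) m6 winAgainstLoss
    (E := fun x y => M v x ≠ 0 ∧ M v y = 0) (W := W)
    (by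
      intro m' h
      rw [winAgainstLoss, Expr.add_eval_eq_zero, Expr.isZero_eval_eq_zero]
      simp only [Expr.eval, h, e61])
    (by rwa [e60]) (by rwa [e60])
    (by
      intro x hx hxW
      rw [e60] at hx ⊢
      rw [s6a x (hnXY x (Or.inr (Or.inr hxW))).1 (hnXY x (Or.inr (Or.inr hxW))).2, Ne, f3 x hx]
      exact fun h => hxW h.1)
    (by rwa [e60])
  have a7 : ∀ b, b ≠ 3 → ((playGreedy winAgainstLoss).run M m6).arr b = m6.arr b := fun b h =>
    run_arr_of_notMem (by simp [playGreedy, stored, whenZero, h]) m6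
  have v7 : ∀ y, y ∉ [4, 5, 7, 8, 9, 10, 11, 12] →
      ((playGreedy winAgainstLoss).run M m6).var y = m.var y := fun y h => by
    have h' := h
    simp at h
    rw [run_var_of_notMem (by simp [playGreedy, assigned, whenZero, h]) m6]
    exact v6 y h'
  generalize (playGreedy winAgainstLoss).run M m6 = m7 at s7 a7 v7 hmf
  rw [e60] at s7
  obtain ⟨mat7, s7a, s7b, s7c⟩ := s7
  -- greedy matches between all others
  have e70 : m7.var 0 = n := (v7 0 (by simp)).trans hn.symm
  have s8 := playGreedy_spec (M := M) m7 (.const 0) (E := fun _ _ => True) (W := W)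
    (by simp [Expr.eval]) (by rwa [e70]) (by rwa [e70])
    (by
      intro x hx hxW
      rw [e70] at hx ⊢
      have : m6.arr 3 x ≠ n := by
        rw [s6a x (hnXY x (Or.inr (Or.inr hxW))).1 (hnXY x (Or.inr (Or.inr hxW))).2, Ne, f3 x hx]
        exact fun h => hxW h.1
      rwa [s7a x this])
    (by rwa [e70])
  have a8 : ∀ b, b ≠ 3 → ((playGreedy (.const 0)).run M m7).arr b = m7.arr b := fun b h =>
    run_arr_of_notMem (by simp [playGreedy, stored, whenZero, h]) m7
  have v8 : ∀ y, y ∉ [4, 5, 7, 8, 9, 10, 11, 12] →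
      ((playGreedy (.const 0)).run M m7).var y = m.var y := fun y h => by
    have h' := h
    simp at h
    rw [run_var_of_notMem (by simp [playGreedy, assigned, whenZero, h]) m7]
    exact v7 y h'
  generalize (playGreedy (.const 0)).run M m7 = m8 at s8 a8 v8 hmf
  rw [e70] at s8
  obtain ⟨mat8, s8a, -, s8c⟩ := s8
  have f8v : m8.arr 3 v = v := by
    have h6 : m6.arr 3 v ≠ n := by rw [f6v]; exact hvn.ne
    rw [s8a v (by rwa [s7a v h6]), s7a v h6, f6v]
  have all8 : ∀ x ∈ W, m8.arr 3 x ≠ n := by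
    -- at most one player could be left over, and the number of players is even
    have h1 : {x ∈ W | m8.arr 3 x = n}.card ≤ 1 := by
      rw [Finset.card_le_one]
      intro x hx y hy
      obtain ⟨hxW, hxn⟩ := Finset.mem_filter.1 hx
      obtain ⟨hyW, hyn⟩ := Finset.mem_filter.1 hy
      by_contra hxy
      by_cases hb : M x y = 0
      · have := s8c y hyW x hxW ((hM.swap y (hW y hyW) x (hW x hxW) (Ne.symm hxy)).1 hb) trivial
        clear * - this hxn hyn
        tauto
      · have := s8c x hxW y hyW hb trivial
        clear * - this hxn hyn
        tauto
    have h2 := mat8.card hW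
    have h3 : {x ∈ W | m8.arr 3 x = n}.card = 0 := by
      rcases heven with ⟨r, hr⟩
      omega
    intro x hx hxn
    rw [Finset.card_eq_zero] at h3
    have : x ∈ {x ∈ W | m8.arr 3 x = n} := Finset.mem_filter.2 ⟨hx, hxn⟩
    rw [h3] at this
    simp at this
  -- `merge` and the end of the round
  have s9 := merge_spec (M := M) m8
  have v9 : ∀ y, y ≠ 9 → (merge.run M m8).var y = m8.var y := fun y h =>
    run_var_of_notMem (by simp [merge, assigned, h]) m8
  generalize merge.run M m8 = m9 at s9 v9 hmf
  have h81 : ∀ x, m8.arr 1 x = m.arr 1 x := fun x => by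
    rw [a8 1 (by simp), a7 1 (by simp), a6 1 (by simp), a5 1 (by simp), a4 1 (by simp),
      a3 1 (by simp), a1 1 (by simp)]
  have h82 : ∀ x, m8.arr 2 x = m.arr 2 x := fun x => by
    rw [a8 2 (by simp), a7 2 (by simp), a6 2 (by simp), a5 2 (by simp), a4 2 (by simp),
      a3 2 (by simp), a1 2 (by simp)]
  refine ⟨m8.arr 3, mat8, all8, f8v, ?_, ?_, ?_, ?_⟩
  · intro x hx
    have := s9 x (by rwa [v8 0 (by simp), ← hn])
    rw [h81, h82, v8 3 (by simp)] at this
    simpa [run, hmf] using this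
  · simp [hmf, run, Expr.eval, v9, v8 2 (by simp), hj]
  · simp [hmf, run, Expr.eval, v9, v8 3 (by simp)]
  · intro x hx hxv hvx
    obtain ⟨hxW, hfx⟩ := Finset.mem_filter.1 hx
    have hxn := hW x hxW
    -- `x` has at least `j` in-neighbours among the players that are beaten by `v`
    have hcard : j ≤ (common M W v x).card := by
      by_contra hlt
      obtain ⟨g1, g2⟩ := gamma x hxW hxv hvx (not_le.1 hlt)
      rw [s8a x (by rwa [s7a x g1]), s7a x g1] at hfx
      exact g2 hfx
    -- all of them except the opponent of `v` survive
    have hsurv : ∀ y ∈ W, M v y ≠ 0 → M y x ≠ 0 → y ≠ a → m8.arr 3 y = y := by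
      intro y hy hvy hyx hya
      have h7 : m7.arr 3 y ≠ n → m7.arr 3 y = y := by
        intro h7n
        rcases alpha y hy hvy hya with h6 | h6
        · rcases s7b y h6 h7n with ⟨h, -⟩ | ⟨-, z, -, h⟩
          · exact h
          · exact absurd h hvy
        · rw [s7a y (by rw [h6]; exact (hW y hy).ne), h6]
      suffices h7n : m7.arr 3 y ≠ n by rw [s8a y h7n, h7 h7n]
      by_cases hx7 : m7.arr 3 x = n
      · rcases s7c y hy x hxW hyx ⟨hvy, hvx⟩ with h | h
        · exact h
        · exact absurd hx7 h
      · -- `x` has won before, hence in the auction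
        have hfx7 : m7.arr 3 x = x := by rw [← s8a x hx7, hfx]
        have hx6 : m6.arr 3 x ≠ n := by
          intro h6
          rcases s7b x h6 hx7 with ⟨-, z, h, -⟩ | ⟨h, -⟩
          · exact h hvx
          · exact h hfx7
        have hfx6 : m6.arr 3 x = x := by rw [← s7a x hx6, hfx7]
        have hy6 := beta x hxW hxv hvx hfx6 y hy hvy hya
        rw [s7a y (by rw [hy6]; exact (hW y hy).ne), hy6]
        exact (hW y hy).ne
    have hsub : (common M W v x).erase a ⊆ common M {x ∈ W | m8.arr 3 x = x} v x := by
      intro y hy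
      obtain ⟨hya, hy⟩ := Finset.mem_erase.1 hy
      obtain ⟨hyW, hvy, hyx⟩ := Finset.mem_filter.1 hy
      exact Finset.mem_filter.2
        ⟨Finset.mem_filter.2 ⟨hyW, hsurv y hyW hvy hyx hya⟩, hvy, hyx⟩
    have h1 := Finset.card_le_card hsub
    have h2 := Finset.pred_card_le_card_erase (s := common M W v x) (a := a)
    omega

end Algo

/-! ### From rounds to brackets -/

lemma isTournamentMatrix_inputMatrix {n : ℕ} (T : Tournament (Fin n)) :
    IsTournamentMatrix (inputMatrix T) n where
  self x := by simp [inputMatrix, T.beats_self]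
  swap x hx y hy hxy := by
    have := T.beats_swap ⟨x, hx⟩ ⟨y, hy⟩ (by simpa using hxy)
    simp [inputMatrix, hx, hy, this]

lemma inputMatrix_ne_zero {n : ℕ} (T : Tournament (Fin n)) (x y : Fin n) :
    inputMatrix T x y ≠ 0 ↔ T.beats x y = true := by
  simp [inputMatrix]

/-- The state after `t` rounds of a tournament with `2 ^ k` players. The block of `w` consists of
the players `x` with champion `champ x = w`. The player `x` has the position `pos x` in its block,
and with these positions as a seeding the champion wins the bracket of its block. -/
structure Stage {k : ℕ} (T : Tournament (Fin (2 ^ k))) (v t : ℕ) (champ pos : ℕ → ℕ) :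
    Prop where
  champ_mem : ∀ x < 2 ^ k, champ x ∈ alive (2 ^ k) champ
  mem : v ∈ alive (2 ^ k) champ
  card : (alive (2 ^ k) champ).card = 2 ^ (k - t)
  pos_lt : ∀ x < 2 ^ k, pos x < 2 ^ t
  inj : ∀ x < 2 ^ k, ∀ y < 2 ^ k, champ x = champ y → pos x = pos y → x = y
  champion : ∀ w ∈ alive (2 ^ k) champ, ∀ s : Fin (2 ^ t) → Fin (2 ^ k),
    (∀ i, champ (s i) = w ∧ pos (s i) = i) → (T.champion t s : ℕ) = w

lemma mem_alive {n x : ℕ} {champ : ℕ → ℕ} : x ∈ alive n champ ↔ x < n ∧ champ x = x := by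
  simp [alive]

lemma Stage.zero {k : ℕ} (T : Tournament (Fin (2 ^ k))) {v : ℕ} (hv : v < 2 ^ k)
    {champ pos : ℕ → ℕ} (hc : ∀ x < 2 ^ k, champ x = x) (hp : ∀ x < 2 ^ k, pos x = 0) :
    Stage T v 0 champ pos := by
  have ha : alive (2 ^ k) champ = Finset.range (2 ^ k) := by
    ext x; rw [mem_alive]; simp; exact fun h => hc x h
  constructor
  · intro x hx; rw [ha, hc x hx]; simpa using hx
  · rw [ha]; simpa using hv
  · simp [ha]
  · intro x hx; simp [hp x hx]
  · intro x hx y hy h _; rwa [hc x hx, hc y hy] at h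
  · intro w hw s hs
    have := (hs ⟨0, by norm_num⟩).1
    rw [hc _ (s ⟨0, by norm_num⟩).isLt] at this
    exact this

/-- The matches `f` of one round join the blocks in pairs. -/
lemma Stage.succ {k : ℕ} {T : Tournament (Fin (2 ^ k))} {v t : ℕ} {champ pos champ' pos' : ℕ → ℕ}
    (h : Stage T v t champ pos) (ht : t < k) {f : ℕ → ℕ}
    (hf : Matching (inputMatrix T) (2 ^ k) (alive (2 ^ k) champ) f)
    (hall : ∀ x ∈ alive (2 ^ k) champ, f x ≠ 2 ^ k) (hfv : f v = v)
    (hc : ∀ x < 2 ^ k, champ' x = f (champ x))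
    (hp : ∀ x < 2 ^ k, pos' x = pos x + if f (champ x) = champ x then 0 else 2 ^ t) :
    alive (2 ^ k) champ' = {x ∈ alive (2 ^ k) champ | f x = x} ∧
      Stage T v (t + 1) champ' pos' := by
  have hW : ∀ x ∈ alive (2 ^ k) champ, x < 2 ^ k := fun x hx => (mem_alive.1 hx).1
  have hmem : ∀ x ∈ alive (2 ^ k) champ, f x ∈ alive (2 ^ k) champ ∧ f (f x) = f x :=
    fun x hx => (hf.mem x hx).resolve_left (hall x hx)
  have ha : alive (2 ^ k) champ' = {x ∈ alive (2 ^ k) champ | f x = x} := by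
    ext x
    rw [Finset.mem_filter, mem_alive]
    constructor
    · rintro ⟨hx, e⟩
      rw [hc x hx] at e
      have h1 := hmem _ (h.champ_mem x hx)
      rw [e] at h1
      exact h1
    · rintro ⟨hx, e⟩
      obtain ⟨h1, h2⟩ := mem_alive.1 hx
      exact ⟨h1, by rw [hc x h1, h2, e]⟩
  refine ⟨ha, ?_⟩
  constructor
  · intro x hx
    rw [ha, hc x hx]
    exact Finset.mem_filter.2 (hmem _ (h.champ_mem x hx))
  · rw [ha]; exact Finset.mem_filter.2 ⟨h.mem, hfv⟩
  · have h1 := hf.card hW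
    have h2 : {x ∈ alive (2 ^ k) champ | f x = 2 ^ k}.card = 0 := by
      rw [Finset.card_eq_zero, Finset.filter_eq_empty_iff]
      exact hall
    have h3 : 2 ^ (k - t) = 2 * 2 ^ (k - (t + 1)) := by
      rw [← pow_succ']; congr 1; omega
    rw [h2, h.card, h3] at h1
    rw [ha]; omega
  · intro x hx
    have := h.pos_lt x hx
    rw [hp x hx, pow_succ]
    split_ifs <;> omega
  · intro x hx y hy e1 e2
    rw [hc x hx, hc y hy] at e1
    rw [hp x hx, hp y hy] at e2
    have hpx := h.pos_lt x hx
    have hpy := h.pos_lt y hy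
    by_cases hx' : f (champ x) = champ x <;> by_cases hy' : f (champ y) = champ y
    · rw [hx', hy'] at e1
      rw [if_pos hx', if_pos hy'] at e2
      exact h.inj x hx y hy e1 e2
    · rw [if_pos hx', if_neg hy'] at e2; omega
    · rw [if_neg hx', if_pos hy'] at e2; omega
    · rw [if_neg hx', if_neg hy'] at e2
      exact h.inj x hx y hy (hf.inj _ (h.champ_mem x hx) _ (h.champ_mem y hy)
        (hall _ (h.champ_mem x hx)) hx' hy' e1) (by omega)
  · intro w hw s hs
    rw [ha] at hw
    obtain ⟨hwW, hfw⟩ := Finset.mem_filter.1 hw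
    have hs1 : ∀ i, f (champ (s i)) = w := fun i => by rw [← (hs i).1, hc _ (s i).isLt]
    have hs2 : ∀ i : Fin (2 ^ (t + 1)), pos (s i) +
        (if f (champ (s i)) = champ (s i) then 0 else 2 ^ t) = i := fun i => by
      rw [← (hs i).2, hp _ (s i).isLt]
    have hlt : ∀ i, pos (s i) < 2 ^ t := fun i => h.pos_lt _ (s i).isLt
    obtain ⟨l, hlW, hlw, hfl⟩ := hf.loser w hwW hfw
    rw [Tournament.champion]
    -- the first half of the bracket is the block of `w`
    have h1 : (T.champion t fun i => s ⟨i, by have := i.isLt; rw [pow_succ]; omega⟩ : ℕ) = w := by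
      refine h.champion w hwW _ fun i => ?_
      have e := hs2 ⟨i, by have := i.isLt; rw [pow_succ]; omega⟩
      have e' := hs1 ⟨i, by have := i.isLt; rw [pow_succ]; omega⟩
      have hi := i.isLt
      by_cases hx : f (champ (s ⟨i, by rw [pow_succ]; omega⟩)) =
          champ (s ⟨i, by rw [pow_succ]; omega⟩)
      · rw [if_pos hx] at e
        exact ⟨hx.symm.trans e', by simpa using e⟩
      · rw [if_neg hx] at e
        simp only at e
        omega
    -- the second half of the bracket is the block of the player who loses to `w`
    have h2 : (T.champion t fun i => s ⟨2 ^ t + i, by have := i.isLt; rw [pow_succ]; omega⟩ : ℕ)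
        = l := by
      refine h.champion l hlW _ fun i => ?_
      have e := hs2 ⟨2 ^ t + i, by have := i.isLt; rw [pow_succ]; omega⟩
      have e' := hs1 ⟨2 ^ t + i, by have := i.isLt; rw [pow_succ]; omega⟩
      have hlt' := hlt ⟨2 ^ t + i, by have := i.isLt; rw [pow_succ]; omega⟩
      have hi := i.isLt
      by_cases hx : f (champ (s ⟨2 ^ t + i, by rw [pow_succ]; omega⟩)) =
          champ (s ⟨2 ^ t + i, by rw [pow_succ]; omega⟩)
      · rw [if_pos hx] at e
        simp only at e
        omega
      · rw [if_neg hx] at e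
        simp only at e
        refine ⟨hf.inj _ (h.champ_mem _ (s _).isLt) _ hlW (hall _ (h.champ_mem _ (s _).isLt)) hx
          (by rw [hfl]; exact hlw.symm) (e'.trans hfl.symm), by omega⟩
    have hb := hf.beats l hlW (hall l hlW) (by rw [hfl]; exact hlw.symm)
    rw [hfl] at hb
    generalize T.champion t (fun i => s ⟨i, by have := i.isLt; rw [pow_succ]; omega⟩) = cw at h1
    generalize T.champion t (fun i => s ⟨2 ^ t + i, by have := i.isLt; rw [pow_succ]; omega⟩) = cl
      at h2
    rw [← h1, ← h2, inputMatrix_ne_zero] at hb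
    rw [Tournament.matchWinner, if_pos hb, h1]

/-! ### Correctness and running time of the algorithm -/

namespace Algo

open Cmd

variable {M : ℕ → ℕ → ℕ}

lemma initPlayers_spec (m : Memory) : ∀ x < m.var 0, (initPlayers.run M m).arr 1 x = x := by
  refine rep_induction (M := M) (m := m) (x := 9) (c := .store 1 (.var 9) (.var 9))
    (fun i m' => ∀ x < i, m'.arr 1 x = x) (by simp) ?_
  intro i hi m' hx hv ha ih x hxi
  rcases Nat.lt_succ_iff_lt_or_eq.1 hxi with h | rfl
  · simpa [run, Expr.eval, hx, h.ne] using ih x h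
  · simp [run, Expr.eval, hx]

lemma countRounds_spec (m : Memory) {k : ℕ} (hk : m.var 0 = 2 ^ k) (h2 : m.var 2 = 0) :
    (countRounds.run M m).var 2 = k ∧ (countRounds.run M m).var 3 = 1 := by
  rw [countRounds]
  simp only [Cmd.run.eq_4, Cmd.run.eq_2, Expr.eval]
  simp only [Memory.setVar_var]
  refine ⟨?_, by simp⟩
  have key := rep_induction (M := M) (x := 9) (m := m.setVar 3 1)
    (c := whenZero (.ge (.var 3) (.var 0))
        (.seq (.assign 3 (.add (.var 3) (.var 3))) (.assign 2 (.add (.var 2) (.const 1)))))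
    (fun i m' => m'.var 2 = min i k ∧ m'.var 3 = 2 ^ min i k) (by simp [h2]) ?_
  · have hlt : k < m.var 0 := hk ▸ Nat.lt_two_pow_self
    simpa [hlt.le] using key.1
  · intro i hi m' hx hv ha ih
    have h0 : m'.var 0 = m.var 0 := by
      have := hv 0 (by simp [assigned, whenZero]) (by simp)
      simpa using this
    simp only [run_whenZero, Expr.ge_eval_eq_zero]
    simp only [Expr.eval, h0, hk, ih.2]
    by_cases hik : i < k
    · rw [if_pos (by rw [min_eq_left hik.le]; exact Nat.pow_lt_pow_right (by norm_num) hik)]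
      simp only [run, Expr.eval, Memory.setVar_var]
      rw [min_eq_left (by omega : i + 1 ≤ k), ih.1, ih.2, min_eq_left hik.le, pow_succ]
      refine ⟨by simp, by simp; omega⟩
    · rw [min_eq_right (by omega), if_neg (lt_irrefl _), min_eq_right (by omega)]
      rw [min_eq_right (by omega)] at ih
      simpa using ih

lemma round_assigned {y : ℕ} (h : y ∉ [2, 3, 4, 5, 7, 8, 9, 10, 11, 12]) :
    y ∉ round.assigned := by
  simp at h
  simp [round, clear, findOpponent, playOpponent, chooseSides, countCommon, auction,
    sweep_assigned, playAuction, playGreedy, merge, whenZero, assigned, h]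

/-- If `v` wins some match, and is a superking or Hall's condition holds at the beginning, then the
algorithm finds a winning seeding for `v`. -/
theorem main_outputs {k : ℕ} (T : Tournament (Fin (2 ^ k))) (v : Fin (2 ^ k))
    (hne : (wins (inputMatrix T) (Finset.range (2 ^ k)) v).Nonempty)
    (hgood : IsSuperking (inputMatrix T) (Finset.range (2 ^ k)) v k ∨
      HallCondition (inputMatrix T) (2 ^ k) (Finset.range (2 ^ k)) v k) :
    ∃ s : Equiv.Perm (Fin (2 ^ k)), main.toProgram.Outputs T v s ∧ IsWinningSeeding T v s := by
  obtain ⟨t, -, he⟩ := exec (M := inputMatrix T) main_wf (initialMemory v)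
  obtain ⟨mf, hmf⟩ : ∃ mf, mf = main.run (inputMatrix T) (initialMemory v) := ⟨_, rfl⟩
  rw [← hmf] at he
  suffices h : ∃ s : Equiv.Perm (Fin (2 ^ k)),
      (∀ i : Fin (2 ^ k), mf.arr 0 i = s i) ∧ IsWinningSeeding T v s by
    obtain ⟨s, h1, h2⟩ := h
    exact ⟨s, ⟨t, mf, he, h1⟩, h2⟩
  clear he
  generalize hMdef : inputMatrix T = M at *
  have hM : IsTournamentMatrix M (2 ^ k) := hMdef ▸ isTournamentMatrix_inputMatrix T
  rw [main] at hmf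
  simp only [Cmd.run.eq_4] at hmf
  -- the memory after `initPlayers`
  have s1 := initPlayers_spec (M := M) (initialMemory v)
  have a1 : ∀ a, a ≠ 1 → (initPlayers.run M (initialMemory v)).arr a = (initialMemory v).arr a :=
    fun a h => run_arr_of_notMem (by simp [initPlayers, stored, h]) _
  have v1 : ∀ y, y ≠ 9 → (initPlayers.run M (initialMemory v)).var y = (initialMemory v).var y :=
    fun y h => run_var_of_notMem (by simp [initPlayers, assigned, h]) _
  generalize initPlayers.run M (initialMemory v) = m1 at s1 a1 v1 hmf
  have e10 : m1.var 0 = 2 ^ k := by rw [v1 0 (by simp)]; simp [initialMemory]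
  have e11 : m1.var 1 = v := by rw [v1 1 (by simp)]; simp [initialMemory]
  have e12 : m1.var 2 = 0 := by rw [v1 2 (by simp)]; simp [initialMemory]
  -- the memory after `countRounds`
  have s2 := countRounds_spec (M := M) m1 e10 e12
  have a2 : ∀ a, (countRounds.run M m1).arr a = m1.arr a := fun a =>
    run_arr_of_notMem (by simp [countRounds, stored, whenZero]) _
  have v2 : ∀ y, y ∉ [2, 3, 9] → (countRounds.run M m1).var y = m1.var y := fun y h =>
    run_var_of_notMem (by simp at h; simp [countRounds, assigned, whenZero, h]) _
  generalize countRounds.run M m1 = m2 at s2 a2 v2 hmf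
  have e20 : m2.var 0 = 2 ^ k := by rw [v2 0 (by simp), e10]
  have e21 : m2.var 1 = v := by rw [v2 1 (by simp), e11]
  have c2 : ∀ x < 2 ^ k, m2.arr 1 x = x := fun x hx => by
    rw [a2, s1 x (by simpa [initialMemory] using hx)]
  have p2 : ∀ x < 2 ^ k, m2.arr 2 x = 0 := fun x hx => by
    rw [a2, a1 2 (by simp)]; rfl
  -- the rounds
  let P : ℕ → Memory → Prop := fun t m' => m'.var 2 = k - t ∧ m'.var 3 = 2 ^ t ∧
    Stage T v t (m'.arr 1) (m'.arr 2) ∧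
    (t < k → (wins M (alive (2 ^ k) (m'.arr 1)) v).Nonempty ∧
      (IsSuperking M (alive (2 ^ k) (m'.arr 1)) v (k - t) ∨
        HallCondition M (2 ^ k) (alive (2 ^ k) (m'.arr 1)) v (k - t)))
  have hP : P k ((Cmd.rep 6 (.ite (.var 2) round .skip)).run M m2) := by
    have hkk : min (m2.var 0) k = k := min_eq_right (e20 ▸ Nat.lt_two_pow_self.le)
    rw [← hkk]
    refine rep_induction (M := M) (x := 6) (m := m2) (fun i m' => P (min i k) m') ?_ ?_
    · have ha : alive (2 ^ k) (m2.arr 1) = Finset.range (2 ^ k) := by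
        ext x; rw [mem_alive]; simp; exact fun h => c2 x h
      simp only [P, Nat.zero_min, Memory.setVar_arr, ha, Nat.sub_zero]
      refine ⟨by simpa using s2.1, by simpa using s2.2, Stage.zero T v.isLt c2 p2,
        fun _ => ⟨hne, hgood⟩⟩
    · intro i hi m' hx hv ha ih
      have h0 : m'.var 0 = 2 ^ k := by
        rw [hv 0 (by simp [assigned, round_assigned]) (by simp), e20]
      have h1 : m'.var 1 = v := by
        rw [hv 1 (by simp [assigned, round_assigned]) (by simp), e21]
      by_cases hik : i < k
      · rw [min_eq_left hik.le] at ih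
        rw [min_eq_left (by omega : i + 1 ≤ k)]
        obtain ⟨i1, i2, i3, i4⟩ := ih
        obtain ⟨i4, i5⟩ := i4 hik
        have hne0 : (Expr.var 2).eval M m' ≠ 0 := by simp only [Expr.eval, i1]; omega
        simp only [Cmd.run.eq_5]
        rw [if_pos hne0]
        obtain ⟨f, r1, r2, r3, r4, r5, r6, r7⟩ := round_spec (M := M) m'
          (W := alive (2 ^ k) (m'.arr 1)) (by rw [h0]) (by rwa [h0]) (by rw [h1]; exact i3.mem)
          (by rw [i3.card]; exact (Nat.even_pow' (by omega)).2 even_two)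
          (by rwa [h1]) (by rwa [h0, h1, i1])
        rw [h0] at r1 r2 r4
        rw [h1] at r3 r7
        rw [i1] at r5 r7
        rw [i2] at r4 r6
        generalize round.run M m' = mr at r4 r5 r6
        obtain ⟨t1, t2⟩ := i3.succ hik (by rwa [hMdef]) r2 r3 (fun x hx => (r4 x hx).1)
          (fun x hx => (r4 x hx).2)
        have r7' : IsSuperking M (alive (2 ^ k) (mr.arr 1)) v (k - (i + 1)) := by
          rw [t1, ← Nat.sub_sub]; exact r7
        refine ⟨by simp [r5, Nat.sub_sub], by simp [r6, pow_succ]; omega, t2,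
          fun hik' => ⟨?_, Or.inl r7'⟩⟩
        -- a superking beats some player
        simp only [Memory.setVar_arr]
        have hc : 1 < (alive (2 ^ k) (mr.arr 1)).card := by
          rw [t2.card]; exact Nat.one_lt_two_pow (by omega)
        obtain ⟨x, hxW, hxv⟩ := Finset.exists_mem_ne hc v
        by_cases hb : M v x = 0
        · have := r7' x hxW hxv hb
          obtain ⟨y, hy⟩ := Finset.card_pos.1 ((Nat.sub_pos_of_lt hik').trans_le this)
          obtain ⟨hy1, hy2, -⟩ := Finset.mem_filter.1 hy
          exact ⟨y, Finset.mem_filter.2 ⟨hy1, hy2⟩⟩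
        · exact ⟨x, Finset.mem_filter.2 ⟨hxW, hb⟩⟩
      · rw [min_eq_right (by omega)] at ih ⊢
        have hz : (Expr.var 2).eval M m' = 0 := by simp only [Expr.eval, ih.1]; omega
        simp only [Cmd.run.eq_5]
        rw [if_neg (by simpa using hz)]
        simpa [P, run] using ih
  have v3 : ∀ y, y = 0 ∨ y = 1 → ((Cmd.rep 6 (.ite (.var 2) round .skip)).run M m2).var y =
      m2.var y := by
    rintro y (rfl | rfl) <;>
    exact run_var_of_notMem (by simp [assigned, round_assigned]) _
  generalize (Cmd.rep 6 (.ite (.var 2) round .skip)).run M m2 = m3 at hP v3 hmf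
  have e30 : m3.var 0 = 2 ^ k := by rw [v3 0 (Or.inl rfl), e20]
  obtain ⟨-, -, st, -⟩ := hP
  -- only `v` is left
  have hc3 : ∀ x < 2 ^ k, m3.arr 1 x = v := by
    intro x hx
    have h1 := st.card
    rw [Nat.sub_self, pow_zero] at h1
    exact Finset.card_le_one.1 h1.le _ (st.champ_mem x hx) _ st.mem
  have hinj : ∀ x < 2 ^ k, ∀ y < 2 ^ k, m3.arr 2 x = m3.arr 2 y → x = y := fun x hx y hy e =>
    st.inj x hx y hy (by rw [hc3 x hx, hc3 y hy]) e
  -- the memory after `output`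
  have hout : ∀ x < 2 ^ k, mf.arr 0 (m3.arr 2 x) = x := by
    rw [hmf, output, ← e30]
    refine rep_induction (M := M) (x := 9) (m := m3) (c := .store 0 (.arr 2 (.var 9)) (.var 9))
      (fun i m' => ∀ x < i, m'.arr 0 (m3.arr 2 x) = x) (by simp) ?_
    intro i hi m' hx hv ha ih x hxi
    have ha2 : m'.arr 2 = m3.arr 2 := ha 2 (by simp [stored])
    rw [e30] at hi
    rcases Nat.lt_succ_iff_lt_or_eq.1 hxi with h | rfl
    · have hne : m3.arr 2 x ≠ m3.arr 2 i := fun e => h.ne (hinj x (by omega) i hi e)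
      simpa [run, Expr.eval, hx, ha2, hne] using ih x h
    · simp [run, Expr.eval, hx, ha2]
  have hbij : Function.Bijective fun x : Fin (2 ^ k) =>
      (⟨m3.arr 2 x, st.pos_lt x x.isLt⟩ : Fin (2 ^ k)) := by
    rw [Finite.injective_iff_bijective.symm]
    intro x y e
    exact Fin.ext (hinj x x.isLt y y.isLt (by simpa using e))
  let e := Equiv.ofBijective _ hbij
  have hes : ∀ i, m3.arr 2 (e.symm i) = i := fun i =>
    congrArg Fin.val (e.apply_symm_apply i)
  refine ⟨e.symm, fun i => ?_, ?_⟩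
  · have := hout (e.symm i) (e.symm i).isLt
    rwa [hes] at this
  · exact Fin.ext (st.champion v st.mem _ fun i => ⟨hc3 _ (e.symm i).isLt, hes i⟩)

lemma main_isPolyTime : main.toProgram.IsPolyTime := by
  refine ⟨main.time, fun k T v => ?_⟩
  obtain ⟨t, ht, he⟩ := exec (M := inputMatrix T) main_wf (initialMemory v)
  exact ⟨t, by simpa [initialMemory] using ht, _, he⟩

end Algo

/-! ### Expansion implies Hall's condition -/

section Expansion

variable {n : ℕ}

/-- The players that are beaten by `v`. -/
def outSet (T : Tournament (Fin n)) (v : Fin n) : Finset (Fin n) := {x | T.beats v x = true}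

/-- A set that contains all possible bidders, if `A` is the set of players that are beaten by `v`,
and `Q` contains all players that beat `v` and are not beaten by enough players of `A`. -/
def bidderPool (Q A : Finset (Fin n)) (v : Fin n) : Finset (Fin n) :=
  if 4 * A.card < n then A ∪ Q.erase v else Q.erase v \ A

/-- A set of players that are all objects of the auction, except possibly the opponent of `v`. -/
def objectPool (Q A : Finset (Fin n)) (v : Fin n) : Finset (Fin n) :=
  if 4 * A.card < n then (Finset.univ.erase v \ A) \ Q else A

/-- Every player outside `Q` is beaten by at least `j` players that are beaten by `v`. -/
def IsDominated (T : Tournament (Fin n)) (Q : Finset (Fin n)) (v : Fin n) (j : ℕ) : Prop :=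
  ∀ u ∉ Q, u ≠ v →
    j ≤ {a ∈ (Finset.univ : Finset (Fin n)) | T.beats v a = true ∧ T.beats a u = true}.card

/-- Every nonempty set of possible bidders has more neighbours than elements. -/
def IsExpanding (T : Tournament (Fin n)) (Q : Finset (Fin n)) (v : Fin n) : Prop :=
  ∀ X ⊆ bidderPool Q (outSet T v) v, X.Nonempty →
    X.card < {z ∈ objectPool Q (outSet T v) v | ∃ x ∈ X, T.beats v x = T.beats x z}.card

lemma card_filter_range (p : ℕ → Prop) [DecidablePred p] :
    {y ∈ Finset.range n | p y}.card = (Finset.univ.filter fun y : Fin n => p y).card := by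
  rw [← Finset.card_map Fin.valEmbedding]
  congr 1
  ext y
  simp only [Finset.mem_filter, Finset.mem_range, Finset.mem_map, Finset.mem_univ, true_and,
    Fin.valEmbedding_apply]
  constructor
  · rintro ⟨h1, h2⟩; exact ⟨⟨y, h1⟩, h2, rfl⟩
  · rintro ⟨z, h, rfl⟩; exact ⟨z.isLt, h⟩

lemma card_wins (T : Tournament (Fin n)) (v : Fin n) :
    (wins (inputMatrix T) (Finset.range n) v).card = (outSet T v).card := by
  rw [wins, card_filter_range, outSet]
  congr 1
  ext x
  simp [inputMatrix]

lemma card_common (T : Tournament (Fin n)) (v u : Fin n) :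
    (common (inputMatrix T) (Finset.range n) v u).card =
      {a ∈ (Finset.univ : Finset (Fin n)) | T.beats v a = true ∧ T.beats a u = true}.card := by
  rw [common, card_filter_range]
  congr 1
  ext x
  simp [inputMatrix]

lemma IsDominated.wins_nonempty {T : Tournament (Fin n)} {Q : Finset (Fin n)} {v : Fin n} {j : ℕ}
    (h : IsDominated T Q v j) (hj : 0 < j) (hQ : Q.card + 1 < n) :
    (wins (inputMatrix T) (Finset.range n) v).Nonempty := by
  rw [← Finset.card_pos, card_wins]
  obtain ⟨u, hu⟩ : ∃ u, u ∉ insert v Q := by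
    by_contra! hcon
    have := Finset.card_le_card (fun u _ => hcon u : (Finset.univ : Finset (Fin n)) ⊆ insert v Q)
    have h2 := Finset.card_insert_le v Q
    simp at this
    omega
  simp only [Finset.mem_insert, not_or] at hu
  refine (hj.trans_le (h u hu.2 hu.1)).trans_le (Finset.card_le_card fun a ha => ?_)
  simp [outSet] at ha ⊢
  exact ha.1

/-- The opponent of `v` is not available in the auction, but expansion gives one neighbour more than
Hall's condition asks for. -/
lemma IsExpanding.hallCondition {T : Tournament (Fin n)} {Q : Finset (Fin n)} {v : Fin n} {j : ℕ}
    (h : IsExpanding T Q v) (hd : IsDominated T Q v j) :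
    HallCondition (inputMatrix T) n (Finset.range n) v j := by
  intro a ha hva X hX
  rcases X.eq_empty_or_nonempty with rfl | hne
  · simp
  rw [Finset.mem_range] at ha
  set M := inputMatrix T with hMdef
  have hM : ∀ x y : Fin n, M x y = (T.beats x y).toNat := fun x y => by simp [hMdef, inputMatrix]
  have hM0 : ∀ x y : Fin n, M x y ≠ 0 ↔ T.beats x y = true := fun x y => by simp [hM]
  have hXn : ∀ x ∈ X, x < n := fun x hx =>
    Finset.mem_range.1 (Finset.mem_filter.1 (hX hx)).1
  let X' : Finset (Fin n) := {x | (x : ℕ) ∈ X}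
  have memX' : ∀ x : Fin n, x ∈ X' ↔ (x : ℕ) ∈ X := fun x => by simp [X']
  have hcard : X.card = X'.card := by
    rw [← card_filter_range (fun x => x ∈ X)]
    congr 1
    ext x
    simp only [Finset.mem_filter, Finset.mem_range]
    exact ⟨fun h => ⟨hXn x h, h⟩, fun h => h.2⟩
  have hmemA : ∀ x : Fin n, x ∈ outSet T v ↔ M v x ≠ 0 := fun x => by simp [outSet, hM]
  have hsub : X' ⊆ bidderPool Q (outSet T v) v := by
    intro x hx
    obtain ⟨-, ⟨hxv, -⟩, hx⟩ := Finset.mem_filter.1 (hX ((memX' x).1 hx))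
    rw [hMdef, card_wins, ← hMdef, card_common] at hx
    have hxv' : x ≠ v := fun e => hxv (congrArg Fin.val e)
    rcases hx with ⟨h1, h2⟩ | ⟨h1, h2⟩
    · rw [bidderPool, if_pos h2]
      exact Finset.mem_union_left _ ((hmemA x).2 h1)
    · have hxQ : x ∈ Q := by
        by_contra hxQ
        have := hd x hxQ hxv'
        omega
      have hxA : x ∉ outSet T v := fun h => (hmemA x).1 h h1
      rw [bidderPool]
      split_ifs <;> simp [hxQ, hxv', hxA]
  have hexp := h X' hsub (by rw [← Finset.card_pos, ← hcard]; exact hne.card_pos)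
  rw [hcard]
  set N := {z ∈ objectPool Q (outSet T v) v | ∃ x ∈ X', T.beats v x = T.beats x z} with hN
  have hmap : (N.erase ⟨a, ha⟩).map Fin.valEmbedding ⊆
      {y ∈ objects M n (Finset.range n) v j a | ∃ x ∈ X, M v x = M x y} := by
    intro z hz
    obtain ⟨z, hz', rfl⟩ := Finset.mem_map.1 hz
    obtain ⟨hza, hz⟩ := Finset.mem_erase.1 hz'
    obtain ⟨hzo, x, hx, hxz⟩ := Finset.mem_filter.1 hz
    refine Finset.mem_filter.2 ⟨Finset.mem_filter.2 ⟨by simp, ⟨?_, ?_⟩, ?_⟩, x, (memX' x).1 hx, ?_⟩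
    · intro e
      have e' : z = v := Fin.ext e
      subst e'
      rw [objectPool] at hzo
      split_ifs at hzo with hc
      · simp at hzo
      · simp [outSet, T.beats_self] at hzo
    · intro e; exact hza (Fin.ext e)
    · simp only [Fin.valEmbedding_apply]
      rw [hMdef, card_wins, card_common, ← hMdef]
      rw [objectPool] at hzo
      split_ifs at hzo with hc
      · simp only [Finset.mem_sdiff, Finset.mem_erase] at hzo
        right
        refine ⟨not_not.1 (mt (hmemA z).2 hzo.1.2), not_lt.2 (hd z hzo.2 hzo.1.1.1), hc⟩
      · left
        exact ⟨(hmemA z).1 hzo, hc⟩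
    · simp only [Fin.valEmbedding_apply, hM, hxz]
  have h1 := Finset.card_le_card hmap
  rw [Finset.card_map] at h1
  have h2 := Finset.pred_card_le_card_erase (s := N) (a := ⟨a, ha⟩)
  refine le_trans ?_ (h1.trans (le_of_eq ?_))
  · omega
  · congr

end Expansion

/-! ### The number of wins of a champion -/

/-- The champion of a bracket with `k` rounds has beaten `k` different players. -/
lemma Tournament.champion_wins {V : Type*} (T : Tournament V) :
    ∀ (k : ℕ) (s : Fin (2 ^ k) → V), Function.Injective s →
      T.champion k s ∈ Set.range s ∧ ∃ S : Finset V, S.card = k ∧ (S : Set V) ⊆ Set.range s ∧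
        ∀ u ∈ S, T.beats (T.champion k s) u = true := by
  classical
  intro k
  induction k with
  | zero => exact fun s _ => ⟨⟨_, rfl⟩, ∅, by simp⟩
  | succ k ih =>
    intro s hs
    have hlt1 : ∀ i : Fin (2 ^ k), (i : ℕ) < 2 ^ (k + 1) := fun i => by
      have := i.isLt; rw [pow_succ]; omega
    have hlt2 : ∀ i : Fin (2 ^ k), 2 ^ k + (i : ℕ) < 2 ^ (k + 1) := fun i => by
      have := i.isLt; rw [pow_succ]; omega
    have key1 := ih (fun i => s ⟨i, hlt1 i⟩) (fun i j e => by simpa [Fin.ext_iff] using hs e)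
    have key2 := ih (fun i => s ⟨2 ^ k + i, hlt2 i⟩) (fun i j e => by
      simpa [Fin.ext_iff] using hs e)
    rw [Tournament.champion]
    generalize T.champion k (fun i => s ⟨i, _⟩) = c1 at key1 ⊢
    generalize T.champion k (fun i => s ⟨2 ^ k + i, _⟩) = c2 at key2 ⊢
    obtain ⟨⟨i1, hi1⟩, S1, hS1, hr1, hb1⟩ := key1
    obtain ⟨⟨i2, hi2⟩, S2, hS2, hr2, hb2⟩ := key2
    have hdisj : ∀ i j : Fin (2 ^ k), s ⟨i, hlt1 i⟩ ≠ s ⟨2 ^ k + j, hlt2 j⟩ := by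
      intro i j e
      have := i.isLt
      have := hs e
      simp [Fin.ext_iff] at this
      omega
    have hne : c1 ≠ c2 := by
      rw [← hi1, ← hi2]; exact hdisj i1 i2
    have hm1 : c1 ∈ Set.range s := ⟨_, hi1⟩
    have hm2 : c2 ∈ Set.range s := ⟨_, hi2⟩
    have hr1' : (S1 : Set V) ⊆ Set.range s := fun u hu => by
      obtain ⟨i, hi⟩ := hr1 hu; exact ⟨_, hi⟩
    have hr2' : (S2 : Set V) ⊆ Set.range s := fun u hu => by
      obtain ⟨i, hi⟩ := hr2 hu; exact ⟨_, hi⟩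
    rw [Tournament.matchWinner]
    by_cases hb : T.beats c1 c2 = true
    · rw [if_pos hb]
      refine ⟨hm1, insert c2 S1, ?_, ?_, ?_⟩
      · rw [Finset.card_insert_of_notMem, hS1]
        intro h
        obtain ⟨i, hi⟩ := hr1 h
        exact hdisj i i2 (hi.trans hi2.symm)
      · rw [Finset.coe_insert]; exact Set.insert_subset hm2 hr1'
      · intro u hu
        rcases Finset.mem_insert.1 hu with rfl | hu
        · exact hb
        · exact hb1 u hu
    · rw [if_neg hb]
      refine ⟨hm2, insert c1 S2, ?_, ?_, ?_⟩
      · rw [Finset.card_insert_of_notMem, hS2]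
        intro h
        obtain ⟨i, hi⟩ := hr2 h
        exact hdisj i1 i (hi1.trans hi.symm)
      · rw [Finset.coe_insert]; exact Set.insert_subset hm1 hr2'
      · intro u hu
        rcases Finset.mem_insert.1 hu with rfl | hu
        · rw [T.beats_swap u c2 hne]; simpa using hb
        · exact hb2 u hu

/-! ### Probabilities in the Condorcet Random Model -/

section Probability

variable {n : ℕ}

/-- The coordinate of the random experiment that decides the match between `u` and `w`. -/
def edge (σ : Equiv.Perm (Fin n)) (u w : Fin n) (h : u ≠ w) :
    {e : Fin n × Fin n // e.1 < e.2} :=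
  if h' : σ u < σ w then ⟨(σ u, σ w), h'⟩
  else ⟨(σ w, σ u), lt_of_le_of_ne (not_lt.1 h') fun e => h (σ.injective e.symm)⟩

lemma beats_iff (σ : Equiv.Perm (Fin n)) (ω : Upsets n) {u w : Fin n} (h : u ≠ w) (b : Bool) :
    (crTournament σ ω).beats u w = b ↔
      ω (edge σ u w h) = if σ u < σ w then !b else b := by
  by_cases h' : σ u < σ w
  · cases b <;> simp [crTournament, edge, h']
  · have h2 : σ w < σ u := lt_of_le_of_ne (not_lt.1 h') fun e => h (σ.injective e.symm)
    cases b <;> simp [crTournament, edge, h', h2]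

lemma edge_inj (σ : Equiv.Perm (Fin n)) {u w u' w' : Fin n} (h : u ≠ w) (h' : u' ≠ w')
    (he : edge σ u w h = edge σ u' w' h') : u = u' ∧ w = w' ∨ u = w' ∧ w = u' := by
  unfold edge at he
  split_ifs at he <;> simp at he <;> tauto

instance (n : ℕ) (p : unitInterval) : IsProbabilityMeasure (upsetMeasure n p) := by
  unfold upsetMeasure; infer_instance

/-- The probability that the match between `u` and `w` has the outcome `b`, where `b = true` means
that `u` wins. -/
noncomputable def weight (σ : Equiv.Perm (Fin n)) (p : ℝ) (u w : Fin n) (b : Bool) : ℝ :=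
  if decide (σ u < σ w) = b then 1 - p else p

/-- Different matches are independent. -/
lemma prob_outcomes (σ : Equiv.Perm (Fin n)) (p : unitInterval) (D : Finset (Fin n × Fin n))
    (hD : ∀ q ∈ D, q.1 ≠ q.2) (hD' : ∀ q ∈ D, q.swap ∉ D) (b : Fin n × Fin n → Bool) :
    (upsetMeasure n p).real {ω | ∀ q ∈ D, (crTournament σ ω).beats q.1 q.2 = b q} =
      ∏ q ∈ D, weight σ p q.1 q.2 (b q) := by
  classical
  let val : Fin n × Fin n → Bool := fun q => if σ q.1 < σ q.2 then !b q else b q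
  let S : {e : Fin n × Fin n // e.1 < e.2} → Set Bool := fun e =>
    {c | ∀ q, ∀ hq : q ∈ D, edge σ q.1 q.2 (hD q hq) = e → c = val q}
  have hset : {ω : Upsets n | ∀ q ∈ D, (crTournament σ ω).beats q.1 q.2 = b q} =
      Set.univ.pi S := by
    ext ω
    simp only [Set.mem_ofPred_eq, Set.mem_pi, Set.mem_univ, true_implies, S]
    constructor
    · rintro h e q hq rfl
      exact (beats_iff σ ω (hD q hq) _).1 (h q hq)
    · intro h q hq
      exact (beats_iff σ ω (hD q hq) _).2 (h _ q hq rfl)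
  rw [hset, upsetMeasure, measureReal_def, Measure.pi_pi, ENNReal.toReal_prod,
    ← Finset.prod_attach D]
  symm
  refine Finset.prod_of_injOn (fun q : {q // q ∈ D} => edge σ q.1.1 q.1.2 (hD q.1 q.2)) ?_ ?_ ?_ ?_
  · intro q _ q' _ he
    rcases edge_inj σ _ _ he with ⟨h1, h2⟩ | ⟨h1, h2⟩
    · exact Subtype.ext (Prod.ext h1 h2)
    · refine absurd q'.2 ?_
      have : q'.1 = q.1.swap := Prod.ext h2.symm h1.symm
      rw [this]
      exact hD' q.1 q.2
  · intro q _; simp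
  · intro e _ he
    have : S e = Set.univ := by
      ext c
      simp only [S, Set.mem_ofPred_eq, Set.mem_univ, iff_true]
      intro q hq h
      exact absurd ⟨⟨q, hq⟩, by simp, h⟩ he
    rw [this]; simp
  · intro q _
    have hS : S (edge σ q.1.1 q.1.2 (hD q.1 q.2)) = {val q.1} := by
      ext c
      simp only [S, Set.mem_ofPred_eq, Set.mem_singleton_iff]
      constructor
      · exact fun h => h q.1 q.2 rfl
      · rintro rfl q' hq' he
        rcases edge_inj σ _ _ he with ⟨h1, h2⟩ | ⟨h1, h2⟩
        · have : q' = q.1 := Prod.ext h1 h2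
          rw [this]
        · refine absurd hq' ?_
          have : q' = q.1.swap := Prod.ext h1 h2
          rw [this]
          exact hD' q.1 q.2
    rw [hS, ← measureReal_def, bernoulliMeasure_real_apply _ (measurableSet_singleton _)]
    simp only [weight, val, Set.mem_singleton_iff]
    by_cases h : σ q.1.1 < σ q.1.2 <;> cases b q.1 <;> simp [h]

variable {σ : Equiv.Perm (Fin n)} {p : ℝ}

lemma weight_nonneg (h0 : 0 ≤ p) (h1 : p ≤ 1) (u w : Fin n) (b : Bool) : 0 ≤ weight σ p u w b := by
  unfold weight; split_ifs <;> linarith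

lemma weight_le (h : p ≤ 1 / 2) (u w : Fin n) (b : Bool) : weight σ p u w b ≤ 1 - p := by
  unfold weight; split_ifs <;> linarith

lemma le_weight (h : p ≤ 1 / 2) (u w : Fin n) (b : Bool) : p ≤ weight σ p u w b := by
  unfold weight; split_ifs <;> linarith

lemma weight_add (u w : Fin n) : weight σ p u w true + weight σ p u w false = 1 := by
  unfold weight; by_cases h : σ u < σ w <;> simp [h]

/-! ### Domination -/

/-- A Chernoff bound: it is unlikely that a set `R` of players stronger than `u` contains fewer than
`j` players that are beaten by `v` and beat `u`. The exponential moment of base `1 / 4` is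
computed by summing over all outcomes of the matches between `v` or `u` and players in `R`. -/
lemma prob_few_common (σ : Equiv.Perm (Fin n)) (p : unitInterval) (hp : (p : ℝ) ≤ 1 / 2)
    {u v : Fin n} (huv : u ≠ v) (R : Finset (Fin n)) (hu : u ∉ R) (hv : v ∉ R)
    (hR : ∀ a ∈ R, σ a < σ u) (j : ℕ) :
    (upsetMeasure n p).real {ω | {a ∈ R | (crTournament σ ω).beats v a = true ∧
      (crTournament σ ω).beats a u = true}.card < j} ≤
      4 ^ j * (1 - 3 / 4 * (p * (1 - p))) ^ R.card := by
  classical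
  have hp0 : 0 ≤ (p : ℝ) := p.2.1
  have hp1 : (p : ℝ) ≤ 1 := p.2.2
  let μ := upsetMeasure n p
  have : IsProbabilityMeasure μ := inferInstanceAs (IsProbabilityMeasure (upsetMeasure n p))
  let cyl : (R → Bool × Bool) → Set (Upsets n) := fun g =>
    {ω | ∀ a : R, (crTournament σ ω).beats v a = (g a).1 ∧
      (crTournament σ ω).beats a u = (g a).2}
  let cnt : (R → Bool × Bool) → ℕ := fun g =>
    (Finset.univ.filter fun a : R => g a = (true, true)).card
  have hcyl : ∀ g, μ.real (cyl g) = ∏ a : R, (weight σ p v a (g a).1 * weight σ p a u (g a).2) := by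
    intro g
    let D1 : Finset (Fin n × Fin n) := R.image fun a => (v, a)
    let D2 : Finset (Fin n × Fin n) := R.image fun a => (a, u)
    let b : Fin n × Fin n → Bool := fun q =>
      if h : q.2 ∈ R then (g ⟨q.2, h⟩).1 else if h : q.1 ∈ R then (g ⟨q.1, h⟩).2 else false
    have hd : Disjoint D1 D2 := by
      rw [Finset.disjoint_left]
      intro q h1 h2
      obtain ⟨a, ha, rfl⟩ := Finset.mem_image.1 h1
      obtain ⟨a', ha', e⟩ := Finset.mem_image.1 h2
      simp only [Prod.mk.injEq] at e
      exact hu (e.2 ▸ ha)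
    have hmem : ∀ q, q ∈ D1 ∪ D2 ↔ (∃ a ∈ R, q = (v, a)) ∨ ∃ a ∈ R, q = (a, u) := by
      intro q; simp [D1, D2, eq_comm]
    have h := prob_outcomes σ p (D1 ∪ D2) ?_ ?_ b
    · have e1 : cyl g = {ω | ∀ q ∈ D1 ∪ D2, (crTournament σ ω).beats q.1 q.2 = b q} := by
        ext ω
        simp only [cyl, Set.mem_ofPred_eq]
        constructor
        · intro h q hq
          rcases (hmem q).1 hq with ⟨a, ha, rfl⟩ | ⟨a, ha, rfl⟩
          · simpa [b, ha] using (h ⟨a, ha⟩).1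
          · simpa [b, ha, hu] using (h ⟨a, ha⟩).2
        · intro h a
          have h1 := h (v, a) ((hmem _).2 (Or.inl ⟨a, a.2, rfl⟩))
          have h2 := h (a, u) ((hmem _).2 (Or.inr ⟨a, a.2, rfl⟩))
          simp [b] at h1
          simp [b, hu] at h2
          exact ⟨h1, h2⟩
      rw [e1]
      refine h.trans ?_
      rw [Finset.prod_union hd, Finset.prod_image (by intro a _ a' _ e; simpa using e),
        Finset.prod_image (by intro a _ a' _ e; simpa using e), ← Finset.prod_mul_distrib,
        ← Finset.prod_coe_sort]
      refine Finset.prod_congr rfl fun a _ => ?_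
      simp [b, hu]
    · intro q hq
      rcases (hmem q).1 hq with ⟨a, ha, rfl⟩ | ⟨a, ha, rfl⟩
      · exact fun e => hv ((show v = a from e) ▸ ha)
      · exact fun e => hu ((show a = u from e) ▸ ha)
    · intro q hq hq'
      rcases (hmem q).1 hq with ⟨a, ha, rfl⟩ | ⟨a, ha, rfl⟩ <;>
        rcases (hmem _).1 hq' with ⟨a', ha', e⟩ | ⟨a', ha', e⟩ <;>
        simp only [Prod.swap_prod_mk, Prod.mk.injEq] at e
      · exact hv (e.1 ▸ ha)
      · exact huv e.2.symm
      · exact huv e.1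
      · exact hu (e.1 ▸ ha')
  -- the moment
  have hmoment : ∑ g : R → Bool × Bool, μ.real (cyl g) * (1 / 4 : ℝ) ^ cnt g ≤
      (1 - 3 / 4 * (p * (1 - p))) ^ R.card := by
    have e1 : ∀ g : R → Bool × Bool, μ.real (cyl g) * (1 / 4 : ℝ) ^ cnt g =
        ∏ a : R, (weight σ p v a (g a).1 * weight σ p a u (g a).2 *
          if g a = (true, true) then 1 / 4 else 1) := by
      intro g
      rw [Finset.prod_mul_distrib, hcyl, Finset.prod_ite]
      simp [cnt]
    rw [Finset.sum_congr rfl fun g _ => e1 g]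
    have e2 := Finset.prod_univ_sum (fun _ : R => (Finset.univ : Finset (Bool × Bool)))
      (fun a c => weight σ p v a c.1 * weight σ p a u c.2 * if c = (true, true) then 1 / 4 else 1)
    rw [Fintype.piFinset_univ] at e2
    rw [← e2]
    have e3 : R.card = (Finset.univ : Finset R).card := by simp
    rw [e3, ← Finset.prod_const]
    refine Finset.prod_le_prod (fun a _ => ?_) fun a _ => ?_
    · refine Finset.sum_nonneg fun c _ => ?_
      have h1 := weight_nonneg (σ := σ) hp0 hp1 v a c.1
      have h2 := weight_nonneg (σ := σ) hp0 hp1 a u c.2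
      split_ifs <;> positivity
    · rw [Fintype.sum_prod_type]
      simp only [Fintype.sum_bool, Prod.mk.injEq, and_self, if_true, Bool.false_eq_true, and_false,
        false_and, if_false]
      have h1 := weight_add (σ := σ) (p := p) v a
      have h2 := weight_add (σ := σ) (p := p) a u
      have h3 : weight σ p a u true = 1 - p := by simp [weight, hR a a.2]
      have h4 := le_weight (σ := σ) hp v a true
      rw [h3] at h2 ⊢
      nlinarith [mul_le_mul_of_nonneg_right h4 (by linarith : (0 : ℝ) ≤ 1 - p)]
  -- the union bound, weighted by the moment
  have hsub : {ω : Upsets n | {a ∈ R | (crTournament σ ω).beats v a = true ∧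
      (crTournament σ ω).beats a u = true}.card < j} ⊆
      ⋃ g ∈ (Finset.univ.filter fun g : R → Bool × Bool => cnt g < j), cyl g := by
    intro ω hω
    simp only [Set.mem_ofPred_eq] at hω
    simp only [Set.mem_iUnion]
    refine ⟨fun a => ((crTournament σ ω).beats v a, (crTournament σ ω).beats a u), ?_, ?_⟩
    · simp only [Finset.mem_filter, Finset.mem_univ, true_and, cnt, Prod.mk.injEq]
      refine lt_of_eq_of_lt ?_ hω
      rw [← Finset.card_map (Function.Embedding.subtype _)]
      congr 1
      ext a
      simp only [Finset.mem_map, Finset.mem_filter, Finset.mem_univ, true_and,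
        Function.Embedding.subtype_apply, Subtype.exists, exists_and_left, exists_prop]
      constructor
      · rintro ⟨b, h, hb, rfl⟩; exact ⟨hb, h⟩
      · rintro ⟨h, h'⟩; exact ⟨a, h', h, rfl⟩
    · simp [cyl]
  calc μ.real _ ≤ μ.real (⋃ g ∈ (Finset.univ.filter fun g : R → Bool × Bool => cnt g < j),
        cyl g) := measureReal_mono hsub (measure_ne_top _ _)
    _ ≤ ∑ g ∈ (Finset.univ.filter fun g : R → Bool × Bool => cnt g < j), μ.real (cyl g) :=
        measureReal_biUnion_finset_le _ _
    _ ≤ ∑ g ∈ (Finset.univ.filter fun g : R → Bool × Bool => cnt g < j),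
          4 ^ j * (μ.real (cyl g) * (1 / 4 : ℝ) ^ cnt g) := by
        refine Finset.sum_le_sum fun g hg => ?_
        have hg := (Finset.mem_filter.1 hg).2
        have h1 : (1 : ℝ) ≤ 4 ^ j * (1 / 4 : ℝ) ^ cnt g := by
          rw [one_div, inv_pow, ← div_eq_mul_inv, one_le_div (by positivity)]
          exact pow_le_pow_right₀ (by norm_num) hg.le
        have h2 : 0 ≤ μ.real (cyl g) := measureReal_nonneg
        nlinarith
    _ ≤ ∑ g : R → Bool × Bool, 4 ^ j * (μ.real (cyl g) * (1 / 4 : ℝ) ^ cnt g) :=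
        Finset.sum_le_univ_sum_of_nonneg fun g => by
          have : 0 ≤ μ.real (cyl g) := measureReal_nonneg
          positivity
    _ ≤ _ := by
        rw [← Finset.mul_sum]
        exact mul_le_mul_of_nonneg_left hmoment (by positivity)

end Probability

/-! ### The probability of expansion -/

section Expansion

variable {n : ℕ}

lemma card_bidderPool_add_le (A : Finset (Fin n)) (v : Fin n) {Q : Finset (Fin n)} {d : ℕ}
    (hQ : 32 * Q.card ≤ 5 * n) (hd : 32 * d ≤ 3 * n) :
    (bidderPool Q A v).card + d ≤ (objectPool Q A v).card := by
  unfold bidderPool objectPool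
  have h1 := Finset.card_erase_le (s := Q) (a := v)
  split_ifs with h
  · have h2 := Finset.card_union_le A (Q.erase v)
    have h3 := Finset.le_card_sdiff Q (Finset.univ.erase v \ A)
    have h4 := Finset.le_card_sdiff A (Finset.univ.erase v)
    rw [Finset.card_erase_of_mem (Finset.mem_univ v), Finset.card_univ, Fintype.card_fin] at h4
    omega
  · have h2 := Finset.card_le_card (Finset.sdiff_subset (s := Q.erase v) (t := A))
    omega

lemma notMem_bidderPool {Q A : Finset (Fin n)} {v : Fin n} (hA : v ∉ A) :
    v ∉ bidderPool Q A v := by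
  unfold bidderPool; split_ifs <;> simp [hA]

lemma notMem_objectPool {Q A : Finset (Fin n)} {v : Fin n} (hA : v ∉ A) :
    v ∉ objectPool Q A v := by
  unfold objectPool; split_ifs <;> simp [hA]

lemma disjoint_pools (Q A : Finset (Fin n)) (v : Fin n) :
    Disjoint (bidderPool Q A v) (objectPool Q A v) := by
  unfold bidderPool objectPool
  rw [Finset.disjoint_left]
  split_ifs
  · intro x hx
    simp at hx ⊢
    tauto
  · intro x hx
    simp at hx ⊢
    tauto

variable (σ : Equiv.Perm (Fin n)) (p : unitInterval)

/-- The event that `v` beats exactly the players in `S`, and no member of `X` is adjacent to a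
member of `Y` in the bipartite graph of the auction, where `x` and `y` are adjacent if `v` beats `x` if and
only if `x` beats `y`. -/
def nonexpansionEvent (v : Fin n) (S X Y : Finset (Fin n)) : Set (Upsets n) :=
  {ω | (∀ x ∈ Finset.univ.erase v, (crTournament σ ω).beats v x = decide (x ∈ S)) ∧
    ∀ x ∈ X, ∀ y ∈ Y, (crTournament σ ω).beats x y = !decide (x ∈ S)}

lemma prob_nonexpansionEvent_le (hp : (p : ℝ) ≤ 1 / 2) {v : Fin n} {S X Y : Finset (Fin n)}
    (hX : v ∉ X) (hY : v ∉ Y) (hXY : Disjoint X Y) :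
    (upsetMeasure n p).real (nonexpansionEvent σ v S X Y) ≤
      (∏ x ∈ Finset.univ.erase v, weight σ p v x (decide (x ∈ S))) *
        (1 - (p : ℝ)) ^ (Y.card * X.card) := by
  have hp0 : 0 ≤ (p : ℝ) := p.2.1
  have hp1 : (p : ℝ) ≤ 1 := p.2.2
  let D1 : Finset (Fin n × Fin n) := (Finset.univ.erase v).image fun a => (v, a)
  let b : Fin n × Fin n → Bool := fun q =>
    if q.1 = v then decide (q.2 ∈ S) else !decide (q.1 ∈ S)
  have hd : Disjoint D1 (X ×ˢ Y) := by
    rw [Finset.disjoint_left]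
    intro q h1 h2
    obtain ⟨a, ha, rfl⟩ := Finset.mem_image.1 h1
    exact hX (Finset.mem_product.1 h2).1
  have hmem : ∀ q, q ∈ D1 ∪ X ×ˢ Y ↔ (q.1 = v ∧ q.2 ≠ v) ∨ q.1 ∈ X ∧ q.2 ∈ Y := by
    rintro ⟨q1, q2⟩
    simp only [D1, Finset.mem_union, Finset.mem_image, Finset.mem_erase, Finset.mem_univ, and_true,
      Prod.mk.injEq, Finset.mem_product]
    constructor
    · rintro (⟨a, h, rfl, rfl⟩ | h)
      · exact Or.inl ⟨rfl, h⟩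
      · exact Or.inr h
    · rintro (⟨h, h'⟩ | h)
      · exact Or.inl ⟨q2, h', h.symm, rfl⟩
      · exact Or.inr h
  have hne : ∀ x ∈ X, x ≠ v := fun x hx e => hX (e ▸ hx)
  have e1 : nonexpansionEvent σ v S X Y =
      {ω | ∀ q ∈ D1 ∪ X ×ˢ Y, (crTournament σ ω).beats q.1 q.2 = b q} := by
    ext ω
    simp only [nonexpansionEvent, Set.mem_ofPred_eq, hmem]
    constructor
    · rintro ⟨h1, h2⟩ ⟨q1, q2⟩ (⟨rfl, h⟩ | ⟨h, h'⟩)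
      · simpa [b] using h1 q2 (by simpa using h)
      · simpa [b, hne q1 h] using h2 q1 h q2 h'
    · intro h
      refine ⟨fun x hx => ?_, fun x hx y hy => ?_⟩
      · simpa [b] using h (v, x) (Or.inl ⟨rfl, by simpa using hx⟩)
      · simpa [b, hne x hx] using h (x, y) (Or.inr ⟨hx, hy⟩)
  rw [e1, prob_outcomes σ p _ ?_ ?_ b, Finset.prod_union hd,
    Finset.prod_image (by intro a _ a' _ e; simpa using e)]
  · refine mul_le_mul (le_of_eq (by simp [b])) ?_ (Finset.prod_nonneg fun q _ =>
      weight_nonneg hp0 hp1 _ _ _) (Finset.prod_nonneg fun q _ => weight_nonneg hp0 hp1 _ _ _)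
    refine (Finset.prod_le_prod (fun q _ => weight_nonneg hp0 hp1 _ _ _)
      fun q _ => weight_le hp _ _ _).trans (le_of_eq ?_)
    rw [Finset.prod_const, Finset.card_product, mul_comm]
  · intro q hq
    rcases (hmem q).1 hq with ⟨h, h'⟩ | ⟨h, h'⟩
    · exact fun e => h' (e ▸ h)
    · exact fun e => Finset.disjoint_left.1 hXY h (e ▸ h')
  · intro q hq hq'
    have hq' := (hmem _).1 hq'
    simp only [Prod.fst_swap, Prod.snd_swap] at hq'
    rcases (hmem q).1 hq with ⟨h, h'⟩ | ⟨h, h'⟩ <;> rcases hq' with ⟨g, g'⟩ | ⟨g, g'⟩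
    · exact h' g
    · exact hY (h ▸ g')
    · exact hY (g ▸ h')
    · exact Finset.disjoint_left.1 hXY h g'

lemma sum_prob_outSet (p : ℝ) (v : Fin n) :
    ∑ S ∈ (Finset.univ.erase v).powerset,
      ∏ x ∈ Finset.univ.erase v, weight σ p v x (decide (x ∈ S)) = 1 := by
  have h := Finset.prod_add (fun x => weight σ p v x true) (fun x => weight σ p v x false)
    (Finset.univ.erase v)
  simp only [weight_add, Finset.prod_const_one] at h
  rw [h]
  refine Finset.sum_congr rfl fun S hS => ?_
  rw [← Finset.prod_sdiff (Finset.mem_powerset.1 hS), mul_comm]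
  congr 1
  · exact Finset.prod_congr rfl fun x hx => by simp [hx]
  · exact Finset.prod_congr rfl fun x hx => by simp [(Finset.mem_sdiff.1 hx).2]

/-- The union bound over the set `S` of players beaten by `v`, over the sets `X` of bidders, and
over the sets `D` of `X.card` objects that may contain all neighbours of `X`. Given `S`, the matches
between the bidders and the objects are still independent, and `X` has no neighbour outside `D` with
probability at most `(1 - p) ^ (d * X.card)`. -/
lemma prob_not_isExpanding_le (hp : (p : ℝ) ≤ 1 / 2) {Q : Finset (Fin n)} {v : Fin n} {d : ℕ}
    (hQ : 32 * Q.card ≤ 5 * n) (hd : 32 * d ≤ 3 * n) :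
    (upsetMeasure n p).real {ω | ¬ IsExpanding (crTournament σ ω) Q v} ≤
      (1 + n * (1 - (p : ℝ)) ^ d) ^ n - 1 := by
  classical
  have hp0 : 0 ≤ (p : ℝ) := p.2.1
  have hp1 : (p : ℝ) ≤ 1 := p.2.2
  let q : ℝ := (1 - (p : ℝ)) ^ d
  have hq : 0 ≤ q := pow_nonneg (by linarith) _
  let XS : Finset (Fin n) → Finset (Finset (Fin n)) := fun S =>
    (bidderPool Q S v).powerset.erase ∅
  let DS : Finset (Fin n) → Finset (Fin n) → Finset (Finset (Fin n)) := fun S X =>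
    (objectPool Q S v).powersetCard X.card
  have hsub : {ω | ¬ IsExpanding (crTournament σ ω) Q v} ⊆
      ⋃ S ∈ (Finset.univ.erase v).powerset, ⋃ X ∈ XS S, ⋃ D ∈ DS S X,
        nonexpansionEvent σ v S X (objectPool Q S v \ D) := by
    intro ω hω
    simp only [Set.mem_ofPred_eq, IsExpanding, not_forall, not_lt] at hω
    obtain ⟨X, hX, hne, hcard⟩ := hω
    set T := crTournament σ ω
    set S := outSet T v with hS
    have hvS : v ∉ S := by simp [hS, outSet, T.beats_self]
    have hlt := card_bidderPool_add_le S v hQ hd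
    have hXc := Finset.card_le_card hX
    obtain ⟨D, hD1, hD2, hD3⟩ := Finset.exists_subsuperset_card_eq
      (Finset.filter_subset (fun z => ∃ x ∈ X, T.beats v x = T.beats x z) (objectPool Q S v))
      hcard (by omega)
    simp only [Set.mem_iUnion]
    refine ⟨S, ?_, X, ?_, D, ?_, ?_, ?_⟩
    · rw [Finset.mem_powerset]
      exact fun x hx => Finset.mem_erase.2 ⟨fun e => hvS (e ▸ hx), Finset.mem_univ _⟩
    · exact Finset.mem_erase.2 ⟨hne.ne_empty, Finset.mem_powerset.2 hX⟩
    · exact Finset.mem_powersetCard.2 ⟨hD2, hD3⟩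
    · intro x _
      rw [Bool.eq_iff_iff]
      simp [hS, outSet, T]
    · intro x hx y hy
      obtain ⟨hy1, hy2⟩ := Finset.mem_sdiff.1 hy
      have h1 : ¬ T.beats v x = T.beats x y := fun e =>
        hy2 (hD1 (Finset.mem_filter.2 ⟨hy1, x, hx, e⟩))
      have h2 : decide (x ∈ S) = T.beats v x := by
        rw [Bool.eq_iff_iff]
        simp [hS, outSet]
      rw [h2]
      change T.beats x y = _
      revert h1
      cases T.beats v x <;> cases T.beats x y <;> simp
  let w : Finset (Fin n) → ℝ := fun S =>
    ∏ x ∈ Finset.univ.erase v, weight σ p v x (decide (x ∈ S))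
  have hw : ∀ S, 0 ≤ w S := fun S => Finset.prod_nonneg fun x _ => weight_nonneg hp0 hp1 _ _ _
  have hE : ∀ S ∈ (Finset.univ.erase v).powerset, ∀ X ∈ XS S, ∀ D ∈ DS S X,
      (upsetMeasure n p).real (nonexpansionEvent σ v S X (objectPool Q S v \ D)) ≤
        w S * q ^ X.card := by
    intro S hS X hX D hD
    have hvS : v ∉ S := fun h => Finset.notMem_erase v _ (Finset.mem_powerset.1 hS h)
    have hX' := Finset.mem_powerset.1 (Finset.mem_erase.1 hX).2
    obtain ⟨hD1, hD2⟩ := Finset.mem_powersetCard.1 hD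
    refine (prob_nonexpansionEvent_le σ p hp (fun h => notMem_bidderPool hvS (hX' h))
      (fun h => notMem_objectPool hvS (Finset.mem_sdiff.1 h).1)
      (Finset.disjoint_of_subset_left hX' (Finset.disjoint_of_subset_right Finset.sdiff_subset
        (disjoint_pools Q S v)))).trans ?_
    refine mul_le_mul_of_nonneg_left ?_ (hw S)
    rw [← pow_mul]
    refine pow_le_pow_of_le_one (by linarith) (by linarith) (Nat.mul_le_mul_right _ ?_)
    have h1 := Finset.le_card_sdiff D (objectPool Q S v)
    have h2 := card_bidderPool_add_le S v hQ hd
    have h3 := Finset.card_le_card hX'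
    omega
  have hsum : ∀ S, ∑ X ∈ XS S, ∑ _D ∈ DS S X, w S * q ^ X.card ≤
      w S * ((1 + n * q) ^ n - 1) := by
    intro S
    calc ∑ X ∈ XS S, ∑ _D ∈ DS S X, w S * q ^ X.card
        ≤ ∑ X ∈ XS S, w S * (n * q) ^ X.card := by
          refine Finset.sum_le_sum fun X _ => ?_
          rw [Finset.sum_const, nsmul_eq_mul, mul_left_comm, mul_pow]
          refine mul_le_mul_of_nonneg_left ?_ (hw S)
          refine mul_le_mul_of_nonneg_right ?_ (pow_nonneg hq _)
          rw [Finset.card_powersetCard]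
          have h1 := Nat.choose_le_pow (objectPool Q S v).card X.card
          have h2 := Nat.pow_le_pow_left (card_finset_fin_le (objectPool Q S v)) X.card
          exact_mod_cast h1.trans h2
      _ = w S * ((1 + n * q) ^ (bidderPool Q S v).card - 1) := by
          rw [← Finset.mul_sum]
          congr 1
          rw [Finset.sum_erase_eq_sub (Finset.empty_mem_powerset _)]
          have := Finset.sum_pow_mul_eq_add_pow (n * q) 1 (bidderPool Q S v)
          simp only [one_pow, mul_one] at this
          rw [this, add_comm]
          simp
      _ ≤ _ := by
          refine mul_le_mul_of_nonneg_left (sub_le_sub_right ?_ 1) (hw S)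
          refine pow_le_pow_right₀ ?_ (card_finset_fin_le _)
          have : 0 ≤ n * q := by positivity
          linarith
  calc (upsetMeasure n p).real {ω | ¬ IsExpanding (crTournament σ ω) Q v}
      ≤ _ := measureReal_mono hsub (measure_ne_top _ _)
    _ ≤ ∑ S ∈ (Finset.univ.erase v).powerset, ∑ X ∈ XS S, ∑ D ∈ DS S X,
        (upsetMeasure n p).real (nonexpansionEvent σ v S X (objectPool Q S v \ D)) := by
        refine (measureReal_biUnion_finset_le _ _).trans (Finset.sum_le_sum fun S _ => ?_)
        refine (measureReal_biUnion_finset_le _ _).trans (Finset.sum_le_sum fun X _ => ?_)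
        exact measureReal_biUnion_finset_le _ _
    _ ≤ ∑ S ∈ (Finset.univ.erase v).powerset, w S * ((1 + n * q) ^ n - 1) :=
        Finset.sum_le_sum fun S hS => (Finset.sum_le_sum fun X hX =>
          Finset.sum_le_sum fun D hD => hE S hS X hX D hD).trans (hsum S)
    _ = _ := by
        rw [← Finset.sum_mul, sum_prob_outSet, one_mul]

end Expansion

/-! ### The algorithm succeeds with high probability -/

/-- The strongest `5 / 32` of the players. They are few enough for the objects to outnumber the
bidders by `3 * n / 32`, and many enough for the
other players to be dominated by `k` players, where `n = 2 ^ k`. -/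
def strongest {n : ℕ} (σ : Equiv.Perm (Fin n)) : Finset (Fin n) :=
  Finset.univ.filter fun u => 32 * (σ u : ℕ) < 5 * n

lemma card_strongest {m : ℕ} (σ : Equiv.Perm (Fin (32 * m))) : (strongest σ).card = 5 * m := by
  rw [← Finset.card_range (5 * m), ← Finset.card_map σ.toEmbedding,
    ← Finset.card_map Fin.valEmbedding]
  congr 1
  ext x
  simp only [strongest, Finset.mem_map, Finset.mem_filter, Finset.mem_univ, true_and,
    Equiv.coe_toEmbedding, Fin.valEmbedding_apply, Finset.mem_range]
  constructor
  · rintro ⟨y, ⟨u, h, rfl⟩, rfl⟩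
    omega
  · intro h
    refine ⟨⟨x, by omega⟩, ⟨σ.symm ⟨x, by omega⟩, ?_, by simp⟩, rfl⟩
    simp
    omega

lemma one_sub_pow_le_exp {x : ℝ} (hx : x ≤ 1) (m : ℕ) : (1 - x) ^ m ≤ Real.exp (-(x * m)) := by
  have h1 : 1 - x ≤ Real.exp (-x) := by have := Real.add_one_le_exp (-x); linarith
  refine (pow_le_pow_left₀ (by linarith) h1 m).trans (le_of_eq ?_)
  rw [← Real.exp_nat_mul]
  congr 1
  ring

lemma exp_neg_mul_log_le {n : ℕ} (hn : 0 < n) {a : ℕ} {y : ℝ} (h : a * Real.log n ≤ y) :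
    Real.exp (-y) ≤ 1 / (n : ℝ) ^ a := by
  have hn' : (0 : ℝ) < n := by exact_mod_cast hn
  rw [one_div, ← Real.exp_log (inv_pos.2 (pow_pos hn' a)), Real.log_inv, Real.log_pow]
  exact Real.exp_le_exp.2 (by linarith)

/-- The lower bound on the noise makes expansion fail with probability at most `1 / n ^ 3` for a
fixed player. -/
lemma prob_not_isExpanding_strongest_le {m : ℕ} (hm : 0 < m) (σ : Equiv.Perm (Fin (32 * m)))
    (p : unitInterval) (hp : (p : ℝ) ≤ 1 / 2)
    (hp' : 64 * Real.log (32 * m : ℕ) ≤ p * (32 * m : ℕ)) (v : Fin (32 * m)) :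
    (upsetMeasure (32 * m) p).real {ω | ¬ IsExpanding (crTournament σ ω) (strongest σ) v} ≤
      1 / ((32 * m : ℕ) : ℝ) ^ 3 := by
  have h := prob_not_isExpanding_le σ p hp (Q := strongest σ) (v := v) (d := 3 * m)
    (by rw [card_strongest]; omega) (by omega)
  refine h.trans ?_
  have hq : (1 - (p : ℝ)) ^ (3 * m) ≤ 1 / ((32 * m : ℕ) : ℝ) ^ 6 := by
    refine (one_sub_pow_le_exp p.2.2 _).trans (exp_neg_mul_log_le (by omega) ?_)
    push_cast at hp' ⊢
    linarith
  have hn32 : (32 : ℝ) ≤ ((32 * m : ℕ) : ℝ) := by exact_mod_cast (by omega : 32 ≤ 32 * m)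
  have hq' : 0 ≤ (1 - (p : ℝ)) ^ (3 * m) := pow_nonneg (by linarith) _
  generalize 32 * m = n at *
  generalize (1 - (p : ℝ)) ^ (3 * m) = q at *
  have hn0 : (0 : ℝ) < n := by linarith
  have hq0 : 0 ≤ 1 + n * q := by positivity
  have h1 : (1 + n * q) ^ n ≤ Real.exp (1 / (n : ℝ) ^ 4) := by
    have h2 : 1 + n * q ≤ Real.exp (1 / (n : ℝ) ^ 5) := by
      refine le_trans ?_ (Real.add_one_le_exp _)
      have : n * q ≤ n * (1 / (n : ℝ) ^ 6) := mul_le_mul_of_nonneg_left hq hn0.le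
      have e : n * (1 / (n : ℝ) ^ 6) = 1 / (n : ℝ) ^ 5 := by field_simp
      linarith
    refine (pow_le_pow_left₀ hq0 h2 n).trans (le_of_eq ?_)
    rw [← Real.exp_nat_mul]
    congr 1
    field_simp
  have h4 : 1 / (n : ℝ) ^ 4 ≤ 1 := by
    rw [div_le_one (by positivity)]
    exact one_le_pow₀ (by linarith)
  have h5 := Real.abs_exp_sub_one_le (x := 1 / (n : ℝ) ^ 4)
    (by rw [abs_of_nonneg (by positivity)]; exact h4)
  rw [abs_of_nonneg (a := 1 / (n : ℝ) ^ 4) (by positivity)] at h5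
  have h6 := (abs_le.1 h5).2
  have h7 : 2 * (1 / (n : ℝ) ^ 4) ≤ 1 / (n : ℝ) ^ 3 := by
    rw [← mul_div_assoc, div_le_div_iff₀ (by positivity) (by positivity)]
    have : (n : ℝ) ^ 4 = n * n ^ 3 := by ring
    rw [this]
    nlinarith [pow_pos hn0 3]
  linarith

lemma thousand_mul_le_two_pow {k : ℕ} (hk : 14 ≤ k) : 1000 * k ≤ 2 ^ k := by
  induction k, hk using Nat.le_induction with
  | base => norm_num
  | succ k hk ih => rw [pow_succ]; omega

/-- The lower bound on the noise makes a fixed player `u` outside the strongest `5 / 32` undominated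
with probability at most `1 / n ^ 4`. -/
lemma prob_few_common_strongest_le {k : ℕ} (hk : 14 ≤ k) {m : ℕ} (hm : 2 ^ k = 32 * m)
    (σ : Equiv.Perm (Fin (32 * m))) (p : unitInterval) (hp : (p : ℝ) < 1 / 2)
    (hp' : 64 * Real.log (32 * m : ℕ) ≤ p * (32 * m : ℕ)) {u v : Fin (32 * m)}
    (hu : u ∉ strongest σ) (huv : u ≠ v) :
    (upsetMeasure (32 * m) p).real {ω | {a ∈ (Finset.univ : Finset (Fin (32 * m))) |
      (crTournament σ ω).beats v a = true ∧ (crTournament σ ω).beats a u = true}.card < k} ≤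
      1 / ((32 * m : ℕ) : ℝ) ^ 4 := by
  have hm0 : 0 < m := by have := Nat.two_pow_pos k; omega
  have h := prob_few_common σ p hp.le huv ((strongest σ).erase v)
    (fun h => hu (Finset.mem_of_mem_erase h)) (Finset.notMem_erase v _) (fun a ha => by
      have h1 := Finset.mem_of_mem_erase ha
      simp only [strongest, Finset.mem_filter, Finset.mem_univ, true_and, not_lt] at h1 hu
      exact Fin.lt_def.2 (by omega)) k
  refine (measureReal_mono (fun ω hω => ?_) (measure_ne_top _ _)).trans (h.trans ?_)
  · refine lt_of_le_of_lt (Finset.card_le_card ?_) hω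
    exact Finset.filter_subset_filter _ (Finset.subset_univ _)
  have hp0 : 0 ≤ (p : ℝ) := p.2.1
  have hR : 5 * (m : ℝ) - 1 ≤ (((strongest σ).erase v).card : ℝ) := by
    have h1 := Finset.pred_card_le_card_erase (s := strongest σ) (a := v)
    rw [card_strongest] at h1
    have h2 : 5 * m ≤ ((strongest σ).erase v).card + 1 := by omega
    have h3 : (5 * m : ℝ) ≤ (((strongest σ).erase v).card : ℝ) + 1 := by exact_mod_cast h2
    linarith
  have hpow := thousand_mul_le_two_pow hk
  have hlog : Real.log (32 * m : ℕ) ≤ k := by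
    rw [← hm]
    push_cast
    rw [Real.log_pow]
    have := Real.log_two_lt_d9
    have hk0 : (0 : ℝ) ≤ k := Nat.cast_nonneg k
    nlinarith
  have hlog' : 1 ≤ Real.log (32 * m : ℕ) := by
    rw [← hm]
    push_cast
    rw [Real.log_pow]
    have := Real.log_two_gt_d9
    have hk0 : (14 : ℝ) ≤ k := by exact_mod_cast hk
    nlinarith
  have hmk : 1000 * (k : ℝ) ≤ 32 * m := by
    rw [hm] at hpow
    exact_mod_cast hpow
  have hkey : (6 : ℕ) * Real.log (32 * m : ℕ) ≤
      3 / 4 * (p * (1 - p)) * (((strongest σ).erase v).card : ℝ) := by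
    have h5 : (0 : ℝ) ≤ 5 * m - 1 := by
      have : (1 : ℝ) ≤ m := by exact_mod_cast hm0
      linarith
    have h6 : 3 / 4 * (p * (1 - p)) * (5 * (m : ℝ) - 1) ≤
        3 / 4 * (p * (1 - p)) * (((strongest σ).erase v).card : ℝ) :=
      mul_le_mul_of_nonneg_left hR (by
        have : 0 ≤ 1 - (p : ℝ) := by linarith
        positivity)
    refine le_trans ?_ h6
    -- for small noise the factor `1 - p` is close to `1`; for large noise there is room to spare
    rcases le_total (p : ℝ) (1 / 8) with h8 | h8
    · have h9 : 7 / 8 * (p : ℝ) ≤ p * (1 - p) := by nlinarith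
      have h10 := mul_le_mul_of_nonneg_right h9 h5
      push_cast at hp' hlog' ⊢
      nlinarith
    · have h9 : 7 / 64 ≤ (p : ℝ) * (1 - p) := by nlinarith
      have h10 := mul_le_mul_of_nonneg_right h9 h5
      push_cast at hlog hlog' ⊢
      nlinarith
  have hq : 3 / 4 * ((p : ℝ) * (1 - p)) ≤ 1 := by nlinarith
  have h11 := (one_sub_pow_le_exp hq ((strongest σ).erase v).card).trans
    (exp_neg_mul_log_le (by omega : 0 < 32 * m) hkey)
  have h4 : (4 : ℝ) ^ k = ((32 * m : ℕ) : ℝ) ^ 2 := by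
    rw [← hm]; push_cast; rw [← pow_mul, mul_comm, pow_mul]; norm_num
  have hn0 : (0 : ℝ) < ((32 * m : ℕ) : ℝ) := by exact_mod_cast (by omega : 0 < 32 * m)
  rw [h4]
  refine (mul_le_mul_of_nonneg_left h11 (by positivity)).trans (le_of_eq ?_)
  field_simp

/-- The event that one of the two structural properties fails for some player has probability at
most `2 / n ^ 2`. -/
lemma prob_structure_fails_le {k : ℕ} (hk : 14 ≤ k) {m : ℕ} (hm : 2 ^ k = 32 * m)
    (σ : Equiv.Perm (Fin (32 * m))) (p : unitInterval) (hp : (p : ℝ) < 1 / 2)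
    (hp' : 64 * Real.log (32 * m : ℕ) ≤ p * (32 * m : ℕ)) :
    (upsetMeasure (32 * m) p).real {ω | ¬ ∀ v, IsExpanding (crTournament σ ω) (strongest σ) v ∧
      IsDominated (crTournament σ ω) (strongest σ) v k} ≤ 2 / ((32 * m : ℕ) : ℝ) ^ 2 := by
  classical
  have hm0 : 0 < m := by have := Nat.two_pow_pos k; omega
  have hn0 : (0 : ℝ) < (32 * m : ℕ) := by exact_mod_cast (by omega : 0 < 32 * m)
  let E : Fin (32 * m) → Set (Upsets (32 * m)) := fun v =>
    {ω | ¬ IsExpanding (crTournament σ ω) (strongest σ) v}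
  let F : Fin (32 * m) × Fin (32 * m) → Set (Upsets (32 * m)) := fun q =>
    {ω | {a ∈ (Finset.univ : Finset (Fin (32 * m))) |
      (crTournament σ ω).beats q.1 a = true ∧ (crTournament σ ω).beats a q.2 = true}.card < k}
  let G : Finset (Fin (32 * m) × Fin (32 * m)) :=
    Finset.univ.filter fun q => q.2 ∉ strongest σ ∧ q.2 ≠ q.1
  have hsub : {ω | ¬ ∀ v, IsExpanding (crTournament σ ω) (strongest σ) v ∧
      IsDominated (crTournament σ ω) (strongest σ) v k} ⊆
      (⋃ v ∈ (Finset.univ : Finset (Fin (32 * m))), E v) ∪ ⋃ q ∈ G, F q := by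
    intro ω hω
    simp only [Set.mem_ofPred_eq, not_forall, not_and_or, IsDominated, not_le] at hω
    obtain ⟨v, hv | ⟨u, hu, huv, h⟩⟩ := hω
    · exact Or.inl (Set.mem_biUnion (Finset.mem_univ v) hv)
    · exact Or.inr (Set.mem_biUnion (x := (v, u)) (by simp [G, hu, huv]) h)
  have hE : (upsetMeasure (32 * m) p).real (⋃ v ∈ (Finset.univ : Finset (Fin (32 * m))), E v) ≤
      1 / ((32 * m : ℕ) : ℝ) ^ 2 := by
    refine (measureReal_biUnion_finset_le _ _).trans ((Finset.sum_le_card_nsmul _ _ _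
      fun v _ => prob_not_isExpanding_strongest_le hm0 σ p hp.le hp' v).trans (le_of_eq ?_))
    rw [Finset.card_univ, Fintype.card_fin, nsmul_eq_mul]
    field_simp
  have hF : (upsetMeasure (32 * m) p).real (⋃ q ∈ G, F q) ≤ 1 / ((32 * m : ℕ) : ℝ) ^ 2 := by
    have hG : (G.card : ℝ) ≤ ((32 * m : ℕ) : ℝ) ^ 2 := by
      have h1 := Finset.card_le_univ G
      rw [Fintype.card_prod, Fintype.card_fin, ← sq] at h1
      exact_mod_cast h1
    refine (measureReal_biUnion_finset_le _ _).trans ((Finset.sum_le_card_nsmul _ _ _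
      fun q hq => prob_few_common_strongest_le hk hm σ p hp hp' (Finset.mem_filter.1 hq).2.1
        (Finset.mem_filter.1 hq).2.2).trans ?_)
    rw [nsmul_eq_mul]
    refine (mul_le_mul_of_nonneg_right hG (by positivity)).trans (le_of_eq ?_)
    field_simp
  refine (measureReal_mono hsub (measure_ne_top (upsetMeasure (32 * m) p) _)).trans
    ((measureReal_union_le _ _).trans ?_)
  have : 2 / ((32 * m : ℕ) : ℝ) ^ 2 =
      1 / ((32 * m : ℕ) : ℝ) ^ 2 + 1 / ((32 * m : ℕ) : ℝ) ^ 2 := by ring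
  linarith

theorem prob_algorithm_succeeds {k : ℕ} (hk : 14 ≤ k) (σ : Equiv.Perm (Fin (2 ^ k)))
    (p : unitInterval) (hp' : 64 * Real.log ((2 : ℝ) ^ k) / (2 : ℝ) ^ k ≤ p)
    (hp : (p : ℝ) < 1 / 2) :
    1 - 2 / ((2 : ℝ) ^ k) ^ 2 ≤ (upsetMeasure (2 ^ k) p).real
      {ω | ∀ v : Fin (2 ^ k), ∃ s : Equiv.Perm (Fin (2 ^ k)),
        Algo.main.toProgram.Outputs (crTournament σ ω) v s ∧
          IsWinningSeeding (crTournament σ ω) v s} := by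
  obtain ⟨m, hm⟩ : 32 ∣ 2 ^ k := pow_dvd_pow 2 (by omega : 5 ≤ k)
  have h2k : ((2 ^ k : ℕ) : ℝ) = (2 : ℝ) ^ k := by push_cast; rfl
  have hfail : (upsetMeasure (2 ^ k) p).real
      {ω | ¬ ∀ v, IsExpanding (crTournament σ ω) (strongest σ) v ∧
        IsDominated (crTournament σ ω) (strongest σ) v k} ≤ 2 / ((2 : ℝ) ^ k) ^ 2 := by
    rw [div_le_iff₀ (by positivity), ← h2k] at hp'
    rw [← h2k]
    revert σ hp'
    rw [hm]
    exact fun σ hp' => prob_structure_fails_le hk hm σ p hp hp'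
  have hcard : 32 * (strongest σ).card = 5 * 2 ^ k := by
    revert σ
    clear hp' h2k
    rw [hm]
    intro σ _
    rw [card_strongest]
    ring
  have h32 : 32 ≤ 2 ^ k := by
    have := Nat.pow_le_pow_right (n := 2) (by norm_num) (by omega : 5 ≤ k); omega
  rw [← sub_nonneg] at hfail
  have huniv : (upsetMeasure (2 ^ k) p).real Set.univ = 1 := probReal_univ
  have hcov : (Set.univ : Set (Upsets (2 ^ k))) ⊆
      {ω | ∀ v : Fin (2 ^ k), ∃ s : Equiv.Perm (Fin (2 ^ k)),
        Algo.main.toProgram.Outputs (crTournament σ ω) v s ∧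
          IsWinningSeeding (crTournament σ ω) v s} ∪
      {ω | ¬ ∀ v, IsExpanding (crTournament σ ω) (strongest σ) v ∧
        IsDominated (crTournament σ ω) (strongest σ) v k} := by
    intro ω _
    by_cases h : ∀ v, IsExpanding (crTournament σ ω) (strongest σ) v ∧
        IsDominated (crTournament σ ω) (strongest σ) v k
    · refine Or.inl fun v => ?_
      exact Algo.main_outputs _ v ((h v).2.wins_nonempty (by omega) (by omega))
        (Or.inr ((h v).1.hallCondition (h v).2))
    · exact Or.inr h
  have := (measureReal_mono hcov (measure_ne_top _ _)).trans
    (measureReal_union_le (μ := upsetMeasure (2 ^ k) p) _ _)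
  linarith

/-! ### Small noise -/

/-- The weakest player has to beat `k` players, and every set of `k` players is beaten by the
weakest player with probability `p ^ k`. -/
lemma prob_isSEWinner_weakest_le {k : ℕ} (σ : Equiv.Perm (Fin (2 ^ k))) (p : unitInterval) :
    (upsetMeasure (2 ^ k) p).real {ω | IsSEWinner (crTournament σ ω) (weakest σ)} ≤
      (2 ^ k).choose k * (p : ℝ) ^ k := by
  classical
  set w := weakest σ with hw
  have hp0 : 0 ≤ (p : ℝ) := p.2.1
  have hlast : ∀ u, u ≠ w → σ u < σ w := by
    intro u hu
    have h1 : σ w = ⟨2 ^ k - 1, Nat.sub_lt (Nat.two_pow_pos k) one_pos⟩ := by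
      simp [hw, weakest]
    have h2 : σ u ≠ σ w := fun e => hu (σ.injective e)
    have h3 := (σ u).isLt
    rw [Fin.lt_def]
    have h4 : (σ u : ℕ) ≠ σ w := fun e => h2 (Fin.ext e)
    rw [h1] at h4 ⊢
    simp only at h4 ⊢
    omega
  have hsub : {ω | IsSEWinner (crTournament σ ω) w} ⊆
      ⋃ S ∈ ((Finset.univ : Finset (Fin (2 ^ k))).powersetCard k).filter (w ∉ ·),
        {ω | ∀ q ∈ S.image fun u => (w, u), (crTournament σ ω).beats q.1 q.2 = true} := by
    rintro ω ⟨s, hs⟩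
    obtain ⟨-, S, hS1, -, hS2⟩ := (crTournament σ ω).champion_wins k s s.injective
    rw [show (crTournament σ ω).champion k s = w from hs] at hS2
    refine Set.mem_biUnion (x := S) ?_ ?_
    · simp only [Finset.coe_filter, Finset.mem_powersetCard, Set.mem_ofPred_eq]
      refine ⟨⟨Finset.subset_univ _, hS1⟩, fun h => ?_⟩
      have := hS2 w h
      rw [(crTournament σ ω).beats_self] at this
      exact absurd this (by decide)
    · intro q hq
      obtain ⟨u, hu, rfl⟩ := Finset.mem_image.1 hq
      exact hS2 u hu
  refine (measureReal_mono hsub (measure_ne_top _ _)).trans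
    ((measureReal_biUnion_finset_le _ _).trans ?_)
  refine (Finset.sum_le_card_nsmul _ _ ((p : ℝ) ^ k) fun S hS => ?_).trans ?_
  · obtain ⟨hS1, hS2⟩ := Finset.mem_filter.1 hS
    have hne : ∀ u ∈ S, u ≠ w := fun u hu e => hS2 (e ▸ hu)
    rw [prob_outcomes σ p _ _ _ fun _ => true]
    · rw [Finset.prod_image (by intro a _ a' _ e; simpa using e),
        Finset.prod_congr rfl fun u hu => show _ = (p : ℝ) by
          simp [weight, (hlast u (hne u hu)).not_gt], Finset.prod_const,
        (Finset.mem_powersetCard.1 hS1).2]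
    · intro q hq
      obtain ⟨u, hu, rfl⟩ := Finset.mem_image.1 hq
      exact (hne u hu).symm
    · intro q hq hq'
      obtain ⟨u, hu, rfl⟩ := Finset.mem_image.1 hq
      obtain ⟨u', hu', e⟩ := Finset.mem_image.1 hq'
      simp only [Prod.swap_prod_mk, Prod.mk.injEq] at e
      exact hne u hu e.1.symm
  · rw [nsmul_eq_mul]
    refine mul_le_mul_of_nonneg_right ?_ (pow_nonneg hp0 k)
    have h1 := Finset.card_filter_le ((Finset.univ : Finset (Fin (2 ^ k))).powersetCard k) (w ∉ ·)
    rw [Finset.card_powersetCard, Finset.card_univ, Fintype.card_fin] at h1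
    exact_mod_cast h1

lemma prob_isSEWinner_weakest_le_half_pow {k : ℕ} (σ : Equiv.Perm (Fin (2 ^ k))) (p : unitInterval)
    (hp : (p : ℝ) ≤ 1 / 4 * Real.log ((2 : ℝ) ^ k) / (2 : ℝ) ^ k) :
    (upsetMeasure (2 ^ k) p).real {ω | IsSEWinner (crTournament σ ω) (weakest σ)} ≤
      (1 / 2) ^ k := by
  have hp0 : 0 ≤ (p : ℝ) := p.2.1
  refine (prob_isSEWinner_weakest_le σ p).trans ?_
  have h1 : (2 : ℝ) ^ k * p ≤ 1 / 4 * Real.log 2 * k := by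
    rw [le_div_iff₀ (by positivity), Real.log_pow] at hp
    linarith
  have h2 := Nat.choose_le_pow_div (α := ℝ) k (2 ^ k)
  push_cast at h2
  have h3 := Real.pow_div_factorial_le_exp (x := (k : ℝ)) (Nat.cast_nonneg k) k
  have hf : (0 : ℝ) < k.factorial := by exact_mod_cast k.factorial_pos
  have hl : 0 ≤ Real.log 2 := Real.log_nonneg (by norm_num)
  calc ((2 ^ k).choose k : ℝ) * (p : ℝ) ^ k
      ≤ ((2 : ℝ) ^ k) ^ k / k.factorial * (p : ℝ) ^ k :=
        mul_le_mul_of_nonneg_right h2 (pow_nonneg hp0 k)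
    _ = ((2 : ℝ) ^ k * p) ^ k / k.factorial := by rw [mul_pow]; ring
    _ ≤ (1 / 4 * Real.log 2 * k) ^ k / k.factorial :=
        div_le_div_of_nonneg_right (pow_le_pow_left₀ (by positivity) h1 k) hf.le
    _ = (1 / 4 * Real.log 2) ^ k * ((k : ℝ) ^ k / k.factorial) := by rw [mul_pow]; ring
    _ ≤ (1 / 4 * Real.log 2) ^ k * Real.exp k :=
        mul_le_mul_of_nonneg_left h3 (by positivity)
    _ = (1 / 4 * Real.log 2 * Real.exp 1) ^ k := by
        rw [mul_pow _ (Real.exp 1), ← Real.exp_nat_mul, mul_one]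
    _ ≤ (1 / 2) ^ k := by
        refine pow_le_pow_left₀ (by positivity) ?_ k
        have h4 := Real.log_two_lt_d9
        have h5 := Real.exp_one_lt_d9
        have h6 := Real.exp_pos 1
        nlinarith

lemma tendsto_prob_not_isSEWinner_weakest (σ : ∀ k : ℕ, Equiv.Perm (Fin (2 ^ k)))
    (p : ℕ → unitInterval)
    (hp : ∀ᶠ k in atTop, (p k : ℝ) ≤ 1 / 4 * Real.log ((2 : ℝ) ^ k) / (2 : ℝ) ^ k) :
    Tendsto (fun k => (upsetMeasure (2 ^ k) (p k)).real
      {ω | ¬ IsSEWinner (crTournament (σ k) ω) (weakest (σ k))}) atTop (𝓝 1) := by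
  have hlim : Tendsto (fun k : ℕ => 1 - (1 / 2 : ℝ) ^ k) atTop (𝓝 1) := by
    have := (tendsto_pow_atTop_nhds_zero_of_lt_one (r := (1 / 2 : ℝ)) (by norm_num)
      (by norm_num)).const_sub 1
    simpa using this
  refine tendsto_of_tendsto_of_tendsto_of_le_of_le' hlim tendsto_const_nhds ?_
    (Eventually.of_forall fun k => measureReal_le_one)
  filter_upwards [hp] with k hk
  have h1 := prob_isSEWinner_weakest_le_half_pow (σ k) (p k) hk
  have h2 : (upsetMeasure (2 ^ k) (p k)).real Set.univ = 1 := probReal_univ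
  have h3 : (Set.univ : Set (Upsets (2 ^ k))) ⊆
      {ω | IsSEWinner (crTournament (σ k) ω) (weakest (σ k))} ∪
        {ω | ¬ IsSEWinner (crTournament (σ k) ω) (weakest (σ k))} := fun ω _ => em _
  have := (measureReal_mono h3 (measure_ne_top _ _)).trans
    (measureReal_union_le (μ := upsetMeasure (2 ^ k) (p k)) _ _)
  linarith

end SETournament

theorem theorem4p1 :
    -- one polynomial-time algorithm finds winning seedings for all players
    (∃ P : Program, P.IsPolyTime ∧
      ∃ c : ℝ, 0 < c ∧ ∀ C : ℝ, 64 ≤ C → ∃ nC : ℕ, ∀ k : ℕ, nC < 2 ^ k →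
        ∀ (σ : Equiv.Perm (Fin (2 ^ k))) (p : unitInterval),
          C * Real.log ((2 : ℝ) ^ k) / (2 : ℝ) ^ k ≤ (p : ℝ) → (p : ℝ) < 1 / 2 →
          1 - 1 / (c * ((2 : ℝ) ^ k) ^ 2) ≤
            (upsetMeasure (2 ^ k) p).real
              {ω | ∀ v : Fin (2 ^ k), ∃ s : Equiv.Perm (Fin (2 ^ k)),
                P.Outputs (crTournament σ ω) v s ∧
                  IsWinningSeeding (crTournament σ ω) v s}) ∧
    -- optimality of the noise level, up to constants
    (∃ ε : ℝ, 0 < ε ∧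
      ∀ (σ : ∀ k : ℕ, Equiv.Perm (Fin (2 ^ k))) (p : ℕ → unitInterval),
        (∀ᶠ k in atTop, (p k : ℝ) ≤ ε * Real.log ((2 : ℝ) ^ k) / (2 : ℝ) ^ k) →
        Tendsto (fun k => (upsetMeasure (2 ^ k) (p k)).real
          {ω | ¬ IsSEWinner (crTournament (σ k) ω) (weakest (σ k))}) atTop (𝓝 1)) := by
  refine ⟨⟨Algo.main.toProgram, Algo.main_isPolyTime, 1 / 2, by norm_num, fun C hC =>
    ⟨2 ^ 14, fun k hk σ p hp hp' => ?_⟩⟩, 1 / 4, by norm_num, tendsto_prob_not_isSEWinner_weakest⟩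
  have hk' : 14 < k := (Nat.pow_lt_pow_iff_right (by norm_num)).1 hk
  refine le_trans (le_of_eq ?_) (prob_algorithm_succeeds hk'.le σ p (le_trans ?_ hp) hp')
  · field_simp
  · have : 0 ≤ Real.log ((2 : ℝ) ^ k) := Real.log_nonneg (one_le_pow₀ (by norm_num))
    gcongr
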